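/- Let $K$ be a field with algebraic closure $\overline K$. A variety over $K$ is the set of points of $\overline K^m$ satisfying a system of polynomial equations with coefficients in $K$. Irreducibility, irreducible components, dimension, degree and Zariski closure are taken over $\overline K$: the dimension of a variety is the largest dimension of its components, and the degree of an irreducible variety of dimension $d$ in $\mathbb A^m$ is its number of intersection points with a generic linear (affine) subvariety of codimension $d$. An algebraic subgroup of $\mathrm{SL}_n$ over $K$ is a subgroup of $\mathrm{SL}_n(\overline K)$ that is a variety over $K$ in the affine space $\mathbb A^{n^2}$ of $n\times n$ matrices. An algebraic group $G$ over $K$ is almost simple if it has no normal algebraic subgroup $H$ over $K$ with $0<\dim H<\dim G$. Let $G\subset \mathrm{SL}_n$ be an irreducible, almost simple algebraic group defined over $K$. Let $V',V\subsetneq G$ be subvarieties over $K$ with $V$ non-empty and $\dim V'>0$. Then there is a subvariety $W\subsetneq G$ over $K$ such that, for every $g\in G(\overline K)$ with $g\notin W$, some irreducible component of the Zariski closure $\overline{V'gV}$ has dimension greater than $\dim V$. Moreover, $W$ can be chosen so that the number of its irreducible components and their degrees are bounded by a constant that depends only on $n$ and on the number and degrees of the irreducible components of $V'$ and of $V$ (and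 not on $K$ or $G$). -/

import Mathlib

open scoped Pointwise

section AffineVarieties

variable {σ : Type*} {L : Type*} [Field L]

/-- `V ⊆ L^σ` is an affine variety defined over `K`: the set of all `L`-points at which a system
of polynomials with coefficients in `K` vanishes. In use, `L` is an algebraic closure of `K`. -/
def IsVarietyOver (K : Type*) [Field K] [Algebra K L] (V : Set (σ → L)) : Prop :=
  ∃ S : Set (MvPolynomial σ K), V = {x | ∀ p ∈ S, MvPolynomial.aeval x p = 0}

/-- The Zariski closure of a set of points: the smallest variety (over `L`) containing it. -/
def zariskiClosure (S : Set (σ → L)) : Set (σ → L) :=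
  ⋂₀ {V | IsVarietyOver L V ∧ S ⊆ V}

/-- A nonempty variety over `L` that is not the union of two proper subvarieties. -/
def IsIrreducibleVariety (V : Set (σ → L)) : Prop :=
  IsVarietyOver L V ∧ V.Nonempty ∧
    ∀ V₁ V₂ : Set (σ → L), IsVarietyOver L V₁ → IsVarietyOver L V₂ →
      V = V₁ ∪ V₂ → V₁ = V ∨ V₂ = V

/-- The irreducible components of `V`: its maximal irreducible subvarieties. -/
def varietyComponents (V : Set (σ → L)) : Set (Set (σ → L)) :=
  {Z | Maximal (fun Y => IsIrreducibleVariety Y ∧ Y ⊆ V) Z}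

/-- The dimension of `V`: the supremum of the lengths `d` of chains
`V₀ ⊊ V₁ ⊊ ⋯ ⊊ V_d ⊆ V` of (nonempty) irreducible varieties; it is `⊥` for `V = ∅`. For reducible
`V` this is the largest dimension of a component. -/
noncomputable def varietyDim (V : Set (σ → L)) : WithBot ℕ∞ :=
  Order.krullDim {Z : Set (σ → L) // IsIrreducibleVariety Z ∧ Z ⊆ V}

/-- `Z`, of dimension `d`, has degree `k`: it meets a generic linear (affine) subspace
`{x | A x = b}` of codimension `d` in exactly `k` points. Generic means: outside the zero set of
some nonzero polynomial in the entries of `A` (a `d × σ` matrix, generically of rank `d`)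
and of `b`. -/
def HasVarietyDegree [Fintype σ] (Z : Set (σ → L)) (k : ℕ) : Prop :=
  ∃ d : ℕ, varietyDim Z = (d : WithBot ℕ∞) ∧
    ∃ P : MvPolynomial ((Fin d × σ) ⊕ Fin d) L, P ≠ 0 ∧
      ∀ (A : Matrix (Fin d) σ L) (b : Fin d → L),
        MvPolynomial.eval (Sum.elim (fun p => A p.1 p.2) b) P ≠ 0 →
          {x | x ∈ Z ∧ A.mulVec x = b}.encard = (k : ℕ∞)

/-- `V` has at most `N` irreducible components, each of degree at most `D`. -/
def HasBoundedComponents [Fintype σ] (V : Set (σ → L)) (N D : ℕ) : Prop :=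
  (varietyComponents V).encard ≤ (N : ℕ∞) ∧
    ∀ Z ∈ varietyComponents V, ∃ k ≤ D, HasVarietyDegree Z k

end AffineVarieties

section LinearGroups

variable {n : ℕ} {L : Type*} [Field L]

/-- A set of matrices in `SL_n(L)`, as a set of points of the affine space `L^(n × n)`. -/
def matrixPoints (S : Set (Matrix.SpecialLinearGroup (Fin n) L)) : Set (Fin n × Fin n → L) :=
  (fun (g : Matrix.SpecialLinearGroup (Fin n) L) (p : Fin n × Fin n) => g.1 p.1 p.2) '' S

/-- `G ≤ SL_n(L)` is (the group of `L`-points of) an algebraic subgroup of `SL_n` defined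
over `K`. -/
def IsAlgebraicSubgroupOver (K : Type*) [Field K] [Algebra K L]
    (G : Subgroup (Matrix.SpecialLinearGroup (Fin n) L)) : Prop :=
  IsVarietyOver K (matrixPoints (G : Set (Matrix.SpecialLinearGroup (Fin n) L)))

/-- `G` has no normal algebraic subgroup `H` (over `K`) with `0 < dim H < dim G`. -/
def IsAlmostSimpleOver (K : Type*) [Field K] [Algebra K L]
    (G : Subgroup (Matrix.SpecialLinearGroup (Fin n) L)) : Prop :=
  ∀ H : Subgroup (Matrix.SpecialLinearGroup (Fin n) L),
    IsAlgebraicSubgroupOver K H → H ≤ G → (∀ g ∈ G, ∀ h ∈ H, g * h * g⁻¹ ∈ H) →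
      ¬ (0 < varietyDim (matrixPoints (H : Set (Matrix.SpecialLinearGroup (Fin n) L))) ∧
        varietyDim (matrixPoints (H : Set (Matrix.SpecialLinearGroup (Fin n) L))) <
          varietyDim (matrixPoints (G : Set (Matrix.SpecialLinearGroup (Fin n) L))))

end LinearGroups

/-! Let `Z` be a component of `V` of largest dimension and let `x`, `y` lie in one component `X` of
`V'`. For `g` in `G` the closure of `X g Z` is irreducible and contains the translate `x g Z`. If
its dimension does not exceed that of `Z`, it equals `x g Z`, and then `g⁻¹ x⁻¹ y g` maps `Z` into
itself. Accordingly `growthObstruction` takes for `W` the elements `g` of `G` for which all these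
conjugates send `Z` into the zero set of the polynomials of degree at most `D` vanishing on `Z`,
where `D` bounds the degrees of the components of `V`. Off `W` the dimension grows
(`exists_component_of_notMem_growthObstruction`).

`W` is proper (`growthObstruction_ssubset`). If `W = G`, the common zeros in `G` of those
polynomials are stable under all conjugates of the elements `x⁻¹ y` and of their Galois images. The
elements of `G` all of whose conjugates stabilise a given closed set form a normal closed subgroup,
defined over `K` by Galois descent (`IsVarietyOver.descend`). Here it has positive dimension, so it
is `G`, and the common zeros fill `G` (`eq_of_forall_conj_mul_mem`). This is absurd, since an
irreducible variety of degree `k` lies on a hypersurface of degree at most `k` not containing a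
given larger-dimensional irreducible variety (`exists_mem_vanishingIdeal_of_hasVarietyDegree`). The
same descent shows that `W` is defined over `K`.

For the bounds, `W` is cut out on `G` by polynomials of degree at most `(n + 1) D`, but nothing is
assumed about the degree of `G`. Complexity is measured by Hilbert functions: `HilbBound c Z` allows
growth at most `c (t + 1) ^ dim Z`. A hypersurface section of degree `d` multiplies `c` by a power
of `d + 1`, and a lower bound for Hilbert functions counts components, which gives `bezout`. Degree
and complexity control each other (`HilbBound.of_hasVarietyDegree`,
`IsIrreducibleVariety.exists_hasVarietyDegree`). Finally, `G` is reached from a curve inside `V'` by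
at most `n²` multiplications with conjugates of that curve, each raising the dimension by exactly
one and multiplying the complexity by that of the curve (`HilbBound.of_subset_almostSimple`). -/

open scoped Pointwise

/-! ### Transcendence degree of quotients of finitely generated domains. -/

section TranscendenceDegree

open Algebra Cardinal

variable {k A : Type*} [Field k] [CommRing A] [IsDomain A] [Algebra k A]

/-- The transcendence degree drops when passing to a proper irreducible closed subset. -/
theorem trdeg_quotient_add_one_le [Algebra.FiniteType k A] (P : Ideal A) [P.IsPrime]
    (hP : P ≠ ⊥) : trdeg k (A ⧸ P) + 1 ≤ trdeg k A := by
  have : FaithfulSMul k (A ⧸ P) :=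
    (faithfulSMul_iff_algebraMap_injective k (A ⧸ P)).2 (algebraMap k (A ⧸ P)).injective
  obtain ⟨ι, y, hy⟩ := exists_isTranscendenceBasis' k (A ⧸ P)
  choose x hx using fun i => Ideal.Quotient.mk_surjective (I := P) (y i)
  have hx' : (Ideal.Quotient.mkₐ k P) ∘ x = y := funext hx
  have hindep : AlgebraicIndependent k x :=
    AlgebraicIndependent.of_comp (Ideal.Quotient.mkₐ k P) (hx' ▸ hy.1)
  have hle := hindep.cardinalMk_le_trdeg
  have hcard := hy.cardinalMk_eq_trdeg
  rw [← hcard]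
  have hfin : trdeg k A < ℵ₀ := trdeg_lt_aleph0_of_finiteType
  have hι : #ι < ℵ₀ := hle.trans_lt hfin
  by_contra hlt
  rw [not_le] at hlt
  have hle' : trdeg k A ≤ #ι := by
    obtain ⟨a, ha⟩ := lt_aleph0.1 hfin
    obtain ⟨b, hb⟩ := lt_aleph0.1 hι
    rw [ha, hb] at hlt ⊢
    norm_cast at hlt ⊢
    omega
  have : Finite ι := by simpa [lt_aleph0_iff_finite] using hι
  -- Without a drop the lifts `x` form a transcendence basis of `A`, so a nonzero element of `P`
  -- divides a nonzero polynomial in them. That polynomial then lies in `P` and is a relation among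
  -- the `y i`.
  have hbasis := hindep.isTranscendenceBasis_of_trdeg_le_of_finite hle'
  obtain ⟨f, hfP, hf0⟩ := Submodule.exists_mem_ne_zero_of_ne_bot hP
  have halg := hbasis.isAlgebraic
  obtain ⟨r, hr0, hdvd⟩ := (halg.1 f).exists_nonzero_dvd (mem_nonZeroDivisors_of_ne_zero hf0)
  obtain ⟨⟨r, hr⟩, rfl⟩ : ∃ r' : adjoin k (Set.range x), r' = r := ⟨r, rfl⟩
  rw [adjoin_range_eq_range_aeval] at hr
  obtain ⟨q, rfl⟩ := hr
  have hq : MvPolynomial.aeval x q ∈ P := P.mem_of_dvd hdvd hfP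
  refine hr0 ?_
  have : MvPolynomial.aeval y q = 0 := by
    rw [← hx', ← Ideal.Quotient.eq_zero_iff_mem.2 hq]
    exact (MvPolynomial.comp_aeval_apply x (Ideal.Quotient.mkₐ k P) q).symm
  have hq0 := hy.1.eq_zero_of_aeval_eq_zero _ this
  ext; simp [hq0]

/-- A nonzero multiple of `g` has positive degree in `X i`, so it cannot be a polynomial in the
other variables alone. -/
theorem trdeg_mvPolynomial_quotient_span_singleton {s : ℕ} {g : MvPolynomial (Fin s) k}
    {i : Fin s} (hi : i ∈ g.vars) :
    AlgebraicIndependent k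
      (fun j : {j : Fin s // j ≠ i} => Ideal.Quotient.mk (Ideal.span {g}) (MvPolynomial.X j.1)) := by
  rw [algebraicIndependent_iff]
  intro p hp
  have h1 : MvPolynomial.aeval (fun j : {j : Fin s // j ≠ i} =>
      Ideal.Quotient.mk (Ideal.span {g}) (MvPolynomial.X j.1)) p =
      Ideal.Quotient.mkₐ k (Ideal.span {g}) (MvPolynomial.rename Subtype.val p) := by
    have : (MvPolynomial.aeval (R := k) (fun j : {j : Fin s // j ≠ i} =>
      Ideal.Quotient.mk (Ideal.span {g}) (MvPolynomial.X j.1))) =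
      (Ideal.Quotient.mkₐ k (Ideal.span {g})).comp (MvPolynomial.rename Subtype.val) := by
      ext; simp
    rw [this]; rfl
  rw [h1, Ideal.Quotient.mkₐ_eq_mk, Ideal.Quotient.eq_zero_iff_mem,
    Ideal.mem_span_singleton] at hp
  obtain ⟨h, hh⟩ := hp
  by_contra hp0
  have hren : MvPolynomial.rename (Subtype.val : {j : Fin s // j ≠ i} → Fin s) p ≠ 0 := by
    intro h; exact hp0 (MvPolynomial.rename_injective _ Subtype.val_injective (by simpa using h))
  have hg0 : g ≠ 0 := by rintro rfl; exact hren (by simpa using hh)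
  have hh0 : h ≠ 0 := by rintro rfl; exact hren (by simpa using hh)
  have hdeg := MvPolynomial.degreeOf_mul_eq (n := i) hg0 hh0
  rw [← hh] at hdeg
  have hz : MvPolynomial.degreeOf i (MvPolynomial.rename
      (Subtype.val : {j : Fin s // j ≠ i} → Fin s) p) = 0 := by
    classical
    rw [← Nat.le_zero, MvPolynomial.degreeOf_le_iff]
    intro m hm
    rw [MvPolynomial.support_rename_of_injective Subtype.val_injective] at hm
    obtain ⟨m', -, rfl⟩ := Finset.mem_image.1 hm
    rw [Finsupp.mapDomain_of_notMem_range]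
    rintro ⟨j, hj⟩; exact j.2 hj
  have : MvPolynomial.degreeOf i g ≠ 0 := by
    rw [MvPolynomial.mem_vars_iff_mem_support] at hi
    obtain ⟨m, hm, him⟩ := hi
    have := MvPolynomial.degreeOf_le_iff.1 (le_refl (MvPolynomial.degreeOf i g)) m hm
    rw [Finsupp.mem_support_iff] at him
    omega
  omega

/-- A prime of height at most one in a finitely generated domain has transcendence codegree
one. -/
theorem trdeg_quotient_add_one_eq [Algebra.FiniteType k A] (P : Ideal A) [P.IsPrime]
    (hP : P ≠ ⊥) (hh : P.height ≤ 1) : trdeg k (A ⧸ P) + 1 = trdeg k A := by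
  refine (trdeg_quotient_add_one_le P hP).antisymm ?_
  -- Noether normalisation reduces to a polynomial ring `B`. By going down the contraction of `P` to
  -- `B` still has height at most one, hence is principal by unique factorisation, and the variables
  -- other than one occurring in its generator stay independent modulo `P`.
  obtain ⟨s, φ, hinj, hint⟩ := exists_integral_inj_algHom_of_fg k A
  let B := MvPolynomial (Fin s) k
  algebraize [φ.toRingHom]
  have : IsScalarTower k B A := IsScalarTower.of_algebraMap_eq fun x => (φ.commutes x).symm
  have hfaith : FaithfulSMul B A := (faithfulSMul_iff_algebraMap_injective B A).2 hinj
  have hInt : Algebra.IsIntegral B A := ⟨hint⟩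
  have hN : IsNoetherianRing A := Algebra.FiniteType.isNoetherianRing k A
  let p := P.under B
  have hp0 : p ≠ ⊥ := by
    obtain ⟨f, hfP, hf0⟩ := Submodule.exists_mem_ne_zero_of_ne_bot hP
    exact Ideal.comap_ne_bot_of_integral_mem hf0 hfP (hInt.1 f)
  have hph : p.height ≤ 1 := by
    have := Ideal.height_eq_height_add_of_liesOver_of_hasGoingDown p P
    exact (this ▸ le_self_add).trans hh
  obtain ⟨f, hfp, hf0⟩ := Submodule.exists_mem_ne_zero_of_ne_bot hp0
  obtain ⟨g, hgp, hg⟩ := Ideal.IsPrime.exists_mem_prime_of_ne_bot (I := p) inferInstance hp0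
  have hspan : Ideal.span {g} = p := by
    have : (Ideal.span {g}).IsPrime := (Ideal.span_singleton_prime hg.ne_zero).2 hg
    by_contra hne
    have hlt : Ideal.span {g} < p := lt_of_le_of_ne (by simpa [Ideal.span_le] using hgp) hne
    have h1 := Ideal.height_strict_mono_of_isPrime_of_isPrime hlt
    have h2 : (⊥ : Ideal B) < Ideal.span {g} := by
      rw [bot_lt_iff_ne_bot]; simpa [Ideal.span_singleton_eq_bot] using hg.ne_zero
    have h3 := Ideal.height_strict_mono_of_isPrime_of_isPrime h2
    have h4 := Order.one_le_iff_pos.2 (pos_of_gt h3)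
    exact absurd (h1.trans_le hph) (not_lt.2 h4)
  have hvars : g.vars.Nonempty := by
    rw [Finset.nonempty_iff_ne_empty]
    intro h
    rw [MvPolynomial.vars_eq_empty_iff_eq_C] at h
    refine hg.not_isUnit ?_
    rw [h]
    refine IsUnit.map _ (isUnit_iff_ne_zero.2 fun h0 => hg.ne_zero ?_)
    rw [h, h0, map_zero]
  obtain ⟨i, hi⟩ := hvars
  have hind := trdeg_mvPolynomial_quotient_span_singleton hi
  have htA : trdeg k A = s := by
    have h1 := (IsTranscendenceBasis.mvPolynomial (Fin s) k).algebraMap_comp (A := A)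
    simpa using h1.lift_cardinalMk_eq_trdeg.symm
  rw [hspan] at hind
  have hinjq : Function.Injective (algebraMap (B ⧸ p) (A ⧸ P)) :=
    Ideal.algebraMap_quotient_injective
  have hind' := hind.map' (f := IsScalarTower.toAlgHom k (B ⧸ p) (A ⧸ P)) hinjq
  have h1 := hind'.lift_cardinalMk_le_trdeg
  have h2 : Fintype.card {j : Fin s // j ≠ i} + 1 = s := by
    have := i.pos
    simp only [ne_eq, Fintype.card_subtype_compl, Fintype.card_fin, Fintype.card_unique]
    omega
  rw [htA]
  simp only [mk_fintype, lift_natCast, lift_id'] at h1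
  calc (s : Cardinal) = (Fintype.card {j : Fin s // j ≠ i} : Cardinal) + 1 := by
        exact_mod_cast h2.symm
    _ ≤ _ := by gcongr

end TranscendenceDegree

/-! ### Varieties, prime ideals, components and dimension. -/

section Varieties

open MvPolynomial

variable {σ L : Type*} [Field L]

theorem isVarietyOver_zeroLocus (I : Ideal (MvPolynomial σ L)) :
    IsVarietyOver L (zeroLocus L I) := ⟨I, rfl⟩

theorem IsVarietyOver.zeroLocus_vanishingIdeal {V : Set (σ → L)} (hV : IsVarietyOver L V) :
    zeroLocus L (vanishingIdeal L V) = V := by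
  refine (zeroLocus_vanishingIdeal_le V).antisymm' fun x hx => ?_
  obtain ⟨S, rfl⟩ := hV
  exact fun p hp => hx p fun y hy => hy p hp

theorem IsVarietyOver.subset_iff {V W : Set (σ → L)} (hV : IsVarietyOver L V) :
    W ⊆ V ↔ vanishingIdeal L V ≤ vanishingIdeal L W := by
  refine ⟨fun h => vanishingIdeal_anti_mono h, fun h => ?_⟩
  rw [← hV.zeroLocus_vanishingIdeal]
  exact le_zeroLocus_iff_le_vanishingIdeal.2 h

theorem IsVarietyOver.eq_of_vanishingIdeal_eq {V W : Set (σ → L)} (hV : IsVarietyOver L V)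
    (hW : IsVarietyOver L W) (h : vanishingIdeal L V = vanishingIdeal L W) : V = W := by
  rw [← hV.zeroLocus_vanishingIdeal, h, hW.zeroLocus_vanishingIdeal]

theorem IsVarietyOver.sInter {K : Type*} [Field K] [Algebra K L] {𝒱 : Set (Set (σ → L))}
    (h : ∀ V ∈ 𝒱, IsVarietyOver K V) : IsVarietyOver K (⋂₀ 𝒱) := by
  choose! S hS using h
  refine ⟨⋃ V ∈ 𝒱, S V, ?_⟩
  ext x
  simp only [Set.mem_sInter, Set.mem_iUnion, Set.mem_ofPred_eq]
  constructor
  · rintro h p ⟨V, hV, hp⟩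
    have := h V hV
    rw [hS V hV] at this
    exact this p hp
  · intro h V hV
    rw [hS V hV]
    exact fun p hp => h p ⟨V, hV, hp⟩

theorem IsVarietyOver.iInter {ι : Sort*} {K : Type*} [Field K] [Algebra K L] {V : ι → Set (σ → L)}
    (h : ∀ i, IsVarietyOver K (V i)) : IsVarietyOver K (⋂ i, V i) :=
  IsVarietyOver.sInter (by rintro _ ⟨i, rfl⟩; exact h i)

theorem IsVarietyOver.inter {K : Type*} [Field K] [Algebra K L] {V W : Set (σ → L)}
    (hV : IsVarietyOver K V) (hW : IsVarietyOver K W) : IsVarietyOver K (V ∩ W) := by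
  rw [← Set.sInter_pair]
  exact IsVarietyOver.sInter (by rintro _ (rfl | rfl) <;> assumption)

theorem IsVarietyOver.union {K : Type*} [Field K] [Algebra K L] {V W : Set (σ → L)}
    (hV : IsVarietyOver K V) (hW : IsVarietyOver K W) : IsVarietyOver K (V ∪ W) := by
  obtain ⟨S, rfl⟩ := hV
  obtain ⟨T, rfl⟩ := hW
  refine ⟨Set.image2 (· * ·) S T, ?_⟩
  ext x
  simp only [Set.mem_union, Set.mem_ofPred_eq]
  constructor
  · rintro (h | h) _ ⟨p, hp, q, hq, rfl⟩
    · simp [h p hp]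
    · simp [h q hq]
  · intro h
    by_contra! hc
    obtain ⟨⟨p, hp, hp'⟩, q, hq, hq'⟩ := hc
    have := h _ ⟨p, hp, q, hq, rfl⟩
    simp [hp', hq'] at this

theorem isVarietyOver_setOf_aeval_eq_zero {K : Type*} [Field K] [Algebra K L]
    (p : MvPolynomial σ K) : IsVarietyOver K {x : σ → L | aeval x p = 0} :=
  ⟨{p}, by simp⟩

theorem isVarietyOver_empty : IsVarietyOver L (∅ : Set (σ → L)) :=
  ⟨{1}, by ext; simp⟩

theorem isVarietyOver_univ : IsVarietyOver L (Set.univ : Set (σ → L)) :=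
  ⟨∅, by ext; simp⟩

theorem IsVarietyOver.baseChange {K : Type*} [Field K] [Algebra K L] {V : Set (σ → L)}
    (hV : IsVarietyOver K V) : IsVarietyOver L V := by
  obtain ⟨S, rfl⟩ := hV
  refine ⟨MvPolynomial.map (algebraMap K L) '' S, ?_⟩
  ext x
  simp only [Set.mem_ofPred_eq, Set.forall_mem_image, aeval_map_algebraMap]

theorem isVarietyOver_singleton (x : σ → L) : IsVarietyOver L {x} := by
  refine ⟨Set.range fun i => X i - C (x i), ?_⟩
  ext y
  simp [funext_iff, sub_eq_zero]

theorem zariskiClosure_eq (S : Set (σ → L)) :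
    zariskiClosure S = zeroLocus L (vanishingIdeal L S) := by
  apply subset_antisymm
  · exact Set.sInter_subset_of_mem ⟨isVarietyOver_zeroLocus _, zeroLocus_vanishingIdeal_le S⟩
  · rintro x hx V ⟨hV, hSV⟩
    rw [← hV.zeroLocus_vanishingIdeal]
    exact zeroLocus_anti_mono (vanishingIdeal_anti_mono hSV) hx

theorem isVarietyOver_zariskiClosure (S : Set (σ → L)) : IsVarietyOver L (zariskiClosure S) :=
  IsVarietyOver.sInter fun _ hV => hV.1

theorem subset_zariskiClosure (S : Set (σ → L)) : S ⊆ zariskiClosure S :=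
  Set.subset_sInter fun _ hV => hV.2

theorem zariskiClosure_subset {S V : Set (σ → L)} (hV : IsVarietyOver L V) (h : S ⊆ V) :
    zariskiClosure S ⊆ V := Set.sInter_subset_of_mem ⟨hV, h⟩

theorem vanishingIdeal_zariskiClosure (S : Set (σ → L)) :
    vanishingIdeal L (zariskiClosure S) = vanishingIdeal L S := by
  rw [zariskiClosure_eq]
  exact zeroLocus_vanishingIdeal_galoisConnection.u_l_u_eq_u S

theorem isIrreducibleVariety_iff {Z : Set (σ → L)} :
    IsIrreducibleVariety Z ↔ IsVarietyOver L Z ∧ (vanishingIdeal L Z).IsPrime := by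
  constructor
  · rintro ⟨hZ, ⟨z, hz⟩, h⟩
    refine ⟨hZ, ?_, fun {f g} hfg => ?_⟩
    · rw [Ideal.ne_top_iff_one]
      intro h1
      simpa using h1 z hz
    · have hU : Z = (Z ∩ {x | aeval x f = 0}) ∪ (Z ∩ {x | aeval x g = 0}) := by
        rw [← Set.inter_union_distrib_left, eq_comm, Set.inter_eq_left]
        intro x hx
        simpa using hfg x hx
      rcases h _ _ (hZ.inter (isVarietyOver_setOf_aeval_eq_zero f))
        (hZ.inter (isVarietyOver_setOf_aeval_eq_zero g)) hU with h | h
      · exact Or.inl fun x hx => (Set.inter_eq_left.1 h hx :)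
      · exact Or.inr fun x hx => (Set.inter_eq_left.1 h hx :)
  · rintro ⟨hZ, hP⟩
    refine ⟨hZ, ?_, fun V₁ V₂ h₁ h₂ hU => ?_⟩
    · rw [Set.nonempty_iff_ne_empty]
      rintro rfl
      exact hP.ne_top vanishingIdeal_empty
    · by_contra! hc
      have key : ∀ V : Set (σ → L), IsVarietyOver L V → V ⊆ Z → V ≠ Z →
          ∃ f ∈ vanishingIdeal L V, f ∉ vanishingIdeal L Z := by
        intro V hV hVZ hne
        by_contra! hle
        exact hne (hVZ.antisymm (hV.subset_iff.2 hle))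
      obtain ⟨f, hf, hf'⟩ := key V₁ h₁ (hU ▸ Set.subset_union_left) hc.1
      obtain ⟨g, hg, hg'⟩ := key V₂ h₂ (hU ▸ Set.subset_union_right) hc.2
      have : f * g ∈ vanishingIdeal L Z := by
        intro x hx
        rw [hU] at hx
        rcases hx with hx | hx
        · rw [map_mul, hf x hx, zero_mul]
        · rw [map_mul, hg x hx, mul_zero]
      exact (hP.mem_or_mem this).elim hf' hg'

theorem IsIrreducibleVariety.isPrime {Z : Set (σ → L)} (hZ : IsIrreducibleVariety Z) :
    (vanishingIdeal L Z).IsPrime := (isIrreducibleVariety_iff.1 hZ).2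

theorem isIrreducibleVariety_singleton (x : σ → L) : IsIrreducibleVariety {x} :=
  isIrreducibleVariety_iff.2 ⟨isVarietyOver_singleton x, inferInstance⟩

theorem IsIrreducibleVariety.subset_or_subset {Z V₁ V₂ : Set (σ → L)}
    (hZ : IsIrreducibleVariety Z) (h₁ : IsVarietyOver L V₁) (h₂ : IsVarietyOver L V₂)
    (h : Z ⊆ V₁ ∪ V₂) : Z ⊆ V₁ ∨ Z ⊆ V₂ := by
  have := hZ.2.2 (Z ∩ V₁) (Z ∩ V₂) (hZ.1.inter h₁) (hZ.1.inter h₂)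
    (by rw [← Set.inter_union_distrib_left]; exact (Set.inter_eq_left.2 h).symm)
  simpa [Set.inter_eq_left] using this

variable [IsAlgClosed L] [Finite σ]

theorem isIrreducibleVariety_zeroLocus (P : Ideal (MvPolynomial σ L)) [hP : P.IsPrime] :
    IsIrreducibleVariety (zeroLocus L P) :=
  isIrreducibleVariety_iff.2 ⟨isVarietyOver_zeroLocus P, by
    rwa [IsPrime.vanishingIdeal_zeroLocus]⟩

/-- By the Nullstellensatz, maximal irreducible closed subsets correspond to minimal primes. This
gives finiteness of components and makes Krull's theorem applicable to them. -/
theorem mem_varietyComponents_zeroLocus_iff {I : Ideal (MvPolynomial σ L)} {Z : Set (σ → L)} :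
    Z ∈ varietyComponents (zeroLocus L I) ↔
      IsVarietyOver L Z ∧ vanishingIdeal L Z ∈ I.minimalPrimes := by
  constructor
  · rintro ⟨⟨hZ, hsub⟩, hmax⟩
    refine ⟨hZ.1, ⟨hZ.isPrime, le_zeroLocus_iff_le_vanishingIdeal.1 hsub⟩, fun q hq hle => ?_⟩
    have := hq.1
    have h1 : Z ⊆ zeroLocus L q := le_zeroLocus_iff_le_vanishingIdeal.2 hle
    have h2 := hmax ⟨isIrreducibleVariety_zeroLocus q, zeroLocus_anti_mono hq.2⟩ h1
    rw [← IsPrime.vanishingIdeal_zeroLocus (K := L) q]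
    exact vanishingIdeal_anti_mono h2
  · rintro ⟨hZ, hmin⟩
    refine ⟨⟨isIrreducibleVariety_iff.2 ⟨hZ, hmin.1.1⟩,
      le_zeroLocus_iff_le_vanishingIdeal.2 hmin.1.2⟩, fun Y hY hle => ?_⟩
    exact hZ.subset_iff.2 (hmin.2 ⟨hY.1.isPrime, le_zeroLocus_iff_le_vanishingIdeal.1 hY.2⟩
      (vanishingIdeal_anti_mono hle))

theorem IsVarietyOver.finite_varietyComponents {V : Set (σ → L)} (hV : IsVarietyOver L V) :
    (varietyComponents V).Finite := by
  rw [← hV.zeroLocus_vanishingIdeal]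
  refine Set.Finite.of_finite_image (f := vanishingIdeal L)
    ((Ideal.finite_minimalPrimes_of_isNoetherianRing _ (vanishingIdeal L V)).subset ?_) ?_
  · rintro _ ⟨Z, hZ, rfl⟩
    exact (mem_varietyComponents_zeroLocus_iff.1 hZ).2
  · intro Z hZ Y hY h
    exact hZ.1.1.1.eq_of_vanishingIdeal_eq hY.1.1.1 h

theorem IsVarietyOver.exists_varietyComponent {V Y : Set (σ → L)} (hV : IsVarietyOver L V)
    (hY : IsIrreducibleVariety Y) (h : Y ⊆ V) : ∃ Z ∈ varietyComponents V, Y ⊆ Z := by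
  have := hY.isPrime
  obtain ⟨p, hp, hle⟩ := Ideal.exists_minimalPrimes_le (vanishingIdeal_anti_mono (k := L) h)
  have hpp := hp.1.1
  refine ⟨zeroLocus L p, ?_, le_zeroLocus_iff_le_vanishingIdeal.2 hle⟩
  rw [← hV.zeroLocus_vanishingIdeal]
  refine mem_varietyComponents_zeroLocus_iff.2 ⟨isVarietyOver_zeroLocus p, ?_⟩
  rwa [IsPrime.vanishingIdeal_zeroLocus]

theorem IsVarietyOver.exists_mem_varietyComponent {V : Set (σ → L)} (hV : IsVarietyOver L V)
    {x : σ → L} (hx : x ∈ V) : ∃ Z ∈ varietyComponents V, x ∈ Z := by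
  obtain ⟨Z, hZ, h⟩ := hV.exists_varietyComponent (isIrreducibleVariety_singleton x)
    (Set.singleton_subset_iff.2 hx)
  exact ⟨Z, hZ, h rfl⟩

/-- The dimension of an irreducible variety, as the transcendence degree of its coordinate
ring. -/
noncomputable def coordTrdeg (Z : Set (σ → L)) : ℕ :=
  Cardinal.toNat (Algebra.trdeg L (MvPolynomial σ L ⧸ vanishingIdeal L Z))

theorem IsIrreducibleVariety.coe_coordTrdeg {Z : Set (σ → L)} (hZ : IsIrreducibleVariety Z) :
    (coordTrdeg Z : Cardinal) = Algebra.trdeg L (MvPolynomial σ L ⧸ vanishingIdeal L Z) := by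
  have := hZ.isPrime
  exact Cardinal.cast_toNat_of_lt_aleph0 trdeg_lt_aleph0_of_finiteType

omit [IsAlgClosed L] [Finite σ] in
theorem trdeg_quotQuot {I J : Ideal (MvPolynomial σ L)} (h : I ≤ J) :
    Algebra.trdeg L ((MvPolynomial σ L ⧸ I) ⧸ J.map (Ideal.Quotient.mk I)) =
      Algebra.trdeg L (MvPolynomial σ L ⧸ J) :=
  (DoubleQuot.quotQuotEquivQuotOfLEₐ L h).trdeg_eq

theorem IsIrreducibleVariety.coordTrdeg_lt {Y Z : Set (σ → L)} (hY : IsIrreducibleVariety Y)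
    (hZ : IsIrreducibleVariety Z) (h : Y ⊂ Z) : coordTrdeg Y < coordTrdeg Z := by
  have hle : vanishingIdeal L Z ≤ vanishingIdeal L Y := vanishingIdeal_anti_mono h.1
  have := hY.isPrime
  have := hZ.isPrime
  have := Ideal.isPrime_map_quotientMk_of_isPrime hle
  have key := trdeg_quotient_add_one_le (k := L)
    ((vanishingIdeal L Y).map (Ideal.Quotient.mk (vanishingIdeal L Z))) (by
      rw [Ne, Ideal.map_eq_bot_iff_le_ker, Ideal.mk_ker]
      exact fun h' => h.2 (hY.1.subset_iff.2 h'))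
  rw [trdeg_quotQuot hle, ← hY.coe_coordTrdeg, ← hZ.coe_coordTrdeg] at key
  exact_mod_cast key

/-- **Krull's principal ideal theorem** for varieties. -/
theorem IsIrreducibleVariety.coordTrdeg_component {Y Z : Set (σ → L)}
    (hY : IsIrreducibleVariety Y) {f : MvPolynomial σ L} (hf : f ∉ vanishingIdeal L Y)
    (hZ : Z ∈ varietyComponents (Y ∩ {x | aeval x f = 0})) :
    coordTrdeg Z + 1 = coordTrdeg Y := by
  have heq : Y ∩ {x | aeval x f = 0} = zeroLocus L (vanishingIdeal L Y ⊔ Ideal.span {f}) := by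
    ext x
    refine ⟨fun hx => ?_, fun hx => ⟨?_, hx f (le_sup_right (a := vanishingIdeal L Y)
      (Ideal.mem_span_singleton_self f))⟩⟩
    · have : vanishingIdeal L Y ⊔ Ideal.span {f} ≤ vanishingIdeal L {x} := by
        refine sup_le (vanishingIdeal_anti_mono (Set.singleton_subset_iff.2 hx.1)) ?_
        rw [Ideal.span_singleton_le_iff_mem, mem_vanishingIdeal_singleton_iff]
        exact hx.2
      exact fun p hp => this hp x rfl
    · rw [← hY.1.zeroLocus_vanishingIdeal]
      exact zeroLocus_anti_mono le_sup_left hx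
  rw [heq] at hZ
  have hmin := (mem_varietyComponents_zeroLocus_iff.1 hZ).2
  have hle : vanishingIdeal L Y ≤ vanishingIdeal L Z := le_sup_left.trans hmin.1.2
  have hfZ : f ∈ vanishingIdeal L Z :=
    (le_sup_right.trans hmin.1.2) (Ideal.mem_span_singleton_self f)
  have := hZ.1.1.isPrime
  have := hY.isPrime
  have := Ideal.isPrime_map_quotientMk_of_isPrime hle
  have key := trdeg_quotient_add_one_eq (k := L)
    ((vanishingIdeal L Z).map (Ideal.Quotient.mk (vanishingIdeal L Y))) (by
      rw [Ne, Ideal.map_eq_bot_iff_le_ker, Ideal.mk_ker]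
      exact fun h' => hf (h' hfZ)) (by
      refine Ideal.height_le_one_of_isPrincipal_of_mem_minimalPrimes
        (Ideal.span {Ideal.Quotient.mk (vanishingIdeal L Y) f}) _ ?_
      rw [← Set.image_singleton, ← Ideal.map_span, Ideal.minimalPrimes_map_of_surjective
        Ideal.Quotient.mk_surjective, Ideal.mk_ker, sup_comm]
      exact ⟨_, hmin, rfl⟩)
  rw [trdeg_quotQuot hle, ← hZ.1.1.coe_coordTrdeg, ← hY.coe_coordTrdeg] at key
  exact_mod_cast key

omit [IsAlgClosed L] [Finite σ] in
theorem coordTrdeg_singleton (x : σ → L) : coordTrdeg ({x} : Set (σ → L)) = 0 := by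
  have : Algebra.IsAlgebraic L (MvPolynomial σ L ⧸ vanishingIdeal L {x}) := by
    refine ⟨fun a => ?_⟩
    obtain ⟨p, rfl⟩ := Ideal.Quotient.mk_surjective a
    have : Ideal.Quotient.mk (vanishingIdeal L {x}) p =
        algebraMap L (MvPolynomial σ L ⧸ vanishingIdeal L {x}) (aeval x p) := by
      rw [← sub_eq_zero, IsScalarTower.algebraMap_apply L (MvPolynomial σ L),
        Ideal.Quotient.algebraMap_eq, ← map_sub, Ideal.Quotient.eq_zero_iff_mem]
      intro y hy
      rw [Set.mem_singleton_iff.1 hy]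
      simp
    rw [this]
    exact isAlgebraic_algebraMap _
  rw [coordTrdeg, trdeg_eq_zero_iff.2 this, map_zero]

/-- Cut by a polynomial that vanishes at one point of `Z` but not on `Z`: the component through that
point has codimension one by Krull. -/
theorem IsIrreducibleVariety.exists_coordTrdeg_succ {Z : Set (σ → L)}
    (hZ : IsIrreducibleVariety Z) (h : coordTrdeg Z ≠ 0) :
    ∃ Y, IsIrreducibleVariety Y ∧ Y ⊂ Z ∧ coordTrdeg Y + 1 = coordTrdeg Z := by
  obtain ⟨z, hz⟩ := hZ.2.1
  have : ¬ vanishingIdeal L {z} ≤ vanishingIdeal L Z := by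
    intro hle
    have := (isVarietyOver_singleton z).subset_iff.2 hle
    have hZz : Z = {z} := this.antisymm (Set.singleton_subset_iff.2 hz)
    exact h (hZz ▸ coordTrdeg_singleton z)
  obtain ⟨f, hfz, hfZ⟩ := Set.not_subset.1 this
  obtain ⟨Y, hY, hzY⟩ := (hZ.1.inter (isVarietyOver_setOf_aeval_eq_zero f)).exists_mem_varietyComponent
    (x := z) ⟨hz, hfz z rfl⟩
  refine ⟨Y, hY.1.1, ⟨hY.1.2.trans Set.inter_subset_left, fun hle => hfZ fun x hx => ?_⟩,
    hZ.coordTrdeg_component hfZ hY⟩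
  exact (hY.1.2 (hle hx)).2

/-- Strict monotonicity of `coordTrdeg` bounds the length of chains, and repeated codimension-one
cuts produce a chain of that length. -/
theorem IsIrreducibleVariety.varietyDim_eq {Z : Set (σ → L)} (hZ : IsIrreducibleVariety Z) :
    varietyDim Z = (coordTrdeg Z : WithBot ℕ∞) := by
  let T := {Z : Set (σ → L) // IsIrreducibleVariety Z}
  have e : {Y : Set (σ → L) // IsIrreducibleVariety Y ∧ Y ⊆ Z} ≃o Set.Iic (⟨Z, hZ⟩ : T) :=
    { toFun := fun Y => ⟨⟨Y.1, Y.2.1⟩, Y.2.2⟩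
      invFun := fun Y => ⟨Y.1.1, Y.1.2, Y.2⟩
      left_inv := fun _ => rfl
      right_inv := fun _ => rfl
      map_rel_iff' := Iff.rfl }
  rw [varietyDim, Order.krullDim_eq_of_orderIso e, ← Order.height_eq_krullDim_Iic]
  have hmono : StrictMono fun Y : T => coordTrdeg Y.1 := fun Y Z h => Y.2.coordTrdeg_lt Z.2 h
  have key : Order.height (⟨Z, hZ⟩ : T) = (coordTrdeg Z : ℕ∞) := by
    apply le_antisymm
    · refine Order.height_le fun p hp => ?_
      have := (p.map _ hmono).head_add_length_le_nat
      have h2 : (p.map _ hmono).last = coordTrdeg Z := by simp [hp]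
      rw [h2, LTSeries.map_length] at this
      exact_mod_cast (Nat.le_add_left _ _).trans this
    · have : ∀ n : ℕ, ∀ Y : T, coordTrdeg Y.1 = n → (n : ℕ∞) ≤ Order.height Y := by
        intro n
        induction n with
        | zero => simp
        | succ n ih =>
          intro Y hY
          obtain ⟨W, hW, hlt, hd⟩ := Y.2.exists_coordTrdeg_succ (by omega)
          have h1 := ih ⟨W, hW⟩ (by simp only; omega)
          have h2 : (⟨W, hW⟩ : T) < Y := hlt
          push_cast
          exact (add_le_add_left h1 1).trans (Order.height_add_one_le h2)
      exact this _ ⟨Z, hZ⟩ rfl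
  rw [key]; rfl

theorem IsIrreducibleVariety.coordTrdeg_mono {Y Z : Set (σ → L)} (hY : IsIrreducibleVariety Y)
    (hZ : IsIrreducibleVariety Z) (h : Y ⊆ Z) : coordTrdeg Y ≤ coordTrdeg Z := by
  rcases h.eq_or_ssubset with rfl | h
  · rfl
  · exact (hY.coordTrdeg_lt hZ h).le

theorem IsIrreducibleVariety.eq_of_coordTrdeg_le {Y Z : Set (σ → L)}
    (hY : IsIrreducibleVariety Y) (hZ : IsIrreducibleVariety Z) (h : Y ⊆ Z)
    (hd : coordTrdeg Z ≤ coordTrdeg Y) : Y = Z := by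
  rcases h.eq_or_ssubset with rfl | h
  · rfl
  · exact absurd (hY.coordTrdeg_lt hZ h) (not_lt.2 hd)

omit [IsAlgClosed L] [Finite σ] in
theorem varietyDim_mono {V W : Set (σ → L)} (h : V ⊆ W) : varietyDim V ≤ varietyDim W :=
  Order.krullDim_le_of_strictMono
    (fun Z : {Z : Set (σ → L) // IsIrreducibleVariety Z ∧ Z ⊆ V} =>
      (⟨Z.1, Z.2.1, Z.2.2.trans h⟩ : {Z : Set (σ → L) // IsIrreducibleVariety Z ∧ Z ⊆ W}))
    fun _ _ hlt => hlt

end Varieties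

/-! ### Affine Hilbert functions. -/

section Hilbert

open MvPolynomial

variable {σ L : Type*} [Field L]

/-- Restriction of polynomials to functions on a set of points. -/
noncomputable def restrictFun (S : Set (σ → L)) : MvPolynomial σ L →ₗ[L] (S → L) :=
  LinearMap.pi fun x => (aeval (x : σ → L)).toLinearMap

@[simp] theorem restrictFun_apply (S : Set (σ → L)) (p : MvPolynomial σ L) (x : S) :
    restrictFun S p x = aeval (x : σ → L) p := rfl

theorem restrictFun_eq_zero_iff {S : Set (σ → L)} {p : MvPolynomial σ L} :
    restrictFun S p = 0 ↔ p ∈ vanishingIdeal L S := by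
  simp only [funext_iff, restrictFun_apply, Pi.zero_apply, Subtype.forall]; rfl

/-- The functions on `S` given by polynomials of degree at most `t`. -/
noncomputable def polyFun (S : Set (σ → L)) (t : ℕ) : Submodule L (S → L) :=
  (restrictTotalDegree σ L t).map (restrictFun S)

/-- The affine Hilbert function of a set of points. -/
noncomputable def hilb (S : Set (σ → L)) (t : ℕ) : ℕ := Module.finrank L (polyFun S t)

variable [Finite σ]

instance (S : Set (σ → L)) (t : ℕ) : Module.Finite L (polyFun S t) :=
  inferInstanceAs (Module.Finite L ((restrictTotalDegree σ L t).map (restrictFun S)))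

theorem card_le_hilb {ι : Type*} [Fintype ι] {S : Set (σ → L)} {t : ℕ}
    (v : ι → MvPolynomial σ L) (hv : ∀ i, (v i).totalDegree ≤ t)
    (h : LinearIndependent L fun i => restrictFun S (v i)) : Fintype.card ι ≤ hilb S t := by
  have : LinearIndependent L fun i => (⟨restrictFun S (v i), v i,
      (mem_restrictTotalDegree _ _ _).2 (hv i), rfl⟩ : polyFun S t) :=
    LinearIndependent.of_comp (polyFun S t).subtype h
  exact this.fintype_card_le_finrank

theorem hilb_mono_right (S : Set (σ → L)) {t t' : ℕ} (h : t ≤ t') : hilb S t ≤ hilb S t' := by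
  refine Submodule.finrank_mono (Submodule.map_mono fun p hp => ?_)
  rw [mem_restrictTotalDegree] at hp ⊢
  exact hp.trans h

/-- If every polynomial function of degree `≤ t` on `T` is obtained linearly from one of degree
`≤ t'` on `S`, the Hilbert functions compare. -/
theorem hilb_le_of_forall {τ : Type*} [Finite τ] {S : Set (σ → L)} {T : Set (τ → L)} {t t' : ℕ}
    (φ : MvPolynomial τ L →ₗ[L] MvPolynomial σ L)
    (hφ : ∀ p, p.totalDegree ≤ t → (φ p).totalDegree ≤ t')
    (h0 : ∀ p, φ p ∈ vanishingIdeal L S → p ∈ vanishingIdeal L T) : hilb T t ≤ hilb S t' := by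
  let b := Module.finBasis L (polyFun T t)
  choose v hv hvb using fun i => (b i).2
  have := card_le_hilb (S := S) (t := t') (fun i => φ (v i))
    (fun i => hφ _ ((mem_restrictTotalDegree _ _ _).1 (hv i))) (by
      rw [Fintype.linearIndependent_iff]
      intro g hg
      have h1 : restrictFun S (φ (∑ i, g i • v i)) = 0 := by
        simpa [map_sum, map_smul] using hg
      rw [restrictFun_eq_zero_iff] at h1
      have h2 := restrictFun_eq_zero_iff.2 (h0 _ h1)
      have h3 : ∑ i, g i • b i = 0 := by
        refine Subtype.ext (Eq.trans ?_ h2)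
        simp [map_sum, map_smul, hvb]
      exact Fintype.linearIndependent_iff.1 b.linearIndependent g h3)
  simpa [hilb] using this

theorem hilb_mono_left {S T : Set (σ → L)} (h : S ⊆ T) (t : ℕ) : hilb S t ≤ hilb T t :=
  hilb_le_of_forall LinearMap.id (fun _ hp => hp) fun _ hp => vanishingIdeal_anti_mono h hp

theorem hilb_zariskiClosure (S : Set (σ → L)) (t : ℕ) : hilb (zariskiClosure S) t = hilb S t := by
  refine le_antisymm ?_ (hilb_mono_left (subset_zariskiClosure S) t)
  exact hilb_le_of_forall LinearMap.id (fun _ hp => hp) fun _ hp => by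
    rwa [vanishingIdeal_zariskiClosure]

/-- Multiplication by `f` is injective modulo the prime ideal of `Y`. So lifts of a basis of
functions on the section, together with `f` times a basis of functions on `Y`, remain independent on
`Y`. -/
theorem hilb_inter_add_le {Y : Set (σ → L)} (hY : IsIrreducibleVariety Y)
    {f : MvPolynomial σ L} (hf : f ∉ vanishingIdeal L Y) {d : ℕ} (hd : f.totalDegree ≤ d) (t : ℕ) :
    hilb (Y ∩ {x | aeval x f = 0}) (t + d) + hilb Y t ≤ hilb Y (t + d) := by
  let b := Module.finBasis L (polyFun (Y ∩ {x | aeval x f = 0}) (t + d))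
  let b' := Module.finBasis L (polyFun Y t)
  choose v hv hvb using fun i => (b i).2
  choose v' hv' hvb' using fun i => (b' i).2
  have := card_le_hilb (S := Y) (t := t + d) (Sum.elim v fun i => v' i * f) (by
      rintro (i | i)
      · exact (mem_restrictTotalDegree _ _ _).1 (hv i)
      · refine (totalDegree_mul _ _).trans (add_le_add ?_ hd)
        exact (mem_restrictTotalDegree _ _ _).1 (hv' i)) (by
      rw [Fintype.linearIndependent_iff]
      intro g hg
      have h1 : restrictFun Y (∑ i, g (.inl i) • v i + (∑ i, g (.inr i) • v' i) * f) = 0 := by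
        rw [← hg, Fintype.sum_sum_type]
        simp only [map_add, map_sum, map_smul, Finset.sum_mul, smul_mul_assoc, Sum.elim_inl,
          Sum.elim_inr]
      have h1' := restrictFun_eq_zero_iff.1 h1
      have h2 : ∑ i, g (.inl i) • v i ∈ vanishingIdeal L (Y ∩ {x | aeval x f = 0}) := by
        intro x hx
        have := h1' x hx.1
        have hfx : aeval x f = 0 := hx.2
        rwa [map_add, map_mul, hfx, mul_zero, add_zero] at this
      have h3 : ∑ i, g (.inl i) • b i = 0 := by
        refine Subtype.ext (Eq.trans ?_ (restrictFun_eq_zero_iff.2 h2))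
        simp only [map_sum, map_smul, hvb, AddSubmonoidClass.coe_finsetSum, SetLike.val_smul]
      have h4 := Fintype.linearIndependent_iff.1 b.linearIndependent _ h3
      simp only [h4, zero_smul, Finset.sum_const_zero, zero_add] at h1'
      have h5 := (hY.isPrime.mem_or_mem h1').resolve_right hf
      have h6 : ∑ i, g (.inr i) • b' i = 0 := by
        refine Subtype.ext (Eq.trans ?_ (restrictFun_eq_zero_iff.2 h5))
        simp [map_sum, map_smul, hvb']
      have h7 := Fintype.linearIndependent_iff.1 b'.linearIndependent _ h6
      rintro (i | i)
      · exact h4 i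
      · exact h7 i)
  simpa only [hilb, Fintype.card_sum, Fintype.card_fin] using this

/-- Iterating `hilb_inter_add_le` `t + 1` times in steps of `d` bounds `t + 1` copies of the Hilbert
function of the section by that of `Y` at `t + (t + 1) d`. Dividing by `t + 1` lowers the exponent
by one. -/
theorem hilb_inter_le {Y : Set (σ → L)} (hY : IsIrreducibleVariety Y)
    {f : MvPolynomial σ L} (hf : f ∉ vanishingIdeal L Y) {d : ℕ} (hd : f.totalDegree ≤ d)
    {c e : ℕ} (hc : ∀ t, hilb Y t ≤ c * (t + 1) ^ (e + 1)) (t : ℕ) :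
    hilb (Y ∩ {x | aeval x f = 0}) t ≤ c * (d + 1) ^ (e + 1) * (t + 1) ^ e := by
  have key : ∀ n, n * hilb (Y ∩ {x | aeval x f = 0}) t ≤ hilb Y (t + n * d) := by
    intro n
    induction n with
    | zero => simp
    | succ n ih =>
      have h1 := hilb_inter_add_le hY hf hd (t + n * d)
      have h2 := hilb_mono_right (Y ∩ {x | aeval x f = 0}) (show t ≤ t + n * d + d by omega)
      have h3 : t + (n + 1) * d = t + n * d + d := by ring
      rw [h3]
      linarith
  have h1 := (key (t + 1)).trans (hc _)
  have h2 : t + (t + 1) * d + 1 = (t + 1) * (d + 1) := by ring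
  rw [h2, mul_pow, pow_succ (t + 1)] at h1
  refine Nat.le_of_mul_le_mul_left (h1.trans (le_of_eq ?_)) (Nat.succ_pos t)
  ring

theorem hilb_univ_le (t : ℕ) : hilb (Set.univ : Set (σ → L)) t ≤ (t + 1) ^ Nat.card σ := by
  classical
  have := Fintype.ofFinite σ
  let B := restrictTotalDegree σ L t
  have h1 : hilb (Set.univ : Set (σ → L)) t ≤ Module.finrank L B :=
    Submodule.finrank_map_le _ _
  refine h1.trans ?_
  let φ : B →ₗ[L] ((σ → Fin (t + 1)) → L) := LinearMap.pi fun α =>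
    (lcoeff L (Finsupp.equivFunOnFinite.symm fun i => (α i : ℕ))).comp B.subtype
  have hφ : Function.Injective φ := by
    rw [injective_iff_map_eq_zero]
    rintro ⟨p, hp⟩ h
    ext m
    rw [mem_restrictTotalDegree] at hp
    simp only [ZeroMemClass.coe_zero, coeff_zero]
    by_contra hm
    have hdeg : ∀ i, m i < t + 1 := fun i => by
      have := le_totalDegree (mem_support_iff.2 hm)
      have := Finsupp.le_degree i m
      simp only [Finsupp.degree] at this
      have : m i ≤ m.sum fun _ e => e := this
      omega
    have := congrFun h fun i => ⟨m i, hdeg i⟩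
    apply hm
    simpa [φ] using this
  have := LinearMap.finrank_le_finrank_of_injective hφ
  rw [Module.finrank_fintype_fun_eq_card] at this
  simpa using this

variable [IsAlgClosed L]

/-- The coordinate functions generate the coordinate ring, so a transcendence basis can be chosen
among them. -/
theorem IsIrreducibleVariety.exists_algebraicIndependent {Z : Set (σ → L)}
    (hZ : IsIrreducibleVariety Z) : ∃ y : Fin (coordTrdeg Z) → σ,
      AlgebraicIndependent L fun a => Ideal.Quotient.mk (vanishingIdeal L Z) (X (y a)) := by
  have := hZ.isPrime
  let s : Set (MvPolynomial σ L ⧸ vanishingIdeal L Z) :=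
    Set.range fun i => Ideal.Quotient.mk (vanishingIdeal L Z) (X i)
  have hs : Algebra.adjoin L s = ⊤ := by
    rw [eq_top_iff]
    rintro a -
    obtain ⟨p, rfl⟩ := Ideal.Quotient.mk_surjective a
    rw [Algebra.adjoin_range_eq_range_aeval]
    refine ⟨p, ?_⟩
    have : (aeval fun i => Ideal.Quotient.mk (vanishingIdeal L Z) (X i)) =
      Ideal.Quotient.mkₐ L (vanishingIdeal L Z) := by ext; simp
    exact DFunLike.congr_fun this p
  have : Algebra.IsAlgebraic (Algebra.adjoin L s) (MvPolynomial σ L ⧸ vanishingIdeal L Z) :=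
    ⟨fun a => isAlgebraic_algebraMap (⟨a, hs ▸ Algebra.mem_top⟩ : Algebra.adjoin L s)⟩
  have : FaithfulSMul L (MvPolynomial σ L ⧸ vanishingIdeal L Z) :=
    (faithfulSMul_iff_algebraMap_injective L (MvPolynomial σ L ⧸ vanishingIdeal L Z)).2
      (algebraMap L _).injective
  obtain ⟨u, hu, hb⟩ := exists_isTranscendenceBasis_subset (R := L) s
  have hcard := hb.cardinalMk_eq_trdeg
  rw [← hZ.coe_coordTrdeg] at hcard
  have : Finite u := (Set.finite_range _).subset hu
  have := Fintype.ofFinite u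
  rw [Cardinal.mk_fintype, Nat.cast_inj] at hcard
  let φ := (Fintype.equivFinOfCardEq hcard).symm
  choose y hy using fun a => hu (φ a).2
  refine ⟨y, ?_⟩
  have := hb.1.comp φ φ.injective
  convert! this using 1
  exact funext hy

omit [Finite σ] [IsAlgClosed L] in
theorem sum_smul_mem_vanishingIdeal {Z : Set (σ → L)} {e q : ℕ} {y : Fin e → σ}
    (hy : AlgebraicIndependent L fun a => Ideal.Quotient.mk (vanishingIdeal L Z) (X (y a)))
    (g : (Fin e → Fin (q + 1)) → L)
    (h : ∑ α, g α • ∏ a, X (y a) ^ (α a : ℕ) ∈ vanishingIdeal L Z) : g = 0 := by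
  have h1 : aeval (fun a => Ideal.Quotient.mk (vanishingIdeal L Z) (X (y a)))
      (∑ α, monomial (Finsupp.equivFunOnFinite.symm fun a => (α a : ℕ)) (g α)) = 0 := by
    rw [← Ideal.Quotient.eq_zero_iff_mem.2 h, ← Ideal.Quotient.mkₐ_eq_mk L]
    simp only [smul_eq_C_mul, map_sum, map_mul, map_prod, map_pow]
    refine Finset.sum_congr rfl fun α _ => ?_
    rw [aeval_monomial, ← algebraMap_eq, AlgHom.commutes]
    congr 1
    rw [Finsupp.prod_fintype _ _ (by simp)]
    simp
  have h2 := hy.eq_zero_of_aeval_eq_zero _ h1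
  ext α
  have h3 := congrArg (coeff (Finsupp.equivFunOnFinite.symm fun a => (α a : ℕ))) h2
  simp only [coeff_sum, coeff_monomial, coeff_zero] at h3
  rw [Finset.sum_eq_single α] at h3
  · simpa using h3
  · intro β _ hβ
    rw [if_neg]
    intro h
    apply hβ
    ext a
    exact DFunLike.congr_fun h a
  · simp

/-- Irreducible varieties of equal dimension do not contain each other, so each `Z` has a polynomial
vanishing on all the others but not on `Z`. Multiplying it by monomials in `e` independent
coordinates of `Z`, with exponents at most `q`, gives functions that are jointly independent on `S`.
-/
theorem exists_forall_card_mul_pow_le_hilb {S : Set (σ → L)} {e : ℕ}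
    (F : Finset (Set (σ → L))) (hirr : ∀ Z ∈ F, IsIrreducibleVariety Z)
    (hdim : ∀ Z ∈ F, coordTrdeg Z = e) (hS : ∀ Z ∈ F, Z ⊆ S) :
    ∃ s, ∀ q, F.card * (q + 1) ^ e ≤ hilb S (s + e * q) := by
  classical
  have hy : ∀ Z : F, ∃ y : Fin e → σ,
      AlgebraicIndependent L fun a => Ideal.Quotient.mk (vanishingIdeal L Z.1) (X (y a)) := by
    intro Z
    obtain ⟨y, hy⟩ := (hirr Z.1 Z.2).exists_algebraicIndependent
    have h := hdim Z.1 Z.2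
    subst h
    exact ⟨y, hy⟩
  choose y hy using hy
  have hsep : ∀ Z : F, ∃ f : MvPolynomial σ L, f ∉ vanishingIdeal L Z.1 ∧
      ∀ Y : F, Y ≠ Z → f ∈ vanishingIdeal L Y.1 := by
    intro Z
    have h1 : ∀ Y : F, ∃ f ∉ vanishingIdeal L Z.1, Y ≠ Z → f ∈ vanishingIdeal L Y.1 := by
      intro Y
      by_cases hYZ : Y = Z
      · exact ⟨1, fun h => (hirr Z.1 Z.2).isPrime.ne_top ((Ideal.eq_top_iff_one _).2 h),
          fun h => absurd hYZ h⟩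
      · have : ¬ vanishingIdeal L Y.1 ≤ vanishingIdeal L Z.1 := by
          intro hle
          have hsub := (hirr Y.1 Y.2).1.subset_iff.2 hle
          exact hYZ (Subtype.ext ((hirr Z.1 Z.2).eq_of_coordTrdeg_le (hirr Y.1 Y.2) hsub
            (by rw [hdim _ Y.2, hdim _ Z.2])).symm)
        obtain ⟨f, hf, hf'⟩ := Set.not_subset.1 this
        exact ⟨f, hf', fun _ => hf⟩
    choose f hf hf' using h1
    have := (hirr Z.1 Z.2).isPrime
    refine ⟨∏ Y, f Y, fun h => ?_, fun Y hY => ?_⟩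
    · obtain ⟨Y, -, hY⟩ := (Ideal.IsPrime.prod_mem_iff).1 h
      exact hf Y hY
    · exact Ideal.mem_of_dvd _ (Finset.dvd_prod_of_mem _ (Finset.mem_univ Y)) (hf' Y hY)
  choose f hf hf' using hsep
  refine ⟨∑ Z, (f Z).totalDegree, fun q => ?_⟩
  have := card_le_hilb (S := S) (t := ∑ Z, (f Z).totalDegree + e * q)
    (fun i : F × (Fin e → Fin (q + 1)) => f i.1 * ∏ a, X (y i.1 a) ^ (i.2 a : ℕ)) (by
      rintro ⟨Z, α⟩
      refine (totalDegree_mul _ _).trans (add_le_add ?_ ?_)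
      · exact Finset.single_le_sum (f := fun Z => (f Z).totalDegree) (by simp) (Finset.mem_univ Z)
      · refine (totalDegree_finsetProd _ _).trans ?_
        calc _ ≤ ∑ a : Fin e, q := Finset.sum_le_sum fun a _ => by
              rw [totalDegree_X_pow]; exact Nat.lt_succ_iff.1 (α a).2
          _ = e * q := by simp) (by
      rw [Fintype.linearIndependent_iff]
      intro g hg
      rintro ⟨Z, α⟩
      have h1 : ∑ i : F × (Fin e → Fin (q + 1)), g i • (f i.1 * ∏ a, X (y i.1 a) ^ (i.2 a : ℕ)) ∈
          vanishingIdeal L S := by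
        rw [← restrictFun_eq_zero_iff, ← hg]
        simp only [map_sum, map_smul]
      have h2 := vanishingIdeal_anti_mono (hS Z.1 Z.2) h1
      rw [Fintype.sum_prod_type, ← Finset.add_sum_erase _ _ (Finset.mem_univ Z)] at h2
      have h3 := (Ideal.add_mem_iff_left _ (Ideal.sum_mem _ fun Y hY => Ideal.sum_mem _ fun α _ =>
        Submodule.smul_of_tower_mem _ _ (Ideal.mul_mem_right _ _
          (hf' Y Z (Finset.ne_of_mem_erase hY).symm)))).1 h2
      simp only [← mul_smul_comm] at h3
      rw [← Finset.mul_sum] at h3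
      have h4 := ((hirr Z.1 Z.2).isPrime.mem_or_mem h3).resolve_left (hf Z)
      exact congrFun (sum_smul_mem_vanishingIdeal (hy Z) _ h4) α)
  simpa using this

/-- The lower bound at `q = s` meets the upper bound, and the common factor `(s + 1) ^ e` cancels.
-/
theorem card_le_of_hilb_le {S : Set (σ → L)} {c e : ℕ} (hc : ∀ t, hilb S t ≤ c * (t + 1) ^ e)
    (F : Finset (Set (σ → L))) (hirr : ∀ Z ∈ F, IsIrreducibleVariety Z)
    (hdim : ∀ Z ∈ F, coordTrdeg Z = e) (hS : ∀ Z ∈ F, Z ⊆ S) :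
    F.card ≤ c * (e + 1) ^ e := by
  obtain ⟨s, hs⟩ := exists_forall_card_mul_pow_le_hilb F hirr hdim hS
  have h := (hs s).trans (hc _)
  have h1 : (s + e * s + 1) ^ e ≤ ((e + 1) * (s + 1)) ^ e :=
    Nat.pow_le_pow_left (by nlinarith) e
  rw [mul_pow] at h1
  have h2 := h.trans (Nat.mul_le_mul_left c h1)
  rw [← mul_assoc] at h2
  exact Nat.le_of_mul_le_mul_right h2 (by positivity)

theorem IsIrreducibleVariety.coordTrdeg_le_of_hilb_le {Z : Set (σ → L)}
    (hZ : IsIrreducibleVariety Z) {c e : ℕ} (hc : ∀ t, hilb Z t ≤ c * (t + 1) ^ e) :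
    coordTrdeg Z ≤ e := by
  by_contra! hlt
  obtain ⟨s, hs⟩ := exists_forall_card_mul_pow_le_hilb (S := Z) {Z} (by simpa using hZ)
    (e := coordTrdeg Z) (by simp) (by simp)
  set d := coordTrdeg Z
  -- The summand `s` absorbs the shift in the degree, and the other summand contradicts `q + 1 ≤ c
  -- (d + 1) ^ e`, which the comparison of exponents `e < d` yields.
  let q := s + c * (d + 1) ^ e
  have h := (hs q).trans (hc _)
  have h1 : (s + d * q + 1) ^ e ≤ ((d + 1) * (q + 1)) ^ e :=
    Nat.pow_le_pow_left (by
      have : s ≤ q := Nat.le_add_right _ _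
      nlinarith) e
  rw [mul_pow] at h1
  have h2 := h.trans (Nat.mul_le_mul_left c h1)
  rw [Finset.card_singleton, one_mul, ← mul_assoc] at h2
  have h3 : (q + 1) ^ (e + 1) ≤ (q + 1) ^ d := Nat.pow_le_pow_right (by omega) hlt
  rw [pow_succ, mul_comm] at h3
  have h4 := Nat.le_of_mul_le_mul_right (h3.trans h2) (by positivity)
  have : c * (d + 1) ^ e ≤ q := Nat.le_add_left _ _
  omega

end Hilbert

/-! ### A Bézout-type bound in terms of Hilbert functions. -/

section Bezout

open MvPolynomial

/-- A bound for the number and the complexity of the components cut out on a variety of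
dimension `e` and complexity `c` by polynomials of degree at most `d`. -/
def bezoutBound (d : ℕ) : ℕ → ℕ → ℕ
  | 0, c => c + 1
  | e + 1, c => c + 1 + (c * (d + 1) ^ (e + 1) * (e + 1) ^ e + 1) *
      bezoutBound d e (c * (d + 1) ^ (e + 1))

theorem lt_bezoutBound (d e c : ℕ) : c < bezoutBound d e c := by
  cases e <;> simp only [bezoutBound] <;> omega

variable {σ L : Type*} [Field L]

/-- The Hilbert function of `Z` is bounded by `c (t + 1) ^ dim Z`. -/
def HilbBound (c : ℕ) (Z : Set (σ → L)) : Prop :=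
  ∀ t, hilb Z t ≤ c * (t + 1) ^ coordTrdeg Z

theorem HilbBound.mono {c c' : ℕ} (h : c ≤ c') {Z : Set (σ → L)} (hZ : HilbBound c Z) :
    HilbBound c' Z := fun t => (hZ t).trans (Nat.mul_le_mul_right _ h)

variable [Finite σ] [IsAlgClosed L]

theorem IsIrreducibleVariety.coordTrdeg_le_card {Z : Set (σ → L)} (hZ : IsIrreducibleVariety Z) :
    coordTrdeg Z ≤ Nat.card σ :=
  hZ.coordTrdeg_le_of_hilb_le (c := 1) fun t => by
    rw [one_mul]
    exact (hilb_mono_left (Set.subset_univ Z) t).trans (hilb_univ_le t)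

theorem HilbBound.component {Y Z : Set (σ → L)} (hY : IsIrreducibleVariety Y)
    {f : MvPolynomial σ L} (hf : f ∉ vanishingIdeal L Y) {d : ℕ} (hd : f.totalDegree ≤ d)
    {c : ℕ} (hc : HilbBound c Y) (hZ : Z ∈ varietyComponents (Y ∩ {x | aeval x f = 0})) :
    HilbBound (c * (d + 1) ^ coordTrdeg Y) Z := by
  intro t
  have h := hY.coordTrdeg_component hf hZ
  have hc' := hc
  unfold HilbBound at hc'
  rw [← h] at hc' ⊢
  exact (hilb_mono_left hZ.1.2 t).trans (hilb_inter_le hY hf hd hc' t)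

/-- All components of a proper hypersurface section have the same dimension `e`, so the Hilbert
function of the section counts them. -/
theorem ncard_varietyComponents_inter_le {Y : Set (σ → L)} (hY : IsIrreducibleVariety Y)
    {f : MvPolynomial σ L} (hf : f ∉ vanishingIdeal L Y) {d : ℕ} (hd : f.totalDegree ≤ d)
    {c e : ℕ} (he : coordTrdeg Y = e + 1) (hc : HilbBound c Y) :
    (varietyComponents (Y ∩ {x | aeval x f = 0})).ncard ≤
      c * (d + 1) ^ (e + 1) * (e + 1) ^ e := by
  have hfin := (hY.1.inter (isVarietyOver_setOf_aeval_eq_zero f)).finite_varietyComponents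
  rw [Set.ncard_eq_toFinset_card _ hfin]
  unfold HilbBound at hc
  rw [he] at hc
  refine card_le_of_hilb_le (hilb_inter_le hY hf hd hc) _ ?_ ?_ ?_
  · intro Z hZ
    exact ((Set.Finite.mem_toFinset _).1 hZ).1.1
  · intro Z hZ
    have := hY.coordTrdeg_component hf ((Set.Finite.mem_toFinset _).1 hZ)
    omega
  · intro Z hZ
    exact ((Set.Finite.mem_toFinset _).1 hZ).1.2

omit [Finite σ] [IsAlgClosed L] in
theorem varietyComponents_eq_singleton {Y : Set (σ → L)} (hY : IsIrreducibleVariety Y) :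
    varietyComponents Y = {Y} := by
  ext Z
  rw [Set.mem_singleton_iff]
  constructor
  · rintro ⟨⟨_, hZ⟩, hmax⟩
    exact hZ.antisymm (hmax ⟨hY, le_rfl⟩ hZ)
  · rintro rfl
    exact ⟨⟨hY, le_rfl⟩, fun W hW _ => hW.2⟩

omit [Finite σ] [IsAlgClosed L] in
theorem mem_varietyComponents_of_subset {V W Z : Set (σ → L)} (hWV : W ⊆ V) (hZW : Z ⊆ W)
    (hZ : Z ∈ varietyComponents V) : Z ∈ varietyComponents W :=
  ⟨⟨hZ.1.1, hZW⟩, fun _ hY h => hZ.2 ⟨hY.1, hY.2.trans hWV⟩ h⟩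

/-- Induction on the dimension, for a possibly infinite set of equations. Either all of them vanish
on `Y`, or one of them cuts `Y` into boundedly many components of smaller dimension and bounded
complexity, and every component of the whole intersection is a component of the intersection with
one of these. -/
theorem bezout {d e c : ℕ} {Y : Set (σ → L)} (hY : IsIrreducibleVariety Y)
    (he : coordTrdeg Y = e) (hc : HilbBound c Y) (S : Set (MvPolynomial σ L))
    (hS : ∀ f ∈ S, f.totalDegree ≤ d) :
    (varietyComponents (Y ∩ {x | ∀ f ∈ S, aeval x f = 0})).ncard ≤ bezoutBound d e c ∧
      ∀ Z ∈ varietyComponents (Y ∩ {x | ∀ f ∈ S, aeval x f = 0}),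
        HilbBound (bezoutBound d e c) Z := by
  classical
  have hVS : IsVarietyOver L {x : σ → L | ∀ f ∈ S, aeval x f = 0} := ⟨S, rfl⟩
  induction e generalizing c Y with
  | zero =>
    by_cases hSY : S ⊆ vanishingIdeal L Y
    · have : Y ∩ {x | ∀ f ∈ S, aeval x f = 0} = Y :=
        Set.inter_eq_left.2 fun x hx f hf => hSY hf x hx
      rw [this, varietyComponents_eq_singleton hY]
      refine ⟨by simp [bezoutBound], ?_⟩
      rintro Z rfl
      exact hc.mono (lt_bezoutBound _ _ _).le
    · obtain ⟨f, hf, hfY⟩ := Set.not_subset.1 hSY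
      have : varietyComponents (Y ∩ {x | ∀ f ∈ S, aeval x f = 0}) = ∅ := by
        rw [Set.eq_empty_iff_forall_notMem]
        intro Z hZ
        obtain ⟨z, hz⟩ := hZ.1.1.2.1
        have hz' := hZ.1.2 hz
        obtain ⟨W, hW, -⟩ := (hY.1.inter
          (isVarietyOver_setOf_aeval_eq_zero f)).exists_mem_varietyComponent (x := z)
          ⟨hz'.1, hz'.2 f hf⟩
        have := hY.coordTrdeg_component hfY hW
        omega
      rw [this]
      simp
  | succ e ih =>
    by_cases hSY : S ⊆ vanishingIdeal L Y
    · have : Y ∩ {x | ∀ f ∈ S, aeval x f = 0} = Y :=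
        Set.inter_eq_left.2 fun x hx f hf => hSY hf x hx
      rw [this, varietyComponents_eq_singleton hY]
      refine ⟨by rw [Set.ncard_singleton]; have := lt_bezoutBound d (e + 1) c; omega, ?_⟩
      rintro Z rfl
      exact hc.mono (lt_bezoutBound _ _ _).le
    · obtain ⟨f, hf, hfY⟩ := Set.not_subset.1 hSY
      set c₁ := c * (d + 1) ^ (e + 1) with hc₁
      have hfin := (hY.1.inter (isVarietyOver_setOf_aeval_eq_zero f)).finite_varietyComponents
      have hsub : ∀ Z ∈ varietyComponents (Y ∩ {x | ∀ f ∈ S, aeval x f = 0}),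
          ∃ Y' ∈ varietyComponents (Y ∩ {x | aeval x f = 0}),
            Z ∈ varietyComponents (Y' ∩ {x | ∀ f ∈ S, aeval x f = 0}) := by
        intro Z hZ
        obtain ⟨Y', hY', hZY'⟩ := (hY.1.inter
          (isVarietyOver_setOf_aeval_eq_zero f)).exists_varietyComponent hZ.1.1
          (fun z hz => ⟨(hZ.1.2 hz).1, (hZ.1.2 hz).2 f hf⟩)
        refine ⟨Y', hY', mem_varietyComponents_of_subset ?_ ?_ hZ⟩
        · exact Set.inter_subset_inter_left _ (hY'.1.2.trans Set.inter_subset_left)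
        · exact fun z hz => ⟨hZY' hz, (hZ.1.2 hz).2⟩
      have ih' : ∀ Y' ∈ varietyComponents (Y ∩ {x | aeval x f = 0}),
          (varietyComponents (Y' ∩ {x | ∀ f ∈ S, aeval x f = 0})).ncard ≤ bezoutBound d e c₁ ∧
          ∀ Z ∈ varietyComponents (Y' ∩ {x | ∀ f ∈ S, aeval x f = 0}),
            HilbBound (bezoutBound d e c₁) Z := fun Y' hY' =>
        ih hY'.1.1 (by have := hY.coordTrdeg_component hfY hY'; omega)
          (by have := HilbBound.component hY hfY (hS f hf) hc hY'; rwa [he] at this)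
      have hle : bezoutBound d e c₁ ≤ bezoutBound d (e + 1) c := by
        simp only [bezoutBound]
        rw [← hc₁]
        nlinarith [Nat.zero_le (c₁ * (e + 1) ^ e * bezoutBound d e c₁)]
      constructor
      · have hsub' : varietyComponents (Y ∩ {x | ∀ f ∈ S, aeval x f = 0}) ⊆
            ((hfin.toFinset.biUnion fun Y' => if h : (varietyComponents
              (Y' ∩ {x | ∀ f ∈ S, aeval x f = 0})).Finite then h.toFinset else ∅ : Finset _) :
                Set (Set (σ → L))) := by
          intro Z hZ
          obtain ⟨Y', hY', hZ'⟩ := hsub Z hZ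
          have hfin' := (hY'.1.1.1.inter hVS).finite_varietyComponents
          rw [Finset.mem_coe, Finset.mem_biUnion]
          refine ⟨Y', hfin.mem_toFinset.2 hY', ?_⟩
          rw [dif_pos hfin']
          exact hfin'.mem_toFinset.2 hZ'
        refine (Set.ncard_le_ncard hsub' (Finset.finite_toSet _)).trans ?_
        rw [Set.ncard_coe_finset]
        refine (Finset.card_biUnion_le_card_mul _ _ (bezoutBound d e c₁) ?_).trans ?_
        · intro Y' hY'
          rw [hfin.mem_toFinset] at hY'
          split_ifs with h
          · rw [← Set.ncard_eq_toFinset_card _ h]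
            exact (ih' Y' hY').1
          · simp
        · rw [← Set.ncard_eq_toFinset_card _ hfin]
          have := ncard_varietyComponents_inter_le hY hfY (hS f hf) he hc
          rw [← hc₁] at this
          simp only [bezoutBound]
          rw [← hc₁]
          have := Nat.mul_le_mul_right (bezoutBound d e c₁) this
          nlinarith
      · intro Z hZ
        obtain ⟨Y', hY', hZ'⟩ := hsub Z hZ
        exact ((ih' Y' hY').2 Z hZ').mono hle

end Bezout

/-! ### Generic fibres and the existence of the degree. -/

section GenericFibre

open MvPolynomial

/-- Homomorphisms to an algebraically closed field extend generically along injective algebras of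
finite type. -/
theorem exists_ne_zero_forall_algHom_extends {L R S : Type*} [Field L] [IsAlgClosed L]
    [CommRing R] [IsDomain R] [CommRing S] [Algebra L R] [Algebra L S]
    [Algebra.FiniteType L R] [Algebra.FiniteType L S] (φ : R →ₐ[L] S)
    (hφ : Function.Injective φ) :
    ∃ r : R, r ≠ 0 ∧ ∀ ψ : R →ₐ[L] L, ψ r ≠ 0 →
      ∃ ψ' : S →ₐ[L] L, ∀ x, ψ' (φ x) = ψ x := by
  have hN : IsNoetherianRing R := Algebra.FiniteType.isNoetherianRing L R
  have hfp : φ.toRingHom.FinitePresentation := by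
    have : φ.toRingHom.FiniteType := by
      have h : algebraMap L S = φ.toRingHom.comp (algebraMap L R) := φ.comp_algebraMap.symm
      exact RingHom.FiniteType.of_comp_finiteType
        (h ▸ RingHom.finiteType_algebraMap.mpr inferInstance)
    exact RingHom.FinitePresentation.of_finiteType.1 this
  -- By Chevalley the image on spectra is constructible, and it contains the generic point because
  -- `φ` is injective. The piece containing the generic point has only zero closed conditions, so it
  -- is the basic open set of some `B.f ≠ 0`.
  obtain ⟨C, hC⟩ := PrimeSpectrum.exists_constructibleSetData_iff.2
    (PrimeSpectrum.isConstructible_range_comap hfp)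
  have hbot : (⊥ : PrimeSpectrum R) ∈ C.toSet := by
    rw [hC]
    obtain ⟨p, hp, hp'⟩ := Ideal.exists_comap_eq_of_mem_minimalPrimes_of_injective
      (f := φ.toRingHom) hφ ⊥ (by rw [IsDomain.minimalPrimes_eq_singleton_bot]; rfl)
    exact ⟨⟨p, hp⟩, PrimeSpectrum.ext hp'⟩
  simp only [PrimeSpectrum.ConstructibleSetData.toSet, Set.mem_iUnion] at hbot
  obtain ⟨B, hB, hbB⟩ := hbot
  have hg : ∀ i, B.g i = 0 := fun i => by
    have := hbB.1 ⟨i, rfl⟩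
    exact this
  have hf : B.f ≠ 0 := fun h => hbB.2 (by
    rintro _ rfl
    exact h)
  refine ⟨B.f, hf, fun ψ hψ => ?_⟩
  have hker : (⟨RingHom.ker ψ, RingHom.ker_isPrime ψ⟩ : PrimeSpectrum R) ∈ C.toSet := by
    simp only [PrimeSpectrum.ConstructibleSetData.toSet, Set.mem_iUnion]
    refine ⟨B, hB, ?_, ?_⟩
    · rintro _ ⟨i, rfl⟩
      rw [hg i]
      exact Ideal.zero_mem _
    · intro h
      exact hψ (h rfl)
  rw [hC] at hker
  obtain ⟨Q, hQ⟩ := hker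
  have hQ' : Q.asIdeal.comap φ = RingHom.ker ψ := congrArg PrimeSpectrum.asIdeal hQ
  -- A maximal ideal above `Q` still lies over the kernel of `ψ`, and its residue field is finite
  -- over `L`, hence maps to `L`.
  obtain ⟨M, hM, hQM⟩ := Q.asIdeal.exists_le_maximal Q.isPrime.ne_top
  have hfin : Module.Finite L (S ⧸ M) := by
    let := Ideal.Quotient.field M
    exact finite_of_finite_type_of_isJacobsonRing L (S ⧸ M)
  let θ : (S ⧸ M) →ₐ[L] L := IsAlgClosed.lift
  refine ⟨θ.comp (Ideal.Quotient.mkₐ L M), fun x => ?_⟩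
  have hx : x - algebraMap L R (ψ x) ∈ RingHom.ker ψ := by
    rw [RingHom.mem_ker, map_sub, AlgHom.commutes, Algebra.algebraMap_self_apply, sub_self]
  rw [← hQ'] at hx
  have h1 : φ (x - algebraMap L R (ψ x)) ∈ M := hQM hx
  rw [map_sub, AlgHom.commutes] at h1
  have h2 := Ideal.Quotient.eq_zero_iff_mem.2 h1
  rw [map_sub, sub_eq_zero] at h2
  simp only [AlgHom.comp_apply, Ideal.Quotient.mkₐ_eq_mk, h2]
  exact θ.commutes _

variable {L : Type*} [Field L]

/-- The point of `Q` given by a homomorphism from the coordinate ring. -/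
theorem IsVarietyOver.exists_mem_of_algHom {τ : Type*} {Q : Set (τ → L)} (hQ : IsVarietyOver L Q)
    (ψ : (MvPolynomial τ L ⧸ vanishingIdeal L Q) →ₐ[L] L) :
    ∃ w ∈ Q, ∀ p, ψ (Ideal.Quotient.mk _ p) = aeval w p := by
  have h : ∀ p, ψ (Ideal.Quotient.mk _ p) =
      aeval (fun i => ψ (Ideal.Quotient.mk _ (X i))) p := by
    intro p
    have : ψ.comp (Ideal.Quotient.mkₐ L _) =
      aeval (fun i => ψ (Ideal.Quotient.mk (vanishingIdeal L Q) (X i))) := by ext; simp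
    exact DFunLike.congr_fun this p
  refine ⟨_, hQ.zeroLocus_vanishingIdeal.subset fun p hp => ?_, h⟩
  rw [← h, Ideal.Quotient.eq_zero_iff_mem.2 hp, map_zero]

/-- The hom from the coordinate ring given by a point. -/
noncomputable def evalAt {τ : Type*} (Q : Set (τ → L)) (w : τ → L) (hw : w ∈ Q) :
    (MvPolynomial τ L ⧸ vanishingIdeal L Q) →ₐ[L] L :=
  Ideal.Quotient.liftₐ _ (aeval w) fun _ hp => hp w hw

@[simp] theorem evalAt_mk {τ : Type*} (Q : Set (τ → L)) (w : τ → L) (hw : w ∈ Q)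
    (p : MvPolynomial τ L) : evalAt Q w hw (Ideal.Quotient.mk _ p) = aeval w p := rfl

theorem IsVarietyOver.preimage {K σ τ : Type*} [Field K] [Algebra K L] {V : Set (σ → L)}
    (hV : IsVarietyOver K V) (q : σ → MvPolynomial τ K) :
    IsVarietyOver K {w : τ → L | (fun s => aeval w (q s)) ∈ V} := by
  obtain ⟨S, rfl⟩ := hV
  refine ⟨(aeval q) '' S, ?_⟩
  ext w
  simp only [Set.mem_ofPred_eq, Set.forall_mem_image]
  refine forall₂_congr fun p _ => ?_
  rw [comp_aeval_apply]

/-- If the projection of `Q` to the parameters is dominant, generic parameter points lift. Otherwise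
any nonzero element of the kernel of the comorphism vanishes on the projection. -/
theorem generic_fibre_dichotomy [IsAlgClosed L] {ρ τ : Type*} [Finite ρ] [Finite τ]
    {Q : Set (ρ ⊕ τ → L)} (hQ : IsVarietyOver L Q) :
    (∃ P : MvPolynomial ρ L, P ≠ 0 ∧ ∀ a, aeval a P ≠ 0 → ∃ b, Sum.elim a b ∈ Q) ∨
      ∃ P : MvPolynomial ρ L, P ≠ 0 ∧ ∀ a, aeval a P ≠ 0 → ∀ b, Sum.elim a b ∉ Q := by
  let φ : MvPolynomial ρ L →ₐ[L] (MvPolynomial (ρ ⊕ τ) L ⧸ vanishingIdeal L Q) :=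
    (Ideal.Quotient.mkₐ L _).comp (rename Sum.inl)
  by_cases hφ : Function.Injective φ
  · left
    obtain ⟨P, hP, h⟩ := exists_ne_zero_forall_algHom_extends φ hφ
    refine ⟨P, hP, fun a ha => ?_⟩
    obtain ⟨ψ, hψ⟩ := h (aeval a) ha
    obtain ⟨w, hw, hwψ⟩ := hQ.exists_mem_of_algHom ψ
    refine ⟨w ∘ Sum.inr, ?_⟩
    convert! hw
    ext (i | i)
    · have := hψ (X i)
      rw [aeval_X] at this
      rw [Sum.elim_inl, ← this]
      simp only [φ, AlgHom.comp_apply, Ideal.Quotient.mkₐ_eq_mk, hwψ, rename_X, aeval_X]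
    · rfl
  · right
    rw [injective_iff_map_eq_zero] at hφ
    push Not at hφ
    obtain ⟨P, hP, hP0⟩ := hφ
    refine ⟨P, hP0, fun a ha b hab => ha ?_⟩
    have : rename Sum.inl P ∈ vanishingIdeal L Q := Ideal.Quotient.eq_zero_iff_mem.1 hP
    have := this _ hab
    rwa [aeval_rename, Sum.elim_comp_inl] at this

variable [IsAlgClosed L] {σ : Type*} [Fintype σ]

/-- The points of `Z` on the affine subspace with parameters `a = (A, b)`. -/
def linearSection {e : ℕ} (Z : Set (σ → L)) (a : (Fin e × σ) ⊕ Fin e → L) : Set (σ → L) :=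
  {x | x ∈ Z ∧ ∀ r, ∑ s, a (.inl (r, s)) * x s = a (.inr r)}

/-- Tuples of `j` distinct points on a section form a variety over the parameter space once
distinctness is encoded by auxiliary unknowns satisfying `∑ y_s (x_s - x'_s) = 1`. The claim is then
`generic_fibre_dichotomy` for this variety. -/
theorem linearSection_dichotomy {Z : Set (σ → L)} (hZ : IsVarietyOver L Z) (e j : ℕ) :
    (∃ P : MvPolynomial ((Fin e × σ) ⊕ Fin e) L, P ≠ 0 ∧ ∀ a, aeval a P ≠ 0 →
      ∃ x : Fin j → σ → L, Function.Injective x ∧ ∀ i, x i ∈ linearSection Z a) ∨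
    (∃ P : MvPolynomial ((Fin e × σ) ⊕ Fin e) L, P ≠ 0 ∧ ∀ a, aeval a P ≠ 0 →
      ∀ x : Fin j → σ → L, Function.Injective x → ¬ ∀ i, x i ∈ linearSection Z a) := by
  let Q : Set (((Fin e × σ) ⊕ Fin e) ⊕ ((Fin j × σ) ⊕ ((Fin j × Fin j) × σ)) → L) :=
    (⋂ i : Fin j, {w | (fun s => aeval w (X (.inr (.inl (i, s))) : MvPolynomial
        (((Fin e × σ) ⊕ Fin e) ⊕ ((Fin j × σ) ⊕ ((Fin j × Fin j) × σ))) L)) ∈ Z}) ∩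
    ((⋂ i : Fin j, ⋂ r : Fin e, {w | aeval w (∑ s, X (.inl (.inl (r, s))) * X (.inr (.inl (i, s))) -
      X (.inl (.inr r)) : MvPolynomial
        (((Fin e × σ) ⊕ Fin e) ⊕ ((Fin j × σ) ⊕ ((Fin j × Fin j) × σ))) L) = 0}) ∩
    (⋂ p : Fin j × Fin j, ⋂ _ : p.1 ≠ p.2, {w | aeval w (∑ s, X (.inr (.inr (p, s))) *
      (X (.inr (.inl (p.1, s))) - X (.inr (.inl (p.2, s)))) - 1 : MvPolynomial
        (((Fin e × σ) ⊕ Fin e) ⊕ ((Fin j × σ) ⊕ ((Fin j × Fin j) × σ))) L) = 0}))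
  have hQ : IsVarietyOver L Q := by
    refine (IsVarietyOver.iInter fun i => hZ.preimage _).inter (.inter ?_ ?_)
    · exact .iInter fun i => .iInter fun r => isVarietyOver_setOf_aeval_eq_zero _
    · exact .iInter fun i => .iInter fun r => isVarietyOver_setOf_aeval_eq_zero _
  have hmem : ∀ a b, Sum.elim a b ∈ Q ↔ (∀ i : Fin j, (fun s => b (.inl (i, s))) ∈ linearSection Z a) ∧
      ∀ p : Fin j × Fin j, p.1 ≠ p.2 →
        ∑ s, b (.inr (p, s)) * (b (.inl (p.1, s)) - b (.inl (p.2, s))) = 1 := by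
    intro a b
    simp [Q, linearSection, sub_eq_zero, forall_and, and_assoc]
  have hex : ∀ a, (∃ b, Sum.elim a b ∈ Q) ↔
      ∃ x : Fin j → σ → L, Function.Injective x ∧ ∀ i, x i ∈ linearSection Z a := by
    intro a
    constructor
    · rintro ⟨b, hb⟩
      rw [hmem] at hb
      refine ⟨fun i s => b (.inl (i, s)), fun i i' h => ?_, hb.1⟩
      by_contra hne
      have := hb.2 (i, i') hne
      simp only [congrFun h, sub_self, mul_zero, Finset.sum_const_zero, zero_ne_one] at this
    · rintro ⟨x, hx, hxa⟩
      have : ∀ p : Fin j × Fin j, ∃ y : σ → L, p.1 ≠ p.2 →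
          ∑ s, y s * (x p.1 s - x p.2 s) = 1 := by
        classical
        intro p
        by_cases hp : p.1 = p.2
        · exact ⟨0, fun h => absurd hp h⟩
        · obtain ⟨s, hs⟩ := Function.ne_iff.1 (hx.ne hp)
          refine ⟨Pi.single s (x p.1 s - x p.2 s)⁻¹, fun _ => ?_⟩
          rw [Finset.sum_eq_single s]
          · rw [Pi.single_eq_same, inv_mul_cancel₀ (sub_ne_zero.2 hs)]
          · intro s' _ hs'
            rw [Pi.single_eq_of_ne hs', zero_mul]
          · simp
      choose y hy using this
      refine ⟨Sum.elim (fun q => x q.1 q.2) (fun q => y q.1 q.2), (hmem _ _).2 ⟨hxa, hy⟩⟩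
  rcases generic_fibre_dichotomy hQ with ⟨P, hP, h⟩ | ⟨P, hP, h⟩
  · exact .inl ⟨P, hP, fun a ha => (hex a).1 (h a ha)⟩
  · refine .inr ⟨P, hP, fun a ha x hx hxa => ?_⟩
    obtain ⟨b, hb⟩ := (hex a).2 ⟨x, hx, hxa⟩
    exact h a ha b hb

/-- In the coordinate ring of pairs (matrix, point of `Z`), the matrix entries and the values of the
linear forms are as many as the transcendence degree. If they are independent, every coordinate of
the point is algebraic over them, so a section is finite wherever the leading coefficients survive.
If not, a relation among them shows that the generic section is empty. -/
theorem IsIrreducibleVariety.exists_finite_linearSection {Z : Set (σ → L)}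
    (hZ : IsIrreducibleVariety Z) :
    ∃ P : MvPolynomial ((Fin (coordTrdeg Z) × σ) ⊕ Fin (coordTrdeg Z)) L, P ≠ 0 ∧
      ∀ a, aeval a P ≠ 0 → (linearSection Z a).Finite := by
  set e := coordTrdeg Z with he
  have := hZ.isPrime
  let A := MvPolynomial σ L ⧸ vanishingIdeal L Z
  let y : (Fin e × σ) ⊕ Fin e → MvPolynomial (Fin e × σ) A :=
    Sum.elim X fun r => ∑ s, X (r, s) * C (Ideal.Quotient.mk _ (X s))
  let ev : (a : (Fin e × σ) ⊕ Fin e → L) → (x : σ → L) → x ∈ Z → MvPolynomial (Fin e × σ) A →+* L :=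
    fun a x hx => eval₂Hom (evalAt Z x hx).toRingHom (fun p => a (.inl p))
  have hev : ∀ a x (hx : x ∈ linearSection Z a) (p : MvPolynomial ((Fin e × σ) ⊕ Fin e) L),
      ev a x hx.1 (aeval y p) = aeval a p := by
    intro a x hx p
    have hX : ∀ s, evalAt Z x hx.1 (Ideal.Quotient.mk _ (X s)) = x s := fun s => by
      rw [evalAt_mk, aeval_X]
    have : (ev a x hx.1).comp
        (aeval y : MvPolynomial ((Fin e × σ) ⊕ Fin e) L →ₐ[L] MvPolynomial (Fin e × σ) A).toRingHom
        = (aeval a : MvPolynomial ((Fin e × σ) ⊕ Fin e) L →ₐ[L] L).toRingHom := by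
      refine ringHom_ext ?_ ?_
      · intro r
        simp [ev, y]
      · rintro (p | r)
        · simp [ev, y]
        · simpa [ev, y, hX] using hx.2 r
    exact DFunLike.congr_fun this p
  by_cases hinj : AlgebraicIndependent L y
  · have hb := hinj.isTranscendenceBasis_of_lift_trdeg_le_of_finite (by
      have : FaithfulSMul L A :=
        (faithfulSMul_iff_algebraMap_injective L A).2 (algebraMap L A).injective
      have h1 := lift_trdeg_add_eq L A (MvPolynomial (Fin e × σ) A)
      rw [MvPolynomial.trdeg_of_isDomain, ← hZ.coe_coordTrdeg] at h1
      simp at h1 ⊢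
      rw [← h1, ← he, add_comm]
      simp)
    have halg := hb.isAlgebraic
    have hroot : ∀ s : σ, ∃ q : Polynomial (MvPolynomial ((Fin e × σ) ⊕ Fin e) L), q ≠ 0 ∧
        ∀ a x, x ∈ linearSection Z a → (q.map (aeval a : MvPolynomial ((Fin e × σ) ⊕ Fin e) L →ₐ[L] L).toRingHom).IsRoot (x s) := by
      intro s
      obtain ⟨p, hp, hpx⟩ := halg.1 (C (Ideal.Quotient.mk _ (X s)))
      refine ⟨p.map hinj.aevalEquiv.symm.toRingEquiv.toRingHom,
        (Polynomial.map_ne_zero_iff hinj.aevalEquiv.symm.injective).2 hp, fun a x hx => ?_⟩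
      have hX : evalAt Z x hx.1 (Ideal.Quotient.mk _ (X s)) = x s := by rw [evalAt_mk, aeval_X]
      have h1 := congrArg (ev a x hx.1) hpx
      rw [map_zero, Polynomial.aeval_def, Polynomial.hom_eval₂] at h1
      rw [Polynomial.IsRoot, Polynomial.map_map, Polynomial.eval_map, ← h1]
      congr 1
      · ext z
        obtain ⟨P, rfl⟩ := hinj.aevalEquiv.surjective z
        have := hev a x hx P
        rw [← hinj.algebraMap_aevalEquiv] at this
        simpa using this.symm
      · simp [ev, hX]
    choose q hq0 hq using hroot
    refine ⟨∏ s, (q s).leadingCoeff, Finset.prod_ne_zero_iff.2 fun s _ =>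
      Polynomial.leadingCoeff_ne_zero.2 (hq0 s), fun a ha => ?_⟩
    rw [map_prod, Finset.prod_ne_zero_iff] at ha
    have hne : ∀ s, (q s).map
        (aeval a : MvPolynomial ((Fin e × σ) ⊕ Fin e) L →ₐ[L] L).toRingHom ≠ 0 := fun s h => ha s (Finset.mem_univ s) (by
      have := congrArg (fun p => p.coeff (q s).natDegree) h
      simpa [Polynomial.coeff_map] using this)
    refine (Set.Finite.pi' fun s => Polynomial.finite_setOfPred_isRoot (hne s)).subset ?_
    intro x hx s
    exact hq s a x hx
  · rw [algebraicIndependent_iff] at hinj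
    push Not at hinj
    obtain ⟨P, hP, hP0⟩ := hinj
    refine ⟨P, hP0, fun a ha => ?_⟩
    have : linearSection Z a = ∅ := by
      rw [Set.eq_empty_iff_forall_notMem]
      intro x hx
      apply ha
      rw [← hev a x hx, hP, map_zero]
    rw [this]
    exact Set.finite_empty

omit [Fintype σ] [IsAlgClosed L] in
theorem Set.Finite.isVarietyOver {F : Set (σ → L)} (hF : F.Finite) : IsVarietyOver L F := by
  induction F, hF using Set.Finite.induction_on with
  | empty => exact isVarietyOver_empty
  | insert _ _ ih => exact (isVarietyOver_singleton _).union ih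

omit [Fintype σ] [IsAlgClosed L] in
theorem Set.Finite.singleton_mem_varietyComponents {F : Set (σ → L)} (hF : F.Finite) {x : σ → L}
    (hx : x ∈ F) : {x} ∈ varietyComponents F := by
  refine ⟨⟨isIrreducibleVariety_singleton x, Set.singleton_subset_iff.2 hx⟩, fun Y hY hxY => ?_⟩
  have hxY' : x ∈ Y := hxY rfl
  rcases hY.1.subset_or_subset (isVarietyOver_singleton x)
    ((hF.subset hY.2).subset (Set.sdiff_subset (t := {x}))).isVarietyOver
    (by rw [Set.union_sdiff_self]; exact Set.subset_union_right) with h | h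
  · exact h
  · exact absurd rfl (h hxY').2

/-- The points of a finite section are its irreducible components, so `bezout` with equations of
degree one counts them. -/
theorem ncard_linearSection_le {Z : Set (σ → L)} (hZ : IsIrreducibleVariety Z) {c : ℕ}
    (hc : HilbBound c Z) {e : ℕ} (a : (Fin e × σ) ⊕ Fin e → L)
    (hfin : (linearSection Z a).Finite) :
    (linearSection Z a).ncard ≤ bezoutBound 1 (coordTrdeg Z) c := by
  let S : Set (MvPolynomial σ L) :=
    Set.range fun r => ∑ s, C (a (.inl (r, s))) * X s - C (a (.inr r))
  have heq : linearSection Z a = Z ∩ {x | ∀ f ∈ S, aeval x f = 0} := by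
    ext x
    simp [linearSection, S, sub_eq_zero]
  have hS : ∀ f ∈ S, f.totalDegree ≤ 1 := by
    rintro _ ⟨r, rfl⟩
    refine (totalDegree_sub _ _).trans (max_le (totalDegree_finsetSum_le fun s _ => ?_) (by simp))
    exact (totalDegree_mul _ _).trans (by simp)
  have h1 := (bezout hZ rfl hc S hS).1
  rw [← heq] at h1
  refine le_trans ?_ h1
  refine Set.ncard_le_ncard_of_injOn (fun x => {x})
    (fun x hx => hfin.singleton_mem_varietyComponents hx)
    (Set.singleton_injective.injOn) ?_
  exact (hfin.isVarietyOver).finite_varietyComponents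

/-- An irreducible variety has a degree, bounded in terms of its complexity. -/
theorem IsIrreducibleVariety.exists_hasVarietyDegree {Z : Set (σ → L)}
    (hZ : IsIrreducibleVariety Z) {c : ℕ} (hc : HilbBound c Z) :
    ∃ k ≤ bezoutBound 1 (coordTrdeg Z) c, HasVarietyDegree Z k := by
  classical
  set e := coordTrdeg Z with he
  set B := bezoutBound 1 e c with hB
  obtain ⟨P₀, hP₀, hfin⟩ : ∃ P : MvPolynomial ((Fin e × σ) ⊕ Fin e) L, P ≠ 0 ∧
    ∀ a, aeval a P ≠ 0 → (linearSection Z a).Finite := hZ.exists_finite_linearSection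
  -- `G j` says that a generic section has at least `j` points. The degree is the largest such `j`,
  -- searched up to the Bézout bound `B`.
  let G : ℕ → Prop := fun j => ∃ P : MvPolynomial ((Fin e × σ) ⊕ Fin e) L, P ≠ 0 ∧
    ∀ a, aeval a P ≠ 0 →
      ∃ x : Fin j → σ → L, Function.Injective x ∧ ∀ i, x i ∈ linearSection Z a
  have hG0 : G 0 := ⟨1, one_ne_zero, fun a _ => ⟨Fin.elim0, fun i => i.elim0, fun i => i.elim0⟩⟩
  let k := Nat.findGreatest G B
  have hcard : ∀ (a : (Fin e × σ) ⊕ Fin e → L) j, (linearSection Z a).Finite → ((∃ x : Fin j → σ → L, Function.Injective x ∧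
      ∀ i, x i ∈ linearSection Z a) ↔ j ≤ (linearSection Z a).ncard) := by
    intro a j hf
    constructor
    · rintro ⟨x, hx, hxa⟩
      have := Set.ncard_le_ncard (Set.range_subset_iff.2 hxa) hf
      rwa [← Set.image_univ, Set.ncard_image_of_injective _ hx, Set.ncard_univ, Nat.card_fin] at this
    · intro h
      obtain ⟨F, hF, hFj⟩ := Set.exists_subset_card_eq h
      have hFf := hf.subset hF
      have := hFf.fintype
      rw [Set.ncard_eq_toFinset_card', Set.toFinset_card] at hFj
      let φ := (Fintype.equivFinOfCardEq hFj).symm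
      exact ⟨fun i => (φ i).1, Subtype.val_injective.comp φ.injective, fun i => hF (φ i).2⟩
  have hk : G k := Nat.findGreatest_spec (P := G) (Nat.zero_le B) hG0
  have hk1 : ¬ G (k + 1) := by
    by_cases hkB : k + 1 ≤ B
    · exact Nat.findGreatest_is_greatest (Nat.lt_succ_self k) hkB
    · rintro ⟨P, hP, h⟩
      obtain ⟨a, ha⟩ : ∃ a : (Fin e × σ) ⊕ Fin e → L, aeval a (P * P₀) ≠ 0 := by
        by_contra! h0
        exact mul_ne_zero hP hP₀ (MvPolynomial.funext fun a => by
          simpa using h0 a)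
      rw [map_mul] at ha
      have hf := hfin a (right_ne_zero_of_mul ha)
      have h1 := (hcard a _ hf).1 (h a (left_ne_zero_of_mul ha))
      have h2 : _ ≤ B := ncard_linearSection_le hZ hc a hf
      omega
  obtain ⟨P₁, hP₁, h₁⟩ := hk
  -- The dichotomy strengthens the failure of `G (k + 1)`: a generic section does not have `k + 1`
  -- distinct points.
  obtain ⟨P₂, hP₂, h₂⟩ := (linearSection_dichotomy hZ.1 e (k + 1)).resolve_left hk1
  refine ⟨k, Nat.findGreatest_le B, e, hZ.varietyDim_eq, P₀ * P₁ * P₂,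
    mul_ne_zero (mul_ne_zero hP₀ hP₁) hP₂, fun A b hAb => ?_⟩
  set a : (Fin e × σ) ⊕ Fin e → L := Sum.elim (fun p => A p.1 p.2) b with ha
  have hset : {x | x ∈ Z ∧ A.mulVec x = b} = linearSection Z a := by
    ext x
    simp [linearSection, a, _root_.funext_iff, Matrix.mulVec, dotProduct]
  rw [hset]
  rw [map_mul, map_mul] at hAb
  have hf := hfin a (left_ne_zero_of_mul (left_ne_zero_of_mul hAb))
  have hge := (hcard a k hf).1 (h₁ a (right_ne_zero_of_mul (left_ne_zero_of_mul hAb)))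
  have hlt : ¬ k + 1 ≤ (linearSection Z a).ncard := fun h => by
    obtain ⟨x, hx, hxa⟩ := (hcard a _ hf).2 h
    exact h₂ a (right_ne_zero_of_mul hAb) x hx hxa
  rw [← hf.cast_ncard_eq]
  congr 1
  omega

end GenericFibre

/-! ### Restriction of a polynomial to a line. -/

section LineRestriction

open MvPolynomial

variable {J L : Type*} [Field L]

/-- The restriction of `F` to the line `t ↦ z + t v`. -/
noncomputable def lineRestrict (z v : J → L) : MvPolynomial J L →ₐ[L] Polynomial L :=
  aeval fun j => Polynomial.C (z j) + Polynomial.C (v j) * Polynomial.X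

theorem eval_lineRestrict (z v : J → L) (F : MvPolynomial J L) (t : L) :
    (lineRestrict z v F).eval t = aeval (fun j => z j + v j * t) F := by
  have : (Polynomial.aeval t).comp (lineRestrict z v) =
      (aeval fun j => z j + v j * t : MvPolynomial J L →ₐ[L] L) := by
    ext j
    simp [lineRestrict]
  rw [← this]
  simp

theorem lineRestrict_monomial (z v : J → L) (m : J →₀ ℕ) :
    (lineRestrict z v (monomial m 1)).natDegree ≤ m.degree ∧
      (lineRestrict z v (monomial m 1)).coeff m.degree = eval v (monomial m 1) := by
  induction m using Finsupp.induction_linear with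
  | zero => simp
  | add m m' h h' =>
    have : (monomial (m + m') 1 : MvPolynomial J L) = monomial m 1 * monomial m' 1 := by
      rw [monomial_mul, one_mul]
    rw [this, map_mul, map_mul, map_add, Polynomial.coeff_mul_add_eq_of_natDegree_le h.1 h'.1, h.2, h'.2]
    exact ⟨Polynomial.natDegree_mul_le.trans (add_le_add h.1 h'.1), rfl⟩
  | single j k =>
    have : (monomial (Finsupp.single j k) 1 : MvPolynomial J L) = X j ^ k := by
      rw [X_pow_eq_monomial]
    have h1 : (lineRestrict z v (X j)).natDegree ≤ 1 := by
      simp only [lineRestrict, aeval_X]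
      compute_degree
    have h2 : (lineRestrict z v (X j)).coeff 1 = v j := by
      simp [lineRestrict, Polynomial.coeff_C]
    rw [this, map_pow, map_pow, Finsupp.degree_single]
    constructor
    · exact Polynomial.natDegree_pow_le.trans (by nlinarith)
    · have := Polynomial.coeff_pow_of_natDegree_le (m := k) h1
      rw [mul_one] at this
      rw [this, h2, eval_X]

/-- Only the monomials of degree exactly `d` contribute to the coefficient of `t ^ d`, and the base
point drops out of it. -/
theorem lineRestrict_coeff (z v : J → L) (F : MvPolynomial J L) {d : ℕ} (hd : F.totalDegree ≤ d) :
    (lineRestrict z v F).natDegree ≤ d ∧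
      (lineRestrict z v F).coeff d = eval v (homogeneousComponent d F) := by
  have hF : lineRestrict z v F = ∑ m ∈ F.support, coeff m F • lineRestrict z v (monomial m 1) := by
    conv_lhs => rw [F.as_sum]
    rw [map_sum]
    refine Finset.sum_congr rfl fun m _ => ?_
    rw [← map_smul, smul_monomial, smul_eq_mul, mul_one]
  have hm : ∀ m ∈ F.support, m.degree ≤ d := fun m hm =>
    (le_totalDegree hm).trans hd
  rw [hF]
  constructor
  · refine Polynomial.natDegree_sum_le_of_forall_le _ _ fun m h => ?_
    exact (Polynomial.natDegree_smul_le _ _).trans ((lineRestrict_monomial z v m).1.trans (hm m h))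
  · rw [homogeneousComponent_apply, Polynomial.finsetSum_coeff, map_sum, Finset.sum_filter]
    refine Finset.sum_congr rfl fun m h => ?_
    rw [Polynomial.coeff_smul]
    split_ifs with h'
    · rw [← h', (lineRestrict_monomial z v m).2, eval_monomial, eval_monomial, smul_eq_mul, one_mul]
    · rw [Polynomial.coeff_eq_zero_of_natDegree_lt, smul_zero]
      exact (lineRestrict_monomial z v m).1.trans_lt (lt_of_le_of_ne (hm m h) h')

theorem derivative_lineRestrict [Fintype J] (z v : J → L) (F : MvPolynomial J L) :
    Polynomial.derivative (lineRestrict z v F) =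
      lineRestrict z v (∑ j, C (v j) * pderiv j F) := by
  classical
  induction F using MvPolynomial.induction_on with
  | C a => simp [lineRestrict]
  | add p q hp hq => simp only [map_add, hp, hq, mul_add, Finset.sum_add_distrib]
  | mul_X p i hp =>
    have h1 : ∑ j, C (v j) * pderiv j (p * X i) =
        (∑ j, C (v j) * pderiv j p) * X i + C (v i) * p := by
      simp only [Derivation.leibniz, pderiv_X, smul_eq_mul, mul_add, Finset.sum_add_distrib]
      rw [add_comm]
      congr 1
      · rw [Finset.sum_mul]
        exact Finset.sum_congr rfl fun j _ => by ring
      · rw [Finset.sum_eq_single i]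
        · simp
        · intro j _ hj
          rw [Pi.single_eq_of_ne hj.symm]; simp
        · simp
    rw [h1, map_mul, Polynomial.derivative_mul, hp, map_add, map_mul, map_mul]
    congr 1
    rw [mul_comm]
    simp [lineRestrict]

/-- A line on which `F` has only simple zeros and the expected degree meets the hypersurface
`F = 0` in `totalDegree F` points. -/
theorem exists_injective_zeros_on_line [IsAlgClosed L] [Fintype J] (z v : J → L)
    (F : MvPolynomial J L) (hv : eval v (homogeneousComponent F.totalDegree F) ≠ 0)
    (hder : ∀ t, aeval (fun j => z j + v j * t) F = 0 →
      aeval (fun j => z j + v j * t) (∑ j, C (v j) * pderiv j F) ≠ 0) :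
    ∃ t : Fin F.totalDegree → L, Function.Injective t ∧
      ∀ i, aeval (fun j => z j + v j * t i) F = 0 := by
  classical
  set p := lineRestrict z v F with hp
  obtain ⟨h1, h2⟩ := lineRestrict_coeff z v F le_rfl
  rw [← h2, ← hp] at hv
  have hdeg : p.natDegree = F.totalDegree :=
    h1.antisymm (Polynomial.le_natDegree_of_ne_zero hv)
  have hp0 : p ≠ 0 := fun h => hv (by rw [h, Polynomial.coeff_zero])
  have hnd : p.roots.Nodup := by
    rw [Multiset.nodup_iff_count_le_one]
    intro t
    rw [Polynomial.count_roots]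
    by_contra! h
    obtain ⟨h3, h4⟩ := (Polynomial.one_lt_rootMultiplicity_iff_isRoot hp0).1 h
    rw [hp, derivative_lineRestrict, Polynomial.IsRoot, eval_lineRestrict] at h4
    rw [hp, Polynomial.IsRoot, eval_lineRestrict] at h3
    exact hder t h3 h4
  have hcard : p.roots.toFinset.card = F.totalDegree := by
    rw [Multiset.toFinset_card_of_nodup hnd, ← hdeg]
    exact (IsAlgClosed.splits p).natDegree_eq_card_roots.symm
  let φ := (p.roots.toFinset.equivFinOfCardEq hcard).symm
  refine ⟨fun i => (φ i).1, Subtype.val_injective.comp φ.injective, fun i => ?_⟩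
  have := (φ i).2
  rw [Multiset.mem_toFinset, Polynomial.mem_roots hp0, Polynomial.IsRoot] at this
  rw [← eval_lineRestrict]
  exact this

end LineRestriction

/-! ### Partial derivatives and degrees of substitutions. -/

section PartialDerivatives

open MvPolynomial

variable {J L : Type*} [Field L]

/-- Over an algebraically closed field, an irreducible polynomial has a nonzero partial
derivative. -/
theorem Irreducible.exists_pderiv_ne_zero [IsAlgClosed L] {F : MvPolynomial J L}
    (hF : Irreducible F) : ∃ j, pderiv j F ≠ 0 := by
  classical
  by_contra! h
  have hcoeff : ∀ m ∈ F.support, ∀ j, ((m j : ℕ) : L) = 0 := by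
    intro m hm j
    rcases Nat.eq_zero_or_pos (m j) with h0 | h0
    · rw [h0, Nat.cast_zero]
    · have h1 := congrArg (coeff (m - Finsupp.single j 1)) (h j)
      have h2 : m - Finsupp.single j 1 + Finsupp.single j 1 = m :=
        tsub_add_cancel_of_le (Finsupp.single_le_iff.2 h0)
      rw [coeff_pderiv, h2, coeff_zero] at h1
      have h3 : (((m - Finsupp.single j 1 : J →₀ ℕ) j + 1 : ℕ) : L) = (m j : L) := by
        congr 1
        simp
        omega
      rcases mul_eq_zero.1 h1 with h4 | h4
      · exact absurd h4 (mem_support_iff.1 hm)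
      · rw [← h3]; exact_mod_cast h4
  obtain ⟨p, hp⟩ := CharP.exists L
  have hdvd : ∀ m ∈ F.support, ∀ j, p ∣ m j := fun m hm j =>
    (CharP.cast_eq_zero_iff L p _).1 (hcoeff m hm j)
  rcases CharP.char_is_prime_or_zero L p with hpp | hp0
  · have := Fact.mk hpp
    choose r hr using fun a : L => IsAlgClosed.exists_pow_nat_eq a hpp.pos
    -- In characteristic `p` all exponents are multiples of `p` and the coefficients have `p`-th
    -- roots, so `F` would be a `p`-th power.
    let G : MvPolynomial J L := ∑ m ∈ F.support,
      monomial (m.mapRange (· / p) (Nat.zero_div p)) (r (coeff m F))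
    have hG : F = G ^ p := by
      conv_lhs => rw [F.as_sum]
      rw [sum_pow_char]
      refine Finset.sum_congr rfl fun m hm => ?_
      rw [monomial_pow, hr]
      congr 2
      ext j
      simp [Nat.mul_div_cancel' (hdvd m hm j)]
    rw [hG] at hF
    exact hF.not_isUnit ((isUnit_pow_iff hpp.ne_zero).2
      (hF.isUnit_or_isUnit (a := G) (b := G ^ (p - 1)) (by
        rw [← pow_succ', Nat.sub_add_cancel hpp.one_le]) |>.elim id
        fun hu => by
          exact (isUnit_pow_iff (by have := hpp.two_le; omega)).1 hu))
  · have hF0 : F = C (coeff 0 F) := by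
      ext m
      rw [coeff_C]
      split_ifs with hm
      · rw [hm]
      · by_contra hne
        refine hm (Finsupp.ext fun j => ?_)
        have := hdvd m (mem_support_iff.2 hne) j
        rw [hp0, zero_dvd_iff] at this
        exact this.symm
    apply hF.not_isUnit
    rw [hF0]
    refine (isUnit_iff_ne_zero.2 fun h0 => hF.ne_zero ?_).map C
    rw [hF0, h0, map_zero]

theorem totalDegree_pderiv_lt {F : MvPolynomial J L} (hF : F.totalDegree ≠ 0) (j : J) :
    (pderiv j F).totalDegree < F.totalDegree := by
  rw [totalDegree, Finset.sup_lt_iff (Nat.pos_of_ne_zero hF)]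
  intro m hm
  rw [mem_support_iff, coeff_pderiv] at hm
  have := le_totalDegree (mem_support_iff.2 (left_ne_zero_of_mul hm))
  rw [Finsupp.sum_add_index' (fun _ => rfl) (fun _ _ _ => rfl)] at this
  simp at this
  omega

theorem homogeneousComponent_totalDegree_ne_zero {F : MvPolynomial J L} (hF : F ≠ 0) :
    homogeneousComponent F.totalDegree F ≠ 0 := by
  obtain ⟨m, hm, hmd⟩ := Finset.exists_mem_eq_sup F.support (support_nonempty.2 hF)
    fun m => m.sum fun _ e => e
  intro h
  have := congrArg (coeff m) h
  rw [coeff_homogeneousComponent, if_pos, coeff_zero] at this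
  · exact mem_support_iff.1 hm this
  · rw [totalDegree, hmd]; rfl

theorem totalDegree_aeval_le {σ : Type*} (q : J → MvPolynomial σ L) {d : ℕ}
    (hq : ∀ j, (q j).totalDegree ≤ d) (F : MvPolynomial J L) :
    (aeval q F).totalDegree ≤ d * F.totalDegree := by
  conv_lhs => rw [F.as_sum, map_sum]
  refine totalDegree_finsetSum_le fun m hm => ?_
  rw [aeval_monomial]
  refine (totalDegree_mul _ _).trans ?_
  rw [MvPolynomial.algebraMap_eq, totalDegree_C, zero_add, Finsupp.prod]
  refine (totalDegree_finsetProd _ _).trans ?_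
  refine le_trans (Finset.sum_le_sum fun j _ => (totalDegree_pow _ _).trans
    (Nat.mul_le_mul_left _ (hq j))) ?_
  rw [← Finset.sum_mul, mul_comm]
  exact Nat.mul_le_mul_left _ (le_totalDegree hm)

end PartialDerivatives

/-! ### Generic linear forms on a variety. -/

section GenericForms

open MvPolynomial

variable {σ L : Type*} [Field L] [Fintype σ] [IsAlgClosed L]

/-- If generic sections were empty, some nonzero `P` would vanish at `(M, M x)` for every matrix `M`
and every `x` in `Y`. Degenerating `M` to a matrix that selects `e` independent coordinates turns
`P` into a nonzero relation between these coordinates. -/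
theorem IsIrreducibleVariety.exists_forall_linearSection_nonempty {Y : Set (σ → L)}
    (hY : IsIrreducibleVariety Y) {e : ℕ} (he : e ≤ coordTrdeg Y) :
    ∃ P : MvPolynomial ((Fin e × σ) ⊕ Fin e) L, P ≠ 0 ∧
      ∀ a, aeval a P ≠ 0 → (linearSection Y a).Nonempty := by
  classical
  rcases linearSection_dichotomy hY.1 e 1 with ⟨P, hP, h⟩ | ⟨P, hP, h⟩
  · refine ⟨P, hP, fun a ha => ?_⟩
    obtain ⟨x, -, hx⟩ := h a ha
    exact ⟨x 0, hx 0⟩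
  exfalso
  have hzero : ∀ (M : Fin e × σ → L), ∀ x ∈ Y,
      aeval (Sum.elim M fun r => ∑ s, M (r, s) * x s) P = 0 := by
    intro M x hx
    by_contra hne
    exact h _ hne (fun _ => x) (Function.injective_of_subsingleton _) fun _ => ⟨hx, fun r => rfl⟩
  obtain ⟨y, hy⟩ := hY.exists_algebraicIndependent
  obtain ⟨a₁, ha₁⟩ : ∃ a : (Fin e × σ) ⊕ Fin e → L, aeval a P ≠ 0 := by
    by_contra! h0
    exact hP (MvPolynomial.funext fun a => by simpa using h0 a)
  -- The pencil runs from the coordinate selection `M₀` at parameter `0` to `M₁` at parameter `1`.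
  -- Since `P` does not vanish at `a₁`, its restriction `g` to the pencil, with the right-hand sides
  -- kept as variables, is nonzero.
  let M₀ : Fin e × σ → L := fun p => if p.2 = y (Fin.castLE he p.1) then 1 else 0
  let M₁ : Fin e × σ → L := fun p => a₁ (.inl p)
  let g : Polynomial (MvPolynomial (Fin e) L) := aeval (Sum.elim
    (fun p => Polynomial.C (C (M₀ p)) + Polynomial.C (C (M₁ p - M₀ p)) * Polynomial.X)
    (fun r => Polynomial.C (X r))) P
  have hg0 : g ≠ 0 := by
    intro hg
    apply ha₁
    let θ : Polynomial (MvPolynomial (Fin e) L) →ₐ[L] L :=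
      Polynomial.eval₂AlgHom (aeval fun r => a₁ (.inr r)) 1 fun _ => Commute.all _ _
    have h1 : θ g = aeval a₁ P := by
      have : θ.comp (aeval (Sum.elim (fun p => Polynomial.C (C (M₀ p)) +
          Polynomial.C (C (M₁ p - M₀ p)) * Polynomial.X)
          (fun r => Polynomial.C (X r)))) = (aeval a₁ : MvPolynomial _ L →ₐ[L] L) := by
        ext (p | r)
        · simp [θ, M₁]
        · simp [θ]
      exact DFunLike.congr_fun this P
    rw [← h1, hg, map_zero]
  -- `g` itself may vanish at parameter `0`. Removing the exact power of the parameter leaves a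
  -- nonzero constant term, which still vanishes on `Y`.
  obtain ⟨k, h', hgk, hh'⟩ : ∃ k, ∃ h' : Polynomial (MvPolynomial (Fin e) L),
      g = Polynomial.X ^ k * h' ∧ h'.coeff 0 ≠ 0 := by
    obtain ⟨q, hq, hnd⟩ := Polynomial.exists_eq_pow_rootMultiplicity_mul_and_not_dvd g hg0 0
    rw [map_zero, sub_zero] at hq hnd
    exact ⟨_, q, hq, fun h0 => hnd (Polynomial.X_dvd_iff.2 h0)⟩
  have hrel : ∀ x ∈ Y, aeval (fun r => x (y (Fin.castLE he r))) (h'.coeff 0) = 0 := by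
    intro x hx
    let β : Fin e → Polynomial L := fun r => ∑ s, (Polynomial.C (M₀ (r, s)) +
      Polynomial.C (M₁ (r, s) - M₀ (r, s)) * Polynomial.X) * Polynomial.C (x s)
    let θ : Polynomial (MvPolynomial (Fin e) L) →ₐ[L] Polynomial L :=
      Polynomial.eval₂AlgHom (aeval β) Polynomial.X fun _ => Commute.all _ _
    have h1 : θ g = 0 := by
      refine Polynomial.funext fun s => ?_
      have : ((Polynomial.aeval s).comp θ).comp (aeval (Sum.elim (fun p => Polynomial.C (C (M₀ p)) +
          Polynomial.C (C (M₁ p - M₀ p)) * Polynomial.X)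
          (fun r => Polynomial.C (X r)))) = (aeval (Sum.elim (fun p => M₀ p + (M₁ p - M₀ p) * s)
            fun r => ∑ t, (M₀ (r, t) + (M₁ (r, t) - M₀ (r, t)) * s) * x t) :
              MvPolynomial _ L →ₐ[L] L) := by
        ext (p | r)
        · simp [θ]
        · simp [θ, β, Polynomial.eval_finsetSum]
      have h2 := DFunLike.congr_fun this P
      have h3 := hzero (fun p => M₀ p + (M₁ p - M₀ p) * s) x hx
      rw [← h2] at h3
      rw [Polynomial.eval_zero, ← h3]
      simp [g, Polynomial.coe_aeval_eq_eval]
    rw [hgk, map_mul, map_pow] at h1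
    have hX : θ Polynomial.X = Polynomial.X := by simp [θ]
    rw [hX, mul_eq_zero, or_iff_right (pow_ne_zero _ Polynomial.X_ne_zero)] at h1
    have : ∀ q, Polynomial.eval 0 (θ q) =
        aeval (fun r => x (y (Fin.castLE he r))) (q.coeff 0) := by
      intro q
      have h4 : ((Polynomial.aeval (0 : L)).comp θ) =
          ((aeval fun r => x (y (Fin.castLE he r))).comp
            ((Polynomial.aeval (0 : MvPolynomial (Fin e) L)).restrictScalars L)) := by
        refine Polynomial.algHom_ext' ?_ ?_
        · ext r
          simp [θ, β, M₀, Polynomial.eval_finsetSum, apply_ite (Polynomial.eval (0 : L))]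
        · simp [θ]
      have := DFunLike.congr_fun h4 q
      simpa [Polynomial.coe_aeval_eq_eval, Polynomial.coeff_zero_eq_eval_zero] using this
    rw [← this, h1, Polynomial.eval_zero]
  apply hh'
  have hy' := hy.comp (Fin.castLE he) (Fin.castLE_injective he)
  rw [algebraicIndependent_iff] at hy'
  refine hy' _ ?_
  have : aeval ((fun a => Ideal.Quotient.mk (vanishingIdeal L Y) (X (y a))) ∘ Fin.castLE he)
      (h'.coeff 0) = Ideal.Quotient.mk (vanishingIdeal L Y)
        (rename (fun r => y (Fin.castLE he r)) (h'.coeff 0)) := by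
    have h5 : (aeval ((fun a => Ideal.Quotient.mk (vanishingIdeal L Y) (X (y a))) ∘
        Fin.castLE he)) = (Ideal.Quotient.mkₐ L (vanishingIdeal L Y)).comp
          (rename fun r => y (Fin.castLE he r)) := by
      ext r
      simp
    exact DFunLike.congr_fun h5 _
  rw [this, Ideal.Quotient.eq_zero_iff_mem]
  intro x hx
  rw [aeval_rename]
  exact hrel x hx

omit [IsAlgClosed L] in
-- With the matrix fixed, almost every right-hand side is attained on `Y`, so the linear forms
-- satisfy no algebraic relation there.
theorem eq_zero_of_forall_linearSection_nonempty [Infinite L] {Y : Set (σ → L)} {e : ℕ}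
    {P : MvPolynomial ((Fin e × σ) ⊕ Fin e) L}
    (h : ∀ a, aeval a P ≠ 0 → (linearSection Y a).Nonempty)
    {a : (Fin e × σ) ⊕ Fin e → L} (ha : aeval a P ≠ 0) {G : MvPolynomial (Fin e) L}
    (hG : ∀ x ∈ Y, aeval (fun r => ∑ s, a (.inl (r, s)) * x s) G = 0) : G = 0 := by
  let P' : MvPolynomial (Fin e) L := aeval (Sum.elim (fun p => C (a (.inl p))) X) P
  have hP' : ∀ b, aeval b P' = aeval (Sum.elim (fun p => a (.inl p)) b) P := by
    intro b
    simp only [P', comp_aeval_apply]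
    congr 2
    ext (p | r) <;> simp
  have h0 : P' ≠ 0 := by
    intro h0
    have := hP' (fun r => a (.inr r))
    rw [h0, map_zero] at this
    apply ha
    rw [this]
    congr 2
    ext (p | r) <;> rfl
  refine (mul_eq_zero.1 (MvPolynomial.funext fun b => ?_ : G * P' = 0)).resolve_right h0
  by_cases hb : aeval b P' = 0
  · rw [map_mul, map_zero]
    exact mul_eq_zero_of_right _ hb
  · rw [hP'] at hb
    obtain ⟨x, hx, hxb⟩ := h _ hb
    rw [map_mul, map_zero]
    refine mul_eq_zero_of_left ?_ _
    have := hG x hx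
    have hb' : (fun r => ∑ s, a (.inl (r, s)) * x s) = b := _root_.funext hxb
    rw [hb'] at this
    exact this

/-- On each component `e` functions are dependent because the transcendence degree is smaller than
`e`. The product of the relations over the finitely many components works everywhere. -/
theorem exists_ne_zero_of_coordTrdeg_lt {C : Set (σ → L)} (hC : IsVarietyOver L C) {e : ℕ}
    (he : ∀ Z ∈ varietyComponents C, coordTrdeg Z < e) (q : Fin e → MvPolynomial σ L) :
    ∃ r : MvPolynomial (Fin e) L, r ≠ 0 ∧ ∀ x ∈ C, aeval (fun i => aeval x (q i)) r = 0 := by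
  have h1 : ∀ Z ∈ varietyComponents C, ∃ r : MvPolynomial (Fin e) L, r ≠ 0 ∧
      ∀ x ∈ Z, aeval (fun i => aeval x (q i)) r = 0 := by
    intro Z hZ
    have hni : ¬ AlgebraicIndependent L fun i => Ideal.Quotient.mk (vanishingIdeal L Z) (q i) := by
      intro hi
      have := hZ.1.1.isPrime
      have h2 := hi.lift_cardinalMk_le_trdeg
      rw [← hZ.1.1.coe_coordTrdeg] at h2
      simp at h2
      exact absurd (he Z hZ) (not_lt.2 h2)
    rw [algebraicIndependent_iff] at hni
    push Not at hni
    obtain ⟨r, hr, hr0⟩ := hni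
    refine ⟨r, hr0, fun x hx => ?_⟩
    have h3 := congrArg (evalAt Z x hx) hr
    rw [map_zero, comp_aeval_apply] at h3
    exact h3
  choose! r hr0 hr using h1
  have hfin := hC.finite_varietyComponents
  refine ⟨∏ Z ∈ hfin.toFinset, r Z, Finset.prod_ne_zero_iff.2 fun Z hZ =>
    hr0 Z (hfin.mem_toFinset.1 hZ), fun x hx => ?_⟩
  obtain ⟨Z, hZ, hxZ⟩ := hC.exists_mem_varietyComponent hx
  rw [map_prod]
  exact Finset.prod_eq_zero (hfin.mem_toFinset.2 hZ) (hr Z hZ x hxZ)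

end GenericForms

/-! ### From the degree to equations and to the Hilbert function. -/

section DegreeRelation

open MvPolynomial

variable {σ L : Type*} [Field L] [Fintype σ] [IsAlgClosed L]

theorem MvPolynomial.exists_aeval_ne_zero {J : Type*} {P : MvPolynomial J L} (hP : P ≠ 0) :
    ∃ a : J → L, aeval a P ≠ 0 := by
  by_contra! h0
  exact hP (MvPolynomial.funext fun a => by simpa using h0 a)

omit [Fintype σ] in
theorem vanishingIdeal_univ_eq_bot : vanishingIdeal L (Set.univ : Set (σ → L)) = ⊥ :=
  eq_bot_iff.2 fun p hp => MvPolynomial.funext fun x => by simpa using hp x (Set.mem_univ x)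

omit [Fintype σ] in
theorem isIrreducibleVariety_univ : IsIrreducibleVariety (Set.univ : Set (σ → L)) := by
  refine isIrreducibleVariety_iff.2 ⟨isVarietyOver_univ, ?_⟩
  rw [vanishingIdeal_univ_eq_bot]
  exact Ideal.isPrime_bot

omit [Fintype σ] in
theorem coordTrdeg_hypersurface_lt [Finite σ] {F : MvPolynomial σ L} (hF : F ≠ 0)
    (hH : IsIrreducibleVariety {x : σ → L | aeval x F = 0}) :
    coordTrdeg {x : σ → L | aeval x F = 0} < Nat.card σ := by
  have huniv := isIrreducibleVariety_univ (σ := σ) (L := L)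
  have h1 := huniv.coordTrdeg_component (f := F) (Z := {x : σ → L | aeval x F = 0}) (by
    rw [vanishingIdeal_univ_eq_bot]
    exact hF) (by
    rw [Set.univ_inter, varietyComponents_eq_singleton hH]; rfl)
  have h2 := huniv.coordTrdeg_le_card
  omega

/-- The closure of the image of a variety under `d + 1` linear forms, `d` of which are
algebraically independent on it, is an irreducible hypersurface. -/
theorem exists_irreducible_relation {Z : Set (σ → L)} (hZ : IsIrreducibleVariety Z) {d : ℕ}
    (hd : coordTrdeg Z = d) (q : Fin (d + 1) → MvPolynomial σ L)
    (hq : ∀ G : MvPolynomial (Fin d) L,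
      (∀ x ∈ Z, aeval (fun i => aeval x (q (Fin.succ i))) G = 0) → G = 0) :
    ∃ F : MvPolynomial (Fin (d + 1)) L, Irreducible F ∧
      IsIrreducibleVariety {z : Fin (d + 1) → L | aeval z F = 0} ∧
      coordTrdeg {z : Fin (d + 1) → L | aeval z F = 0} = d ∧
      (vanishingIdeal L {z : Fin (d + 1) → L | aeval z F = 0} =
        (vanishingIdeal L Z).comap (aeval q : MvPolynomial (Fin (d + 1)) L →ₐ[L] MvPolynomial σ L)) ∧
      ∀ G ∈ (vanishingIdeal L Z).comap
        (aeval q : MvPolynomial (Fin (d + 1)) L →ₐ[L] MvPolynomial σ L), G ≠ 0 → F.totalDegree ≤ G.totalDegree := by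
  have := hZ.isPrime
  set 𝔎 : Ideal (MvPolynomial (Fin (d + 1)) L) := (vanishingIdeal L Z).comap (aeval q) with h𝔎
  have hprime : 𝔎.IsPrime := Ideal.comap_isPrime _ _
  have hne : ∃ F ∈ 𝔎, F ≠ 0 := by
    by_contra! hbot
    have hi : AlgebraicIndependent L fun i => Ideal.Quotient.mk (vanishingIdeal L Z) (q i) := by
      rw [algebraicIndependent_iff]
      intro p hp
      refine hbot p ?_
      rw [h𝔎, Ideal.mem_comap, ← Ideal.Quotient.eq_zero_iff_mem, ← hp,
        ← Ideal.Quotient.mkₐ_eq_mk L, comp_aeval_apply]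
    have h2 := hi.lift_cardinalMk_le_trdeg
    rw [← hZ.coe_coordTrdeg, hd] at h2
    simp at h2
  -- A nonzero relation of least degree is irreducible: by primality one of two factors is again a
  -- relation, and minimality makes the other constant.
  obtain ⟨F, ⟨hF, hF0⟩, hmin⟩ := WellFounded.has_min
    (measure (totalDegree : MvPolynomial (Fin (d + 1)) L → ℕ)).wf {F | F ∈ 𝔎 ∧ F ≠ 0} hne
  have hmin' : ∀ G ∈ 𝔎, G ≠ 0 → F.totalDegree ≤ G.totalDegree := fun G hG hG0 =>
    not_lt.1 (hmin G ⟨hG, hG0⟩)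
  have hunit : ∀ a b : MvPolynomial (Fin (d + 1)) L, F = a * b → a ∈ 𝔎 → IsUnit b := by
    intro a b hab ha
    have ha0 : a ≠ 0 := by rintro rfl; exact hF0 (by rw [hab, zero_mul])
    have hb0 : b ≠ 0 := by rintro rfl; exact hF0 (by rw [hab, mul_zero])
    have h1 := hmin' a ha ha0
    rw [hab, totalDegree_mul_of_isDomain ha0 hb0] at h1
    have h2 := totalDegree_eq_zero_iff_eq_C.1 (by omega : b.totalDegree = 0)
    rw [h2] at hb0 ⊢
    exact (isUnit_iff_ne_zero.2 fun h0 => hb0 (by rw [h0, map_zero])).map C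
  have hirr : Irreducible F := by
    refine ⟨fun hu => hprime.ne_top (Ideal.eq_top_of_isUnit_mem _ hF hu), fun a b hab => ?_⟩
    rcases hprime.mem_or_mem (hab ▸ hF) with ha | hb
    · exact .inr (hunit a b hab ha)
    · exact .inl (hunit b a (by rw [hab, mul_comm]) hb)
  have hspan : (Ideal.span {F}).IsPrime :=
    (Ideal.span_singleton_prime hF0).2 hirr.prime
  have hHeq : zeroLocus L (Ideal.span {F}) = {z : Fin (d + 1) → L | aeval z F = 0} := by
    rw [zeroLocus_span]
    ext; simp
  have hH : IsIrreducibleVariety {z : Fin (d + 1) → L | aeval z F = 0} :=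
    hHeq ▸ isIrreducibleVariety_zeroLocus (Ideal.span {F})
  have hK : IsIrreducibleVariety (zeroLocus L 𝔎) := isIrreducibleVariety_zeroLocus 𝔎
  have hKH : zeroLocus L 𝔎 ⊆ {z : Fin (d + 1) → L | aeval z F = 0} := fun z hz => hz F hF
  have hIK : vanishingIdeal L (zeroLocus L 𝔎) = 𝔎 := IsPrime.vanishingIdeal_zeroLocus 𝔎
  -- The last `d` forms stay independent, so the closure of the image has dimension at least `d`.
  -- The irreducible hypersurface `F = 0` containing it has dimension at most `d`, so the two
  -- coincide.
  have hdK : d ≤ coordTrdeg (zeroLocus L 𝔎) := by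
    have hi : AlgebraicIndependent L fun i : Fin d =>
        Ideal.Quotient.mk (vanishingIdeal L (zeroLocus L 𝔎)) (X (Fin.succ i)) := by
      rw [algebraicIndependent_iff]
      intro p hp
      refine hq p fun x hx => ?_
      have h1 : rename Fin.succ p ∈ vanishingIdeal L (zeroLocus L 𝔎) := by
        rw [← Ideal.Quotient.eq_zero_iff_mem, ← hp]
        have : (Ideal.Quotient.mkₐ L (vanishingIdeal L (zeroLocus L 𝔎))).comp
          (rename Fin.succ) = aeval fun i : Fin d =>
            Ideal.Quotient.mk (vanishingIdeal L (zeroLocus L 𝔎)) (X (Fin.succ i)) := by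
          ext; simp
        exact DFunLike.congr_fun this p
      rw [hIK] at h1
      have h2 : aeval x (aeval q (rename Fin.succ p)) = 0 := h1 x hx
      rw [comp_aeval_apply, aeval_rename] at h2
      exact h2
    have := hK.isPrime
    have h2 := hi.lift_cardinalMk_le_trdeg
    rw [← hK.coe_coordTrdeg] at h2
    simpa using h2
  have hlt := coordTrdeg_hypersurface_lt hF0 hH
  rw [Nat.card_fin] at hlt
  have heq := hK.eq_of_coordTrdeg_le hH hKH (by omega)
  refine ⟨F, hirr, hH, ?_, ?_, hmin'⟩
  · rw [← heq] at hlt ⊢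
    omega
  · rw [← heq, hIK]

/-- An irreducible variety of degree `k` lies on a hypersurface of degree at most `k` that does
not contain a given irreducible variety of larger dimension. -/
theorem exists_mem_vanishingIdeal_of_hasVarietyDegree {Z Y : Set (σ → L)}
    (hZ : IsIrreducibleVariety Z) (hY : IsIrreducibleVariety Y)
    (hlt : coordTrdeg Z < coordTrdeg Y) {k : ℕ} (hk : HasVarietyDegree Z k) :
    ∃ F ∈ vanishingIdeal L Z, F ∉ vanishingIdeal L Y ∧ F.totalDegree ≤ k := by
  obtain ⟨d, hd, P, hP, hPk⟩ := hk
  have hde : coordTrdeg Z = d := by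
    rw [hZ.varietyDim_eq] at hd
    exact_mod_cast hd
  rw [hde] at hlt
  obtain ⟨PZ, hPZ, hPZ'⟩ := hZ.exists_forall_linearSection_nonempty hde.ge
  obtain ⟨PY, hPY, hPY'⟩ := hY.exists_forall_linearSection_nonempty (Nat.succ_le_of_lt hlt)
  let ι : (Fin d × σ) ⊕ Fin d → (Fin (d + 1) × σ) ⊕ Fin (d + 1) :=
    Sum.map (Prod.map Fin.succ id) Fin.succ
  have hι : Function.Injective ι := Sum.map_injective.2
    ⟨(Fin.succ_injective d).prodMap Function.injective_id, Fin.succ_injective d⟩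
  -- All `d + 1` forms are generic for `Y`, hence independent on it, while the last `d` are generic
  -- for `Z`. The equation `F` of the image of `Z` then pulls back to a polynomial that vanishes on
  -- `Z` but not on `Y`.
  obtain ⟨a, ha⟩ := MvPolynomial.exists_aeval_ne_zero (mul_ne_zero hPY
    (mul_ne_zero ((map_ne_zero_iff _ (rename_injective ι hι)).2 hPZ)
      ((map_ne_zero_iff _ (rename_injective ι hι)).2 hP)))
  rw [map_mul, map_mul, aeval_rename, aeval_rename] at ha
  have haY := left_ne_zero_of_mul ha
  have haZ := left_ne_zero_of_mul (right_ne_zero_of_mul ha)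
  have haP := right_ne_zero_of_mul (right_ne_zero_of_mul ha)
  let q : Fin (d + 1) → MvPolynomial σ L := fun j => ∑ s, C (a (.inl (j, s))) * X s
  have hqx : ∀ j x, aeval x (q j) = ∑ s, a (.inl (j, s)) * x s := fun j x => by simp [q]
  have hqdeg : ∀ j, (q j).totalDegree ≤ 1 := fun j =>
    totalDegree_finsetSum_le fun s _ => (totalDegree_mul _ _).trans (by simp)
  obtain ⟨F, hirr, hH, hHd, hHI, hmin⟩ := exists_irreducible_relation hZ hde q (fun G hG =>
    eq_zero_of_forall_linearSection_nonempty hPZ' haZ (fun x hx => by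
      have := hG x hx
      simp only [hqx] at this
      exact this))
  set H := {z : Fin (d + 1) → L | aeval z F = 0} with hHdef
  have hF0 := hirr.ne_zero
  have hFI : aeval q F ∈ vanishingIdeal L Z := by
    rw [← Ideal.mem_comap, ← hHI]
    exact fun z hz => hz
  refine ⟨aeval q F, hFI, fun hFY => hF0 ?_, (totalDegree_aeval_le q hqdeg F).trans ?_⟩
  · refine eq_zero_of_forall_linearSection_nonempty hPY' haY fun x hx => ?_
    have := hFY x hx
    rw [comp_aeval_apply] at this
    simpa only [hqx] using this
  -- It remains to bound the degree of `F` by `k`. A suitable line meets `F = 0` in `totalDegree F`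
  -- distinct points, all of which lift to one generic linear section of `Z`.
  rw [one_mul]
  have hdeg0 : F.totalDegree ≠ 0 := by
    intro h0
    have h2 := totalDegree_eq_zero_iff_eq_C.1 h0
    apply hirr.not_isUnit
    rw [h2] at hF0 ⊢
    exact (isUnit_iff_ne_zero.2 fun h0 => hF0 (by rw [h0, map_zero])).map C
  -- extension of points of the hypersurface
  have hZp := hZ.isPrime
  have hHp := hH.isPrime
  obtain ⟨r, hr, hext⟩ := exists_ne_zero_forall_algHom_extends
    (Ideal.quotientMapₐ (vanishingIdeal L Z) (aeval q) hHI.le :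
      (MvPolynomial (Fin (d + 1)) L ⧸ vanishingIdeal L H) →ₐ[L] _)
    (Ideal.quotientMap_injective' (H := hHI.le) hHI.ge)
  obtain ⟨G, rfl⟩ := Ideal.Quotient.mk_surjective r
  rw [Ne, Ideal.Quotient.eq_zero_iff_mem] at hr
  have hlift : ∀ z ∈ H, aeval z G ≠ 0 →
      ∃ x ∈ Z, ∀ j, ∑ s, a (.inl (j, s)) * x s = z j := by
    intro z hz hGz
    obtain ⟨ψ, hψ⟩ := hext (evalAt H z hz) (by rwa [evalAt_mk])
    obtain ⟨x, hx, hxψ⟩ := hZ.1.exists_mem_of_algHom ψ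
    refine ⟨x, hx, fun j => ?_⟩
    have h1 := hψ (Ideal.Quotient.mk _ (X j))
    rw [evalAt_mk, aeval_X, Ideal.quotient_map_mkₐ, aeval_X, Ideal.Quotient.mkₐ_eq_mk, hxψ,
      hqx] at h1
    exact h1
  -- choice of the direction
  obtain ⟨j₀, hj₀⟩ := hirr.exists_pderiv_ne_zero
  obtain ⟨z₀, hz₀⟩ := MvPolynomial.exists_aeval_ne_zero hj₀
  -- This is the genericity condition `P` for the matrix of forms cutting out a line of direction
  -- `v`. It is not identically zero, because the direction `(1, 0, …, 0)` recovers the last `d`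
  -- rows chosen in `a`.
  let PV : MvPolynomial (Fin (d + 1)) L := aeval (Sum.elim
    (fun p => X 0 * C (a (.inl (p.1.succ, p.2))) - X p.1.succ * C (a (.inl (0, p.2))))
    (fun i => C (a (.inr i.succ)))) P
  have hPV : ∀ v : Fin (d + 1) → L, aeval v PV = aeval (Sum.elim
      (fun p => v 0 * a (.inl (p.1.succ, p.2)) - v p.1.succ * a (.inl (0, p.2)))
      (fun i => a (.inr i.succ))) P := by
    intro v
    simp only [PV, comp_aeval_apply]
    congr 2
    ext (p | r) <;> simp
  have hPV0 : PV ≠ 0 := by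
    intro h0
    have := hPV (Pi.single 0 1)
    rw [h0, map_zero] at this
    apply haP
    rw [this]
    congr 2
    ext (p | r) <;> simp [ι, Prod.map]
  have hlin0 : (∑ j, C (aeval z₀ (pderiv j F)) * X j : MvPolynomial (Fin (d + 1)) L) ≠ 0 := by
    intro h0
    have := congrArg (aeval (Pi.single j₀ 1 : Fin (d + 1) → L)) h0
    simp [Pi.single_apply] at this
    exact hz₀ (by simpa using this)
  obtain ⟨v, hv⟩ := MvPolynomial.exists_aeval_ne_zero (mul_ne_zero (mul_ne_zero hPV0 hlin0)
    (mul_ne_zero (X_ne_zero 0) (homogeneousComponent_totalDegree_ne_zero hF0)))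
  rw [map_mul, map_mul, map_mul, aeval_X, hPV] at hv
  have hvP := left_ne_zero_of_mul (left_ne_zero_of_mul hv)
  have hvlin := right_ne_zero_of_mul (left_ne_zero_of_mul hv)
  have hv0 := left_ne_zero_of_mul (right_ne_zero_of_mul hv)
  have hvh := right_ne_zero_of_mul (right_ne_zero_of_mul hv)
  set DF := ∑ j, C (v j) * pderiv j F with hDF
  have hDF0 : DF ≠ 0 := by
    intro h0
    apply hvlin
    have := congrArg (aeval z₀) h0
    rw [hDF, map_sum, map_zero] at this
    rw [map_sum, ← this]
    refine Finset.sum_congr rfl fun j _ => ?_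
    simp [mul_comm]
  -- The directional derivative is nonzero of smaller degree than `F`, so minimality of `F` keeps it
  -- from vanishing on `H`.
  have hDFH : DF ∉ vanishingIdeal L H := by
    intro hmem
    rw [hHI] at hmem
    have h1 := hmin DF hmem hDF0
    have h2 : DF.totalDegree < F.totalDegree := by
      rw [hDF]
      refine lt_of_le_of_lt (totalDegree_finsetSum_le (d := F.totalDegree - 1)
        fun j _ => (totalDegree_mul _ _).trans ?_) (by omega)
      have := totalDegree_pderiv_lt hdeg0 j
      rw [totalDegree_C]
      omega
    omega
  have hGD : G * DF ∉ vanishingIdeal L H := fun h =>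
    (hHp.mem_or_mem h).elim hr hDFH
  -- choice of the line
  obtain ⟨r₀, hr₀, hr₀'⟩ := exists_ne_zero_of_coordTrdeg_lt (e := d)
    (hH.1.inter (isVarietyOver_setOf_aeval_eq_zero (G * DF)))
    (fun C hC => by have := hH.coordTrdeg_component hGD hC; omega)
    (fun i => C (v 0) * X i.succ - C (v i.succ) * X 0)
  -- A line of direction `v` is given by prescribing the `d` forms `v₀ w_{i+1} - v_{i+1} w₀`. Its
  -- preimage in `Z` is therefore a linear section with matrix `A'`.
  let A' : Matrix (Fin d) σ L := fun i s =>
    v 0 * a (.inl (i.succ, s)) - v i.succ * a (.inl (0, s))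
  let PB : MvPolynomial (Fin d) L := aeval (Sum.elim (fun p => C (A' p.1 p.2)) X) P
  have hPB : ∀ b, aeval b PB = aeval (Sum.elim (fun p => A' p.1 p.2) b) P := by
    intro b
    simp only [PB, comp_aeval_apply]
    congr 2
    ext (p | r) <;> simp
  have hPB0 : PB ≠ 0 := by
    intro h0
    have := hPB fun i => a (.inr i.succ)
    rw [h0, map_zero] at this
    exact hvP this.symm
  -- The values `b` avoid the projection along `v` of the points of `H` where `G * DF` vanishes, so
  -- each intersection with the line is simple and lifts to `Z`.
  obtain ⟨b, hb⟩ := MvPolynomial.exists_aeval_ne_zero (mul_ne_zero hr₀ hPB0)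
  rw [map_mul, hPB] at hb
  have hb₀ := left_ne_zero_of_mul hb
  have hcard := hPk A' b (right_ne_zero_of_mul hb)
  let z : Fin (d + 1) → L := Fin.cons 0 fun i => b i / v 0
  have hzt : ∀ t i, v 0 * (z (Fin.succ i) + v (Fin.succ i) * t) -
      v (Fin.succ i) * (z 0 + v 0 * t) = b i := by
    intro t i
    simp only [z, Fin.cons_succ, Fin.cons_zero]
    field_simp
    ring
  have hgood : ∀ t, aeval (fun j => z j + v j * t) F = 0 →
      aeval (fun j => z j + v j * t) G ≠ 0 ∧ aeval (fun j => z j + v j * t) DF ≠ 0 := by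
    intro t ht
    rw [← mul_ne_zero_iff, ← map_mul]
    intro h0
    apply hb₀
    rw [← hr₀' _ ⟨ht, h0⟩]
    congr 2
    ext i
    simp only [map_sub, map_mul, aeval_X, aeval_C, Algebra.algebraMap_self_apply]
    exact (hzt t i).symm
  obtain ⟨t, ht, htF⟩ := exists_injective_zeros_on_line z v F hvh fun t ht => (hgood t ht).2
  choose x hxZ hx using fun i => hlift _ (htF i) (hgood _ (htF i)).1
  have hxinj : Function.Injective x := by
    intro i i' h
    apply ht
    have h1 := hx i 0
    rw [h, hx i' 0] at h1
    exact (mul_left_cancel₀ hv0 (add_left_cancel h1)).symm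
  have hsub : Set.range x ⊆ {x | x ∈ Z ∧ A'.mulVec x = b} := by
    rintro _ ⟨i, rfl⟩
    refine ⟨hxZ i, ?_⟩
    ext r
    rw [← hzt (t i) r, ← hx i, ← hx i, Finset.mul_sum, Finset.mul_sum,
      ← Finset.sum_sub_distrib]
    refine Finset.sum_congr rfl fun s _ => ?_
    simp only [A']
    ring
  have h1 := Set.encard_le_encard hsub
  rw [hcard, ← Set.image_univ, hxinj.encard_image, Set.encard_univ,
    ENat.card_eq_coe_fintype_card, Fintype.card_fin] at h1
  exact_mod_cast h1

/-- Starting from the whole space, repeatedly cut by a hypersurface of degree at most `k` through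
`Z` that does not contain the current variety, and keep a component containing `Z`. Each cut costs a
factor of at most `(k + 1) ^ m`, and the process ends at `Z`. -/
theorem HilbBound.of_hasVarietyDegree {Z : Set (σ → L)} (hZ : IsIrreducibleVariety Z) {k : ℕ}
    (hk : HasVarietyDegree Z k) : HilbBound ((k + 1) ^ (Fintype.card σ * Fintype.card σ)) Z := by
  set m := Fintype.card σ with hm
  have huniv := isIrreducibleVariety_univ (σ := σ) (L := L)
  have huniv' : coordTrdeg (Set.univ : Set (σ → L)) = m := by
    refine le_antisymm (by simpa using huniv.coordTrdeg_le_card) ?_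
    have := huniv.isPrime
    have hi : AlgebraicIndependent L fun i =>
        Ideal.Quotient.mk (vanishingIdeal L (Set.univ : Set (σ → L))) (X i) := by
      rw [algebraicIndependent_iff]
      intro p hp
      have : (Ideal.Quotient.mkₐ L (vanishingIdeal L (Set.univ : Set (σ → L)))) = aeval fun i =>
          Ideal.Quotient.mk (vanishingIdeal L (Set.univ : Set (σ → L))) (X i) := by
        ext; simp
      rw [← this, Ideal.Quotient.mkₐ_eq_mk, Ideal.Quotient.eq_zero_iff_mem,
        vanishingIdeal_univ_eq_bot] at hp
      exact hp
    have h2 := hi.lift_cardinalMk_le_trdeg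
    rw [← huniv.coe_coordTrdeg] at h2
    simpa using h2
  have key : ∀ j, ∀ Y : Set (σ → L), IsIrreducibleVariety Y → Z ⊆ Y → coordTrdeg Y =
      coordTrdeg Z + j → ∀ i, i + j = m → HilbBound ((k + 1) ^ (m * i)) Y →
        HilbBound ((k + 1) ^ (m * m)) Z := by
    intro j
    induction j with
    | zero =>
      intro Y hY hZY hd i hi hb
      obtain rfl := hZ.eq_of_coordTrdeg_le hY hZY hd.le
      rw [add_zero] at hi
      rwa [hi] at hb
    | succ j ih =>
      intro Y hY hZY hd i hi hb
      obtain ⟨F, hFZ, hFY, hFk⟩ :=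
        exists_mem_vanishingIdeal_of_hasVarietyDegree hZ hY (by omega) hk
      obtain ⟨Y', hY', hZY'⟩ := (hY.1.inter
        (isVarietyOver_setOf_aeval_eq_zero F)).exists_varietyComponent hZ
        fun x hx => ⟨hZY hx, hFZ x hx⟩
      have h1 := hY.coordTrdeg_component hFY hY'
      refine ih Y' hY'.1.1 hZY' (by omega) (i + 1) (by omega) ?_
      refine (HilbBound.component hY hFY hFk hb hY').mono ?_
      rw [← pow_add, mul_add, mul_one]
      refine Nat.pow_le_pow_right (Nat.succ_pos k) (Nat.add_le_add_left ?_ _)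
      simpa using hY.coordTrdeg_le_card
  have hle := hZ.coordTrdeg_mono huniv (Set.subset_univ _)
  -- The index `i` starts at `dim Z` instead of `0`, a harmless loss that makes the final exponent
  -- `m * m` independent of `dim Z`.
  refine (key (m - coordTrdeg Z) Set.univ huniv (Set.subset_univ _) (by omega)
    (coordTrdeg Z) (by omega) fun t => ?_)
  rw [huniv']
  refine (hilb_univ_le t).trans ?_
  rw [Nat.card_eq_fintype_card]
  exact Nat.le_mul_of_pos_left _ (by positivity)

end DegreeRelation

/-! ### Images of products under maps that are polynomial in each variable. -/

section BipolynomialMaps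

open MvPolynomial

/-- A finite-dimensional space of functions is separated by as many points as its dimension. -/
theorem exists_points_separating {T L : Type*} [Field L] (P : Submodule L (T → L))
    [Module.Finite L P] {b : ℕ} (hb : Module.finrank L P ≤ b) :
    ∃ y : Fin b → Option T, ∀ p ∈ P, (∀ j, ∀ t ∈ y j, p t = 0) → p = 0 := by
  induction b generalizing P with
  | zero =>
    refine ⟨Fin.elim0, fun p hp _ => ?_⟩
    have : P = ⊥ := Submodule.finrank_eq_zero.1 (Nat.le_zero.1 hb)
    rw [this] at hp
    exact (Submodule.mem_bot L).1 hp
  | succ b ih =>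
    by_cases hP : P = ⊥
    -- Once the space is exhausted, `none` fills the remaining slots and imposes no condition. This
    -- also covers an empty `T`.
    · refine ⟨fun _ => none, fun p hp _ => ?_⟩
      rw [hP] at hp
      exact (Submodule.mem_bot L).1 hp
    · obtain ⟨p, hp, hp0⟩ := Submodule.exists_mem_ne_zero_of_ne_bot hP
      obtain ⟨t₀, ht₀⟩ := Function.ne_iff.1 hp0
      let P' : Submodule L (T → L) := P ⊓ LinearMap.ker (LinearMap.proj t₀)
      have hlt : P' < P := lt_of_le_of_ne inf_le_left fun h => by
        have : p ∈ P' := h ▸ hp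
        exact ht₀ this.2
      have : Module.Finite L P' := Submodule.finiteDimensional_of_le hlt.le
      obtain ⟨y, hy⟩ := ih P' (by
        have := Submodule.finrank_lt_finrank_of_lt hlt
        omega)
      refine ⟨Fin.cons (some t₀) y, fun p hp hpy => hy p ⟨hp, ?_⟩ fun j => ?_⟩
      · exact hpy 0 t₀ rfl
      · have := hpy j.succ
        rwa [Fin.cons_succ] at this

variable {σ τ ρ L : Type*} [Field L]

/-- If neither `f` nor `g` vanishes on the image, primality for `A` gives a single `x` at which both
are nonzero for suitable points of `B`. Primality for `B` then shows that `f * g` does not vanish on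
the slice of `x`. No product variety is needed. -/
theorem isPrime_vanishingIdeal_image2 {A : Set (σ → L)} {B : Set (τ → L)}
    (hA : (vanishingIdeal L A).IsPrime) (hB : (vanishingIdeal L B).IsPrime)
    (m : (σ → L) → (τ → L) → ρ → L) (P : (σ → L) → ρ → MvPolynomial τ L)
    (Q : (τ → L) → ρ → MvPolynomial σ L) (hP : ∀ x y r, aeval y (P x r) = m x y r)
    (hQ : ∀ x y r, aeval x (Q y r) = m x y r) :
    (vanishingIdeal L (Set.image2 m A B)).IsPrime := by
  have hPf : ∀ x y (f : MvPolynomial ρ L), aeval y (aeval (P x) f) = aeval (m x y) f := by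
    intro x y f
    rw [comp_aeval_apply]
    congr 2
    exact _root_.funext (hP x y)
  have hQf : ∀ x y (f : MvPolynomial ρ L), aeval x (aeval (Q y) f) = aeval (m x y) f := by
    intro x y f
    rw [comp_aeval_apply]
    congr 2
    exact _root_.funext (hQ x y)
  refine ⟨fun h => ?_, fun {f g} hfg => ?_⟩
  · obtain ⟨x, hx⟩ : A.Nonempty := by
      rw [Set.nonempty_iff_ne_empty]
      rintro rfl
      exact hA.ne_top (by rw [vanishingIdeal_empty])
    obtain ⟨y, hy⟩ : B.Nonempty := by
      rw [Set.nonempty_iff_ne_empty]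
      rintro rfl
      exact hB.ne_top (by rw [vanishingIdeal_empty])
    have : (1 : MvPolynomial ρ L) ∈ vanishingIdeal L (Set.image2 m A B) := h ▸ Submodule.mem_top
    have := this _ (Set.mem_image2_of_mem hx hy)
    simp at this
  · by_contra! hcon
    obtain ⟨hf, hg⟩ := hcon
    have key : ∀ f ∉ vanishingIdeal L (Set.image2 m A B),
        ∃ y ∈ B, aeval (Q y) f ∉ vanishingIdeal L A := by
      intro f hf
      by_contra! h
      apply hf
      rintro _ ⟨x, hx, y, hy, rfl⟩
      rw [← hQf]
      exact h y hy x hx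
    obtain ⟨y, hy, hfy⟩ := key f hf
    obtain ⟨y', hy', hgy⟩ := key g hg
    have := hA.mul_notMem hfy hgy
    apply this
    intro x hx
    have h1 : aeval (P x) f * aeval (P x) g ∈ vanishingIdeal L B := by
      intro z hz
      rw [← map_mul, hPf]
      exact hfg _ (Set.mem_image2_of_mem hx hz)
    rw [map_mul, hQf, hQf, ← hPf, ← hPf]
    rcases hB.mem_or_mem h1 with h | h
    · rw [h y hy, zero_mul]
    · rw [h y' hy', mul_zero]

/-- Choose `hilb B t` points separating the functions of degree at most `t` on `B`. Restriction to
the corresponding slices embeds the functions on the image into that many copies of the functions on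
`A`. -/
theorem hilb_image2_le [Finite σ] [Finite τ] [Finite ρ] (A : Set (σ → L)) (B : Set (τ → L))
    (m : (σ → L) → (τ → L) → ρ → L) (P : (σ → L) → ρ → MvPolynomial τ L)
    (Q : (τ → L) → ρ → MvPolynomial σ L) (hP : ∀ x y r, aeval y (P x r) = m x y r)
    (hQ : ∀ x y r, aeval x (Q y r) = m x y r) (hPd : ∀ x r, (P x r).totalDegree ≤ 1)
    (hQd : ∀ y r, (Q y r).totalDegree ≤ 1) (t : ℕ) :
    hilb (Set.image2 m A B) t ≤ hilb A t * hilb B t := by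
  obtain ⟨y, hy⟩ := exists_points_separating (polyFun B t) (b := hilb B t) le_rfl
  let Φ : (Set.image2 m A B → L) →ₗ[L] Fin (hilb B t) → (A → L) :=
    LinearMap.pi fun j => LinearMap.pi fun x =>
      (y j).elim 0 fun z => LinearMap.proj ⟨m x z, Set.mem_image2_of_mem x.2 z.2⟩
  have hmem : ∀ h ∈ polyFun (Set.image2 m A B) t, ∀ j, Φ h j ∈ polyFun A t := by
    rintro _ ⟨f, hf, rfl⟩ j
    rcases hz : y j with _ | z
    · convert! (polyFun A t).zero_mem using 1
      ext x
      simp [Φ, hz]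
    · refine ⟨aeval (Q z) f, ?_, ?_⟩
      · refine (mem_restrictTotalDegree _ _ _).2 ((totalDegree_aeval_le _ (hQd z) f).trans ?_)
        rw [one_mul]
        exact (mem_restrictTotalDegree _ _ _).1 hf
      · ext x
        have h1 : aeval x.1 (aeval (Q z.1) f) = aeval (m x z) f := by
          rw [comp_aeval_apply]
          congr 2
          exact _root_.funext (hQ x z)
        simpa [Φ, hz] using h1
  have hinj : ∀ h ∈ polyFun (Set.image2 m A B) t, Φ h = 0 → h = 0 := by
    rintro _ ⟨f, hf, rfl⟩ h0
    have h1 : ∀ x ∈ A, restrictFun B (aeval (P x) f) = 0 := by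
      intro x hx
      refine hy _ ⟨_, ?_, rfl⟩ fun j z hz => ?_
      · refine (mem_restrictTotalDegree _ _ _).2 ((totalDegree_aeval_le _ (hPd x) f).trans ?_)
        rw [one_mul]
        exact (mem_restrictTotalDegree _ _ _).1 hf
      · have h2 := congrFun (congrFun h0 j) ⟨x, hx⟩
        rw [restrictFun_apply, comp_aeval_apply]
        have hz' : y j = some z := hz
        have h3 : aeval (m x z) f = 0 := by simpa [Φ, hz'] using h2
        rw [← h3]
        congr 2
        exact _root_.funext (hP x z)
    ext ⟨_, x, hx, z, hz, rfl⟩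
    have h2 := congrFun (h1 x hx) ⟨z, hz⟩
    rw [restrictFun_apply, comp_aeval_apply] at h2
    have h3 : aeval (fun i => aeval z (P x i)) f = 0 := h2
    show aeval (m x z) f = 0
    rw [← h3]
    congr 2
    exact (_root_.funext (hP x z)).symm
  let Ψ : polyFun (Set.image2 m A B) t →ₗ[L] Fin (hilb B t) → polyFun A t :=
    LinearMap.pi fun j => LinearMap.codRestrict _
      ((LinearMap.proj j ∘ₗ Φ) ∘ₗ (polyFun (Set.image2 m A B) t).subtype) fun h => hmem _ h.2 j
  have hΨ : Function.Injective Ψ := by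
    rw [injective_iff_map_eq_zero]
    intro h hh
    refine Subtype.ext (hinj h h.2 ?_)
    ext j x
    have := congrFun (congrArg Subtype.val (congrFun hh j)) x
    exact this
  have := LinearMap.finrank_le_finrank_of_injective hΨ
  rw [Module.finrank_pi_fintype] at this
  simp only [Finset.sum_const, Finset.card_univ, Fintype.card_fin, smul_eq_mul] at this
  rw [mul_comm]
  exact this

end BipolynomialMaps

/-! ### Bijections preserving closed sets. -/

section Homeomorphisms

variable {σ L : Type*} [Field L] (φ : (σ → L) ≃ (σ → L))
  (hφ : ∀ V, IsVarietyOver L (φ '' V) ↔ IsVarietyOver L V)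

include hφ

theorem IsIrreducibleVariety.image {V : Set (σ → L)} (hV : IsIrreducibleVariety V) :
    IsIrreducibleVariety (φ '' V) := by
  refine ⟨(hφ V).2 hV.1, hV.2.1.image φ, fun V₁ V₂ h₁ h₂ h => ?_⟩
  have himg : ∀ U, φ '' (φ ⁻¹' U) = U := fun U => φ.image_preimage U
  rcases hV.2.2 (φ ⁻¹' V₁) (φ ⁻¹' V₂) ((hφ _).1 (by rwa [himg])) ((hφ _).1 (by rwa [himg]))
    (by rw [← Set.preimage_union, ← h, φ.preimage_image]) with h' | h'
  · left; rw [← h', himg]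
  · right; rw [← h', himg]

theorem isVarietyOver_symm_image_iff (V : Set (σ → L)) :
    IsVarietyOver L (φ.symm '' V) ↔ IsVarietyOver L V := by
  rw [← hφ, φ.image_symm_image]

theorem varietyDim_image (V : Set (σ → L)) : varietyDim (φ '' V) = varietyDim V := by
  refine (Order.krullDim_eq_of_orderIso ?_).symm
  exact
    { toFun := fun Y => ⟨φ '' Y.1, Y.2.1.image φ hφ, Set.image_mono Y.2.2⟩
      invFun := fun Y => ⟨φ.symm '' Y.1, Y.2.1.image φ.symm (isVarietyOver_symm_image_iff φ hφ),
        (Set.image_mono Y.2.2).trans (φ.symm_image_image V).subset⟩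
      left_inv := fun Y => Subtype.ext (φ.symm_image_image _)
      right_inv := fun Y => Subtype.ext (φ.image_symm_image _)
      map_rel_iff' := Set.image_subset_image_iff φ.injective }

theorem image_mem_varietyComponents {V Z : Set (σ → L)} (hZ : Z ∈ varietyComponents V) :
    φ '' Z ∈ varietyComponents (φ '' V) := by
  refine ⟨⟨hZ.1.1.image φ hφ, Set.image_mono hZ.1.2⟩, fun Y hY h => ?_⟩
  have h1 : φ.symm '' Y ⊆ Z := hZ.2
    ⟨hY.1.image φ.symm (isVarietyOver_symm_image_iff φ hφ), by
      rw [← φ.symm_image_image V]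
      exact Set.image_mono hY.2⟩ (by
      show Z ⊆ φ.symm '' Y
      rw [← φ.symm_image_image Z]
      exact Set.image_mono h)
  have h2 := Set.image_mono (f := φ) h1
  rwa [φ.image_symm_image] at h2

end Homeomorphisms

/-! ### Components of maximal dimension, and curves of bounded complexity. -/

section Dimension

open MvPolynomial

variable {σ L : Type*} [Field L] [IsAlgClosed L] [Finite σ]

theorem IsVarietyOver.exists_varietyComponent_varietyDim_eq {V : Set (σ → L)}
    (hV : IsVarietyOver L V) (hne : V.Nonempty) :
    ∃ Z ∈ varietyComponents V, varietyDim Z = varietyDim V := by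
  classical
  have hfin := hV.finite_varietyComponents
  obtain ⟨x, hx⟩ := hne
  obtain ⟨Z₀, hZ₀, -⟩ := hV.exists_mem_varietyComponent hx
  obtain ⟨Z, hZ, hmax⟩ := Set.exists_max_image (varietyComponents V) coordTrdeg hfin ⟨Z₀, hZ₀⟩
  refine ⟨Z, hZ, (varietyDim_mono hZ.1.2).antisymm ?_⟩
  rw [hZ.1.1.varietyDim_eq]
  refine iSup_le fun p => ?_
  have hmono : StrictMono fun Y : {Y : Set (σ → L) // IsIrreducibleVariety Y ∧ Y ⊆ V} =>
      coordTrdeg Y.1 := fun Y Y' h => Y.2.1.coordTrdeg_lt Y'.2.1 h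
  have h1 := (p.map _ hmono).head_add_length_le_nat
  obtain ⟨Z', hZ', hle⟩ := hV.exists_varietyComponent p.last.2.1 p.last.2.2
  have h2 : (p.map _ hmono).last ≤ coordTrdeg Z := by
    rw [LTSeries.last_map]
    exact (p.last.2.1.coordTrdeg_mono hZ'.1.1 hle).trans (hmax Z' hZ')
  rw [LTSeries.map_length] at h1
  exact_mod_cast (Nat.le_add_left _ _).trans (h1.trans h2)

/-- While the dimension exceeds one, some coordinate is nonconstant on `Y`. Cutting by the
hyperplane fixing it at a point of `Y` lowers the dimension by one and costs a factor `2 ^ dim Y`.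
-/
theorem IsIrreducibleVariety.exists_curve {Y : Set (σ → L)} (hY : IsIrreducibleVariety Y)
    (hd : coordTrdeg Y ≠ 0) {c : ℕ} (hc : HilbBound c Y) :
    ∃ X ⊆ Y, IsIrreducibleVariety X ∧ coordTrdeg X = 1 ∧
      HilbBound (c * 2 ^ (Nat.card σ * coordTrdeg Y)) X := by
  obtain ⟨e, he⟩ := Nat.exists_eq_succ_of_ne_zero hd
  rw [he]
  induction e generalizing Y c with
  | zero => exact ⟨Y, subset_rfl, hY, he, hc.mono (Nat.le_mul_of_pos_right _ (by positivity))⟩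
  | succ e ih =>
    obtain ⟨a, ha⟩ := hY.2.1
    obtain ⟨i, hi⟩ : ∃ i, X i - C (a i) ∉ vanishingIdeal L Y := by
      by_contra! h
      have : Y = {a} := (Set.singleton_subset_iff.2 ha).antisymm' fun x hx => by
        rw [Set.mem_singleton_iff]
        funext i
        have := h i x hx
        simpa [sub_eq_zero] using this
      rw [this, coordTrdeg_singleton] at he
      omega
    obtain ⟨Z, hZ, -⟩ := (hY.1.inter
      (isVarietyOver_setOf_aeval_eq_zero (X i - C (a i)))).exists_mem_varietyComponent
      (x := a) ⟨ha, by simp⟩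
    have h1 := hY.coordTrdeg_component hi hZ
    have h2 := HilbBound.component hY hi (d := 1) ((totalDegree_sub _ _).trans (by simp)) hc hZ
    obtain ⟨W, hWZ, hW, hW1, hWc⟩ := ih hZ.1.1 (by omega) h2 (by omega)
    refine ⟨W, hWZ.trans (hZ.1.2.trans Set.inter_subset_left), hW, hW1, hWc.mono ?_⟩
    rw [mul_assoc, ← pow_add]
    refine Nat.mul_le_mul_left _ (Nat.pow_le_pow_right two_pos ?_)
    have := hY.coordTrdeg_le_card
    rw [Nat.succ_eq_add_one, Nat.succ_eq_add_one, mul_add (Nat.card σ) (e + 1)]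
    omega

end Dimension

/-! ### Galois action and descent of the field of definition. -/

section Descent

open MvPolynomial

variable {σ K L : Type*} [Field K] [Field L] [Algebra K L]

/-- The action of a field automorphism on points. -/
def galoisEquiv (τ : L ≃ₐ[K] L) : (σ → L) ≃ (σ → L) := Equiv.piCongrRight fun _ => τ.toEquiv

@[simp] theorem galoisEquiv_apply (τ : L ≃ₐ[K] L) (x : σ → L) (i : σ) :
    galoisEquiv τ x i = τ (x i) := rfl

theorem aeval_galoisEquiv_map (τ : L ≃ₐ[K] L) (p : MvPolynomial σ L) (x : σ → L) :
    aeval (galoisEquiv τ x) (map (τ : L →+* L) p) = τ (aeval x p) := by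
  induction p using MvPolynomial.induction_on with
  | C a => simp
  | add p q hp hq => simp only [map_add, hp, hq]
  | mul_X p i hp => simp only [map_mul, hp, map_X, aeval_X, galoisEquiv_apply]

theorem isVarietyOver_image_galoisEquiv (τ : L ≃ₐ[K] L) (V : Set (σ → L)) :
    IsVarietyOver L (galoisEquiv τ '' V) ↔ IsVarietyOver L V := by
  have key : ∀ (τ : L ≃ₐ[K] L) (V : Set (σ → L)), IsVarietyOver L V →
      IsVarietyOver L (galoisEquiv τ '' V) := by
    rintro τ _ ⟨S, rfl⟩
    refine ⟨map (τ : L →+* L) '' S, ?_⟩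
    ext y
    obtain ⟨x, rfl⟩ := (galoisEquiv τ).surjective y
    simp only [Set.mem_ofPred_eq, Set.forall_mem_image, aeval_galoisEquiv_map,
      (galoisEquiv τ).injective.mem_set_image, map_eq_zero_iff τ τ.injective]
  refine ⟨fun h => ?_, key τ V⟩
  have h1 := key τ.symm _ h
  rwa [show (galoisEquiv τ.symm : (σ → L) ≃ (σ → L)) = (galoisEquiv τ).symm from rfl,
    Equiv.symm_image_image] at h1

/-- Applying `τ⁻¹` to coefficients preserves degrees. It is only semilinear, so a linear relation is
transported back by applying `τ` to its coefficients as well. -/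
theorem hilb_image_galoisEquiv_le [Finite σ] (τ : L ≃ₐ[K] L) (S : Set (σ → L)) (t : ℕ) :
    hilb (galoisEquiv τ '' S) t ≤ hilb S t := by
  let b := Module.finBasis L (polyFun (galoisEquiv τ '' S) t)
  choose v hv hvb using fun i => (b i).2
  have := card_le_hilb (S := S) (t := t) (fun i => map (τ.symm : L →+* L) (v i))
    (fun i => (Finset.sup_mono (support_map_subset _ _)).trans ((mem_restrictTotalDegree _ _ _).1 (hv i))) (by
      rw [Fintype.linearIndependent_iff]
      intro g hg
      have h1 : restrictFun (galoisEquiv τ '' S) (∑ i, τ (g i) • v i) = 0 := by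
        rw [restrictFun_eq_zero_iff]
        rintro _ ⟨x, hx, rfl⟩
        have h2 := congrFun hg ⟨x, hx⟩
        rw [Finset.sum_apply, Pi.zero_apply] at h2
        have h3 := congrArg τ h2
        rw [map_zero, map_sum] at h3
        rw [map_sum, ← h3]
        refine Finset.sum_congr rfl fun i _ => ?_
        rw [map_smul, Pi.smul_apply, restrictFun_apply, smul_eq_mul, smul_eq_mul, map_mul,
          ← aeval_galoisEquiv_map, map_map]
        congr 2
        have : ((τ : L →+* L).comp (τ.symm : L →+* L)) = RingHom.id L := by ext; simp
        rw [this, map_id]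
      have h3 : ∑ i, τ (g i) • b i = 0 := by
        refine Subtype.ext (Eq.trans ?_ h1)
        simp [map_sum, map_smul, hvb]
      intro i
      exact (map_eq_zero_iff τ τ.injective).1
        (Fintype.linearIndependent_iff.1 b.linearIndependent _ h3 i))
  simpa [hilb] using this

theorem IsVarietyOver.algEquiv_mem (τ : L ≃ₐ[K] L) {V : Set (σ → L)} (hV : IsVarietyOver K V)
    {x : σ → L} (hx : x ∈ V) : galoisEquiv τ x ∈ V := by
  obtain ⟨S, rfl⟩ := hV
  intro p hp
  have h : τ.toAlgHom.comp (aeval x) = aeval (galoisEquiv τ x) := by ext; simp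
  have := DFunLike.congr_fun h p
  rw [← this, AlgHom.comp_apply, hx p hp, map_zero]

/-- As `L` is algebraic over `K`, the ring generated by the coordinates of `x` is a field. Its two
embeddings, sending the generators to `x` and to `y`, differ by an automorphism of `L`. -/
theorem exists_algEquiv_of_forall_aeval_eq_zero [IsAlgClosed L] [Algebra.IsAlgebraic K L]
    (x y : σ → L) (h : ∀ p : MvPolynomial σ K, aeval x p = 0 → aeval y p = 0) :
    ∃ τ : L ≃ₐ[K] L, ∀ i, τ (y i) = x i := by
  set P : Ideal (MvPolynomial σ K) := RingHom.ker (aeval x : MvPolynomial σ K →ₐ[K] L) with hP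
  have hprime : P.IsPrime := RingHom.ker_isPrime _
  let φx : (MvPolynomial σ K ⧸ P) →ₐ[K] L := Ideal.Quotient.liftₐ P (aeval x) fun p hp => hp
  let φy : (MvPolynomial σ K ⧸ P) →ₐ[K] L := Ideal.Quotient.liftₐ P (aeval y) fun p hp => h p hp
  have hinj : Function.Injective φx := by
    rw [injective_iff_map_eq_zero]
    intro a ha
    obtain ⟨p, rfl⟩ := Ideal.Quotient.mk_surjective a
    exact Ideal.Quotient.eq_zero_iff_mem.2 ha
  have hint : Algebra.IsIntegral K (MvPolynomial σ K ⧸ P) := Algebra.IsIntegral.of_injective φx hinj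
  have hmax : P.IsMaximal := Ideal.Quotient.maximal_of_isField P
    (isField_of_isIntegral_of_isField' (R := K) (Field.toIsField K))
  let : Field (MvPolynomial σ K ⧸ P) := Ideal.Quotient.field P
  let : Algebra (MvPolynomial σ K ⧸ P) L := φy.toRingHom.toAlgebra
  have : IsScalarTower K (MvPolynomial σ K ⧸ P) L := IsScalarTower.of_algebraMap_eq fun a =>
    (φy.commutes a).symm
  have : Algebra.IsAlgebraic (MvPolynomial σ K ⧸ P) L := Algebra.IsAlgebraic.tower_top (K := K) _
  obtain ⟨φ, hφ⟩ := IsAlgClosed.surjective_domRestrict_of_isAlgebraic (K := K)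
    (L := MvPolynomial σ K ⧸ P) (E := L) (M := L) φx
  refine ⟨AlgEquiv.ofBijective φ (Algebra.IsAlgebraic.algHom_bijective φ), fun i => ?_⟩
  have h1 := DFunLike.congr_fun hφ (Ideal.Quotient.mk P (X i))
  have h2 : φy (Ideal.Quotient.mk P (X i)) = y i := aeval_X (R := K) y i
  have h3 : φx (Ideal.Quotient.mk P (X i)) = x i := aeval_X (R := K) x i
  rw [← h3, ← h1, ← h2]
  rfl

/-- A variety over `L` that is stable under the automorphisms of `L` over `K` is defined
over `K`. -/
theorem IsVarietyOver.descend [IsAlgClosed L] [Algebra.IsAlgebraic K L] [Finite σ]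
    {V : Set (σ → L)} (hV : IsVarietyOver L V)
    (hτ : ∀ τ : L ≃ₐ[K] L, ∀ x ∈ V, galoisEquiv τ x ∈ V) : IsVarietyOver K V := by
  refine ⟨{p | ∀ x ∈ V, aeval x p = 0}, ?_⟩
  refine Set.Subset.antisymm (fun x hx p hp => hp x hx) fun x hx => ?_
  have hmap : ∀ (z : σ → L) (p : MvPolynomial σ K), aeval z (map (algebraMap K L) p) = aeval z p :=
    fun z p => aeval_map_algebraMap L z p
  let P : Ideal (MvPolynomial σ K) := RingHom.ker (aeval x : MvPolynomial σ K →ₐ[K] L)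
  have hprime : P.IsPrime := RingHom.ker_isPrime _
  let : Algebra (MvPolynomial σ K) (MvPolynomial σ L) := MvPolynomial.algebraMvPolynomial
  have : Algebra.IsIntegral (MvPolynomial σ K) (MvPolynomial σ L) := inferInstance
  -- A prime lying over the ideal of `x` and containing the ideal of `V` has a zero `y`. This point
  -- lies in `V` and satisfies all equations of `x` over `K`, so `x` is a Galois conjugate of it.
  obtain ⟨Q, hQI, hQ, hQP⟩ := Ideal.exists_ideal_over_prime_of_isIntegral P (vanishingIdeal L V)
    (fun p hp => hx p fun z hz => by rw [← hmap]; exact hp z hz)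
  have hne : (zeroLocus L Q).Nonempty := by
    rw [Set.nonempty_iff_ne_empty]
    intro h0
    have := IsPrime.vanishingIdeal_zeroLocus (K := L) Q
    rw [h0, vanishingIdeal_empty] at this
    exact hQ.ne_top this.symm
  obtain ⟨y, hy⟩ := hne
  have hyV : y ∈ V := by
    rw [← hV.zeroLocus_vanishingIdeal]
    exact zeroLocus_anti_mono hQI hy
  obtain ⟨τ, hτx⟩ := exists_algEquiv_of_forall_aeval_eq_zero x y fun p hp => by
    have h1 : p ∈ P := hp
    rw [← hQP] at h1
    rw [← hmap]
    exact hy _ h1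
  have := hτ τ y hyV
  rwa [show galoisEquiv τ y = x from _root_.funext hτx] at this

end Descent

/-! ### Matrices as points of affine space. -/

section MatrixPoints

open MvPolynomial Matrix

variable {n : ℕ} {L : Type*} [Field L]

/-- A matrix as a point of affine space. -/
def matPt {R : Type*} (M : Matrix (Fin n) (Fin n) R) : Fin n × Fin n → R := fun p => M p.1 p.2

/-- A point of affine space as a matrix. -/
def ptMat {R : Type*} (x : Fin n × Fin n → R) : Matrix (Fin n) (Fin n) R := fun i j => x (i, j)

@[simp] theorem ptMat_matPt {R : Type*} (M : Matrix (Fin n) (Fin n) R) : ptMat (matPt M) = M := rfl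

@[simp] theorem matPt_ptMat {R : Type*} (x : Fin n × Fin n → R) : matPt (ptMat x) = x := rfl

theorem matPt_injective {R : Type*} :
    Function.Injective (matPt : Matrix (Fin n) (Fin n) R → Fin n × Fin n → R) :=
  Function.LeftInverse.injective (g := ptMat) ptMat_matPt

/-- An element of `SL_n` as a point of affine space. -/
def slPt (g : Matrix.SpecialLinearGroup (Fin n) L) : Fin n × Fin n → L :=
  matPt (g : Matrix (Fin n) (Fin n) L)

theorem slPt_injective :
    Function.Injective (slPt : Matrix.SpecialLinearGroup (Fin n) L → Fin n × Fin n → L) :=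
  matPt_injective.comp Subtype.val_injective

@[simp] theorem ptMat_slPt (g : Matrix.SpecialLinearGroup (Fin n) L) :
    ptMat (slPt g) = (g : Matrix (Fin n) (Fin n) L) := rfl

theorem slPt_mem_matrixPoints {S : Set (Matrix.SpecialLinearGroup (Fin n) L)}
    {g : Matrix.SpecialLinearGroup (Fin n) L} : slPt g ∈ matrixPoints S ↔ g ∈ S :=
  slPt_injective.mem_set_image

theorem matrixPoints_subset_iff {S T : Set (Matrix.SpecialLinearGroup (Fin n) L)} :
    matrixPoints S ⊆ matrixPoints T ↔ S ⊆ T :=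
  Set.image_subset_image_iff slPt_injective

/-- A set of points of `SL_n` comes from a set of matrices. -/
theorem exists_matrixPoints_eq {S : Set (Matrix.SpecialLinearGroup (Fin n) L)}
    {Y : Set (Fin n × Fin n → L)} (h : Y ⊆ matrixPoints S) :
    ∃ T ⊆ S, matrixPoints T = Y := by
  obtain ⟨T, hT, rfl⟩ := Set.subset_image_iff.1 h
  exact ⟨T, hT, rfl⟩

/-- The matrix of coordinates. -/
noncomputable def coordMat (n : ℕ) (L : Type*) [Field L] :
    Matrix (Fin n) (Fin n) (MvPolynomial (Fin n × Fin n) L) := ptMat X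

/-- A constant matrix of polynomials. -/
noncomputable def constMat (M : Matrix (Fin n) (Fin n) L) :
    Matrix (Fin n) (Fin n) (MvPolynomial (Fin n × Fin n) L) := M.map C

/-- Evaluation of a matrix of polynomials at a point. -/
noncomputable def evalMat (x : Fin n × Fin n → L) :
    Matrix (Fin n) (Fin n) (MvPolynomial (Fin n × Fin n) L) →+* Matrix (Fin n) (Fin n) L :=
  (aeval x : MvPolynomial (Fin n × Fin n) L →ₐ[L] L).toRingHom.mapMatrix

@[simp] theorem evalMat_coordMat (x : Fin n × Fin n → L) : evalMat x (coordMat n L) = ptMat x := by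
  ext i j
  simp [evalMat, coordMat, ptMat]

@[simp] theorem evalMat_constMat (x : Fin n × Fin n → L) (M : Matrix (Fin n) (Fin n) L) :
    evalMat x (constMat M) = M := by
  ext i j
  simp [evalMat, constMat]

@[simp] theorem evalMat_adjugate (x : Fin n × Fin n → L) :
    evalMat x (coordMat n L).adjugate = (ptMat x).adjugate := by
  rw [← evalMat_coordMat x]
  exact RingHom.map_adjugate _ _

theorem aeval_matPt (x : Fin n × Fin n → L)
    (N : Matrix (Fin n) (Fin n) (MvPolynomial (Fin n × Fin n) L)) (p : Fin n × Fin n) :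
    aeval x (matPt N p) = matPt (evalMat x N) p := rfl

/-- The entries of a matrix of polynomials have degree at most `d`. -/
def MatDegreeLE (N : Matrix (Fin n) (Fin n) (MvPolynomial (Fin n × Fin n) L)) (d : ℕ) : Prop :=
  ∀ i j, (N i j).totalDegree ≤ d

theorem MatDegreeLE.mul {M N : Matrix (Fin n) (Fin n) (MvPolynomial (Fin n × Fin n) L)} {d e : ℕ}
    (hM : MatDegreeLE M d) (hN : MatDegreeLE N e) : MatDegreeLE (M * N) (d + e) := fun i j =>
  totalDegree_finsetSum_le fun k _ =>
    (totalDegree_mul _ _).trans (add_le_add (hM i k) (hN k j))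

theorem matDegreeLE_constMat (M : Matrix (Fin n) (Fin n) L) : MatDegreeLE (constMat M) 0 :=
  fun _ _ => (totalDegree_C _).le

theorem matDegreeLE_coordMat : MatDegreeLE (coordMat n L) 1 := fun _ _ => (totalDegree_X _).le

theorem matDegreeLE_adjugate : MatDegreeLE (coordMat n L).adjugate n := by
  intro i j
  rw [adjugate_apply, det_apply]
  refine totalDegree_finsetSum_le fun s _ => ?_
  refine (totalDegree_smul_le _ _).trans ((totalDegree_finsetProd _ _).trans ?_)
  refine (Finset.sum_le_card_nsmul _ _ 1 fun k _ => ?_).trans (by simp)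
  rw [updateRow_apply]
  split_ifs
  · rw [Pi.single_apply]
    split_ifs <;> simp
  · exact (totalDegree_X _).le

theorem isVarietyOver_setOf_evalMat {V : Set (Fin n × Fin n → L)} (hV : IsVarietyOver L V)
    (N : Matrix (Fin n) (Fin n) (MvPolynomial (Fin n × Fin n) L)) :
    IsVarietyOver L {x | matPt (evalMat x N) ∈ V} :=
  hV.preimage (matPt N)

/-- Left multiplication by `g` on points. -/
def leftMulEquiv (g : Matrix.SpecialLinearGroup (Fin n) L) : (Fin n × Fin n → L) ≃ (Fin n × Fin n → L) where
  toFun x := matPt ((g : Matrix (Fin n) (Fin n) L) * ptMat x)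
  invFun x := matPt ((↑g⁻¹ : Matrix (Fin n) (Fin n) L) * ptMat x)
  left_inv x := by
    change matPt ((↑g⁻¹ : Matrix (Fin n) (Fin n) L) * ((g : Matrix (Fin n) (Fin n) L) * ptMat x)) = x
    rw [← mul_assoc, ← Matrix.SpecialLinearGroup.coe_mul, inv_mul_cancel,
      Matrix.SpecialLinearGroup.coe_one, one_mul, matPt_ptMat]
  right_inv x := by
    change matPt ((g : Matrix (Fin n) (Fin n) L) * ((↑g⁻¹ : Matrix (Fin n) (Fin n) L) * ptMat x)) = x
    rw [← mul_assoc, ← Matrix.SpecialLinearGroup.coe_mul, mul_inv_cancel,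
      Matrix.SpecialLinearGroup.coe_one, one_mul, matPt_ptMat]

theorem isVarietyOver_image_leftMulEquiv (g : Matrix.SpecialLinearGroup (Fin n) L)
    (V : Set (Fin n × Fin n → L)) :
    IsVarietyOver L (leftMulEquiv g '' V) ↔ IsVarietyOver L V := by
  have key : ∀ (g : Matrix.SpecialLinearGroup (Fin n) L) (V : Set (Fin n × Fin n → L)),
      IsVarietyOver L V → IsVarietyOver L (leftMulEquiv g '' V) := by
    intro g V hV
    rw [Equiv.image_eq_preimage_symm]
    convert! isVarietyOver_setOf_evalMat hV (constMat ↑g⁻¹ * coordMat n L) using 1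
    ext x
    rw [Set.mem_ofPred_eq, map_mul, evalMat_constMat, evalMat_coordMat]
    rfl
  refine ⟨fun h => ?_, key g V⟩
  have h1 := key g⁻¹ _ h
  have h2 : leftMulEquiv g⁻¹ '' (leftMulEquiv g '' V) = V := by
    rw [Set.image_image]
    convert! Set.image_id V using 1
    exact Set.image_congr fun x _ => (leftMulEquiv g).left_inv x
  rwa [h2] at h1

theorem leftMulEquiv_image (g : Matrix.SpecialLinearGroup (Fin n) L)
    (S : Set (Matrix.SpecialLinearGroup (Fin n) L)) :
    leftMulEquiv g '' matrixPoints S = matrixPoints ((fun h => g * h) '' S) := by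
  rw [matrixPoints, matrixPoints, Set.image_image, Set.image_image]
  rfl

/-- The product `a z b y` of matrices, on points. -/
def sandwich (a b : Matrix (Fin n) (Fin n) L) (z y : Fin n × Fin n → L) : Fin n × Fin n → L :=
  matPt (a * ptMat z * b * ptMat y)

/-- The product `a z b y` is linear in `z` and in `y` separately, which is exactly what the lemmas
on images of products require. -/
theorem isPrime_vanishingIdeal_sandwich (a b : Matrix (Fin n) (Fin n) L)
    {A B : Set (Fin n × Fin n → L)} (hA : (vanishingIdeal L A).IsPrime)
    (hB : (vanishingIdeal L B).IsPrime) :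
    (vanishingIdeal L (Set.image2 (sandwich a b) A B)).IsPrime :=
  isPrime_vanishingIdeal_image2 hA hB (sandwich a b)
    (fun z => matPt (constMat (a * ptMat z * b) * coordMat n L))
    (fun y => matPt (constMat a * coordMat n L * constMat (b * ptMat y)))
    (fun z y r => by simp [aeval_matPt, sandwich])
    (fun z y r => by simp [aeval_matPt, sandwich, mul_assoc])

theorem hilb_sandwich_le (a b : Matrix (Fin n) (Fin n) L) (A B : Set (Fin n × Fin n → L)) (t : ℕ) :
    hilb (Set.image2 (sandwich a b) A B) t ≤ hilb A t * hilb B t :=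
  hilb_image2_le A B (sandwich a b)
    (fun z => matPt (constMat (a * ptMat z * b) * coordMat n L))
    (fun y => matPt (constMat a * coordMat n L * constMat (b * ptMat y)))
    (fun z y r => by simp [aeval_matPt, sandwich])
    (fun z y r => by simp [aeval_matPt, sandwich, mul_assoc])
    (fun z r => ((matDegreeLE_constMat _).mul matDegreeLE_coordMat _ _).trans (by simp))
    (fun y r => (((matDegreeLE_constMat _).mul matDegreeLE_coordMat).mul
      (matDegreeLE_constMat _) _ _).trans (by simp)) t

theorem irreducible_closure_sandwich [IsAlgClosed L] (a b : Matrix (Fin n) (Fin n) L)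
    {A B : Set (Fin n × Fin n → L)} (hA : IsIrreducibleVariety A) (hB : IsIrreducibleVariety B) :
    IsIrreducibleVariety (zariskiClosure (Set.image2 (sandwich a b) A B)) := by
  refine isIrreducibleVariety_iff.2 ⟨isVarietyOver_zariskiClosure _, ?_⟩
  rw [vanishingIdeal_zariskiClosure]
  exact isPrime_vanishingIdeal_sandwich a b hA.isPrime hB.isPrime

variable {K : Type*} [Field K] [Algebra K L]

/-- The action of a field automorphism on `SL_n`. -/
def galoisSL (τ : L ≃ₐ[K] L) : Matrix.SpecialLinearGroup (Fin n) L →* Matrix.SpecialLinearGroup (Fin n) L :=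
  Matrix.SpecialLinearGroup.map (τ : L →+* L)

theorem galoisEquiv_slPt (τ : L ≃ₐ[K] L) (g : Matrix.SpecialLinearGroup (Fin n) L) :
    galoisEquiv τ (slPt g) = slPt (galoisSL τ g) := rfl

@[simp] theorem galoisSL_galoisSL (τ τ' : L ≃ₐ[K] L) (g : Matrix.SpecialLinearGroup (Fin n) L) :
    galoisSL τ (galoisSL τ' g) = galoisSL (τ * τ') g := rfl

@[simp] theorem galoisSL_one (g : Matrix.SpecialLinearGroup (Fin n) L) :
    galoisSL (1 : L ≃ₐ[K] L) g = g := rfl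

theorem galoisSL_mem (τ : L ≃ₐ[K] L) {S : Set (Matrix.SpecialLinearGroup (Fin n) L)}
    (hS : IsVarietyOver K (matrixPoints S)) {g : Matrix.SpecialLinearGroup (Fin n) L} (hg : g ∈ S) :
    galoisSL τ g ∈ S := by
  rw [← slPt_mem_matrixPoints, ← galoisEquiv_slPt]
  exact hS.algEquiv_mem τ (slPt_mem_matrixPoints.2 hg)

theorem galoisEquiv_image (τ : L ≃ₐ[K] L) (S : Set (Matrix.SpecialLinearGroup (Fin n) L)) :
    galoisEquiv τ '' matrixPoints S = matrixPoints (galoisSL τ '' S) := by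
  rw [matrixPoints, matrixPoints, Set.image_image, Set.image_image]
  rfl

end MatrixPoints

/-! ### Stabilisers in an almost simple group. -/

section AlmostSimple

open MvPolynomial

variable {n : ℕ} {K L : Type*} [Field K] [Field L] [Algebra K L]

theorem galoisSL_symm_mem_image_iff (τ : L ≃ₐ[K] L)
    {Y : Set (Matrix.SpecialLinearGroup (Fin n) L)} {h y : Matrix.SpecialLinearGroup (Fin n) L} :
    h * galoisSL τ.symm y ∈ galoisSL τ.symm '' Y ↔ galoisSL τ h * y ∈ Y := by
  have h1 : ∀ g : Matrix.SpecialLinearGroup (Fin n) L, galoisSL τ (galoisSL τ.symm g) = g :=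
    fun g => by ext; simp [galoisSL]
  have h2 : ∀ g : Matrix.SpecialLinearGroup (Fin n) L, galoisSL τ.symm (galoisSL τ g) = g :=
    fun g => by ext; simp [galoisSL]
  constructor
  · rintro ⟨z, hz, hzy⟩
    have := congrArg (galoisSL τ) hzy
    rw [h1, map_mul, h1] at this
    rwa [← this]
  · intro h3
    exact ⟨_, h3, by rw [map_mul, h2]⟩

/-- The elements of `G` all of whose conjugates under `G` and under the automorphisms of `L`
over `K` stabilise `Y` form a subgroup. -/
def conjStabilizer (K : Type*) [Field K] [Algebra K L]
    (G : Subgroup (Matrix.SpecialLinearGroup (Fin n) L))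
    (Y : Set (Matrix.SpecialLinearGroup (Fin n) L)) :
    Subgroup (Matrix.SpecialLinearGroup (Fin n) L) where
  carrier := {h | h ∈ G ∧ ∀ τ : L ≃ₐ[K] L, ∀ g ∈ G, ∀ y ∈ Y,
    galoisSL τ (g * h * g⁻¹) * y ∈ Y ∧ galoisSL τ (g * h⁻¹ * g⁻¹) * y ∈ Y}
  one_mem' := ⟨G.one_mem, fun τ g _ y hy => by simpa using hy⟩
  mul_mem' := by
    rintro a b ⟨ha, ha'⟩ ⟨hb, hb'⟩
    refine ⟨G.mul_mem ha hb, fun τ g hg y hy => ⟨?_, ?_⟩⟩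
    · have := (ha' τ g hg _ (hb' τ g hg y hy).1).1
      rw [← mul_assoc, ← map_mul] at this
      convert! this using 3
      group
    · have := (hb' τ g hg _ (ha' τ g hg y hy).2).2
      rw [← mul_assoc, ← map_mul] at this
      convert! this using 3
      group
  inv_mem' := by
    rintro a ⟨ha, ha'⟩
    refine ⟨G.inv_mem ha, fun τ g hg y hy => ⟨(ha' τ g hg y hy).2, ?_⟩⟩
    rw [inv_inv]
    exact (ha' τ g hg y hy).1

/-- Moving `τ` over to `Y` makes every single condition polynomial in `h`, with the inverse in
`SL_n` given by the adjugate. The stabiliser is the intersection of these closed conditions. -/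
theorem isVarietyOver_conjStabilizer {G : Subgroup (Matrix.SpecialLinearGroup (Fin n) L)}
    (hG : IsVarietyOver L (matrixPoints (G : Set (Matrix.SpecialLinearGroup (Fin n) L))))
    {Y : Set (Matrix.SpecialLinearGroup (Fin n) L)} (hY : IsVarietyOver L (matrixPoints Y)) :
    IsVarietyOver L (matrixPoints
      (conjStabilizer K G Y : Set (Matrix.SpecialLinearGroup (Fin n) L))) := by
  have hτ : ∀ τ : L ≃ₐ[K] L, IsVarietyOver L (matrixPoints (galoisSL τ '' Y)) := fun τ => by
    rw [← galoisEquiv_image]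
    exact (isVarietyOver_image_galoisEquiv τ _).2 hY
  have heq : matrixPoints (conjStabilizer K G Y : Set (Matrix.SpecialLinearGroup (Fin n) L)) =
      matrixPoints (G : Set (Matrix.SpecialLinearGroup (Fin n) L)) ∩
      ⋂ (τ : L ≃ₐ[K] L) (g : G) (y : Y),
        ({x | matPt (evalMat x (constMat g.1 * coordMat n L *
          constMat (g.1⁻¹ * galoisSL τ.symm y.1 : Matrix.SpecialLinearGroup (Fin n) L))) ∈
            matrixPoints (galoisSL τ.symm '' Y)} ∩
        {x | matPt (evalMat x (constMat g.1 * (coordMat n L).adjugate *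
          constMat (g.1⁻¹ * galoisSL τ.symm y.1 : Matrix.SpecialLinearGroup (Fin n) L))) ∈
            matrixPoints (galoisSL τ.symm '' Y)}) := by
    have key : ∀ h : Matrix.SpecialLinearGroup (Fin n) L, ∀ (τ : L ≃ₐ[K] L)
        (g y : Matrix.SpecialLinearGroup (Fin n) L),
        (matPt (evalMat (slPt h) (constMat g * coordMat n L *
          constMat (g⁻¹ * galoisSL τ.symm y : Matrix.SpecialLinearGroup (Fin n) L))) ∈
            matrixPoints (galoisSL τ.symm '' Y) ↔ galoisSL τ (g * h * g⁻¹) * y ∈ Y) ∧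
        (matPt (evalMat (slPt h) (constMat g * (coordMat n L).adjugate *
          constMat (g⁻¹ * galoisSL τ.symm y : Matrix.SpecialLinearGroup (Fin n) L))) ∈
            matrixPoints (galoisSL τ.symm '' Y) ↔ galoisSL τ (g * h⁻¹ * g⁻¹) * y ∈ Y) := by
      intro h τ g y
      constructor
      · rw [← galoisSL_symm_mem_image_iff, ← slPt_mem_matrixPoints]
        congr! 1
        simp [slPt, mul_assoc]
      · rw [← galoisSL_symm_mem_image_iff, ← slPt_mem_matrixPoints]
        congr! 1
        simp [slPt, mul_assoc]
    ext x
    constructor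
    · rintro ⟨h, ⟨hhG, hh⟩, rfl⟩
      refine ⟨⟨h, hhG, rfl⟩, ?_⟩
      simp only [Set.mem_iInter]
      exact fun τ g y => ⟨(key h τ g y).1.2 (hh τ g g.2 y y.2).1,
        (key h τ g y).2.2 (hh τ g g.2 y y.2).2⟩
    · rintro ⟨⟨h, hhG, rfl⟩, hx⟩
      simp only [Set.mem_iInter] at hx
      exact ⟨h, ⟨hhG, fun τ g hg y hy => ⟨(key h τ g y).1.1 (hx τ ⟨g, hg⟩ ⟨y, hy⟩).1,
        (key h τ g y).2.1 (hx τ ⟨g, hg⟩ ⟨y, hy⟩).2⟩⟩, rfl⟩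
  rw [heq]
  exact hG.inter (.iInter fun τ => .iInter fun g => .iInter fun y =>
    (isVarietyOver_setOf_evalMat (hτ _) _).inter (isVarietyOver_setOf_evalMat (hτ _) _))

/-- In an almost simple group, a closed set stable under the conjugates of a positive-dimensional
set is everything. -/
theorem eq_of_forall_conj_mul_mem [IsAlgClosed L] [Algebra.IsAlgebraic K L]
    {G : Subgroup (Matrix.SpecialLinearGroup (Fin n) L)} (hG : IsAlgebraicSubgroupOver K G)
    (hirr : IsIrreducibleVariety (matrixPoints (G : Set (Matrix.SpecialLinearGroup (Fin n) L))))
    (hsimple : IsAlmostSimpleOver K G) {E Y : Set (Matrix.SpecialLinearGroup (Fin n) L)}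
    (hEG : E ⊆ G) (hinv : ∀ e ∈ E, e⁻¹ ∈ E) (hdim : 0 < varietyDim (matrixPoints E))
    (hY : IsVarietyOver L (matrixPoints Y)) (hYG : Y ⊆ G) (hne : Y.Nonempty)
    (hstab : ∀ τ : L ≃ₐ[K] L, ∀ g ∈ G, ∀ e ∈ E, ∀ y ∈ Y, g * galoisSL τ e * g⁻¹ * y ∈ Y) :
    Y = G := by
  set H := conjStabilizer K G Y with hH
  have hGτ : ∀ τ : L ≃ₐ[K] L, ∀ g ∈ G, galoisSL τ g ∈ G := fun τ g hg => galoisSL_mem τ hG hg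
  have hHG : H ≤ G := fun h hh => hh.1
  have hHL := isVarietyOver_conjStabilizer (K := K) hirr.1 hY
  rw [← hH] at hHL
  -- Applying `σ` to an element only reindexes its conditions, with `τ * σ` in place of `τ` and the
  -- preimage of `g` under `σ` in place of `g`. So `H` is Galois-stable and descends to `K`.
  have hHK : IsAlgebraicSubgroupOver K H := by
    refine hHL.descend fun σ x hx => ?_
    obtain ⟨h, ⟨hhG, hh⟩, rfl⟩ := hx
    change galoisEquiv σ (slPt h) ∈ _
    rw [galoisEquiv_slPt, slPt_mem_matrixPoints]
    refine ⟨hGτ σ h hhG, fun τ g hg y hy => ?_⟩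
    have h1 := hh (τ * σ) (galoisSL σ.symm g) (hGτ _ _ hg) y hy
    have h2 : ∀ k, galoisSL (τ * σ) (galoisSL σ.symm g * k * (galoisSL σ.symm g)⁻¹) =
        galoisSL τ (g * galoisSL σ k * g⁻¹) := by
      intro k
      rw [← galoisSL_galoisSL]
      congr 1
      have : galoisSL σ (galoisSL σ.symm g) = g := by ext; simp [galoisSL]
      simp only [map_mul, map_inv, this]
    rw [h2, h2, map_inv] at h1
    exact h1
  have hHnormal : ∀ g ∈ G, ∀ h ∈ H, g * h * g⁻¹ ∈ H := by
    rintro g hg h ⟨hhG, hh⟩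
    refine ⟨G.mul_mem (G.mul_mem hg hhG) (G.inv_mem hg), fun τ k hk y hy => ?_⟩
    have := hh τ (k * g) (G.mul_mem hk hg) y hy
    refine ⟨?_, ?_⟩
    · convert! this.1 using 3
      group
    · convert! this.2 using 3
      group
  have hEH : E ⊆ H := by
    intro e he
    refine ⟨hEG he, fun τ g hg y hy => ⟨?_, ?_⟩⟩
    · rw [map_mul, map_mul, map_inv]
      exact hstab τ _ (hGτ τ g hg) e he y hy
    · rw [map_mul, map_mul, map_inv (galoisSL τ) g]
      exact hstab τ _ (hGτ τ g hg) _ (hinv e he) y hy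
  have hHpos := hdim.trans_le (varietyDim_mono (matrixPoints_subset_iff.2 hEH))
  -- `H` is normal, defined over `K` and contains the positive-dimensional `E`, so almost simplicity
  -- leaves only full dimension. Irreducibility of `G` then gives `H = G`.
  have hHdim : varietyDim (matrixPoints (H : Set (Matrix.SpecialLinearGroup (Fin n) L))) =
      varietyDim (matrixPoints (G : Set (Matrix.SpecialLinearGroup (Fin n) L))) :=
    (varietyDim_mono (matrixPoints_subset_iff.2 hHG)).antisymm
      (not_lt.1 fun hlt => hsimple H hHK hHG hHnormal ⟨hHpos, hlt⟩)
  have hHeq : (H : Set (Matrix.SpecialLinearGroup (Fin n) L)) = G := by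
    obtain ⟨Z, hZ, hZd⟩ := hHL.exists_varietyComponent_varietyDim_eq ⟨_, 1, H.one_mem, rfl⟩
    have hZG := hZ.1.2.trans (matrixPoints_subset_iff.2 hHG)
    rw [hHdim, hZ.1.1.varietyDim_eq, hirr.varietyDim_eq] at hZd
    have hZd' := hZ.1.1.eq_of_coordTrdeg_le hirr hZG (by exact_mod_cast hZd.ge)
    rw [hZd'] at hZ
    exact Set.Subset.antisymm hHG (matrixPoints_subset_iff.1 hZ.1.2)
  refine Set.Subset.antisymm hYG fun g hg => ?_
  obtain ⟨y, hy⟩ := hne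
  have h1 : g * y⁻¹ ∈ (H : Set (Matrix.SpecialLinearGroup (Fin n) L)) := by
    rw [hHeq]
    exact G.mul_mem hg (G.inv_mem (hYG hy))
  have := (h1.2 1 1 G.one_mem y hy).1
  simpa using this

end AlmostSimple

/-! ### Bounding the complexity of an almost simple group. -/

section Growth

open MvPolynomial

variable {n : ℕ} {K L : Type*} [Field K] [Field L] [Algebra K L]

theorem hilbBound_singleton {σ : Type*} (x : σ → L) : HilbBound 1 {x} := by
  intro t
  rw [one_mul, coordTrdeg_singleton, pow_zero, hilb]
  refine (Submodule.finrank_le _).trans ?_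
  rw [Module.finrank_fintype_fun_eq_card]
  simp

theorem slPt_mul_eq_sandwich (a z b y : Matrix.SpecialLinearGroup (Fin n) L) :
    sandwich (a : Matrix (Fin n) (Fin n) L) (b : Matrix (Fin n) (Fin n) L) (slPt z) (slPt y) =
      slPt (a * z * b * y) := by
  simp [sandwich, slPt]

theorem galoisEquiv_image_eq {σ : Type*} (τ : L ≃ₐ[K] L) {V : Set (σ → L)}
    (hV : IsVarietyOver K V) : galoisEquiv τ '' V = V := by
  refine Set.Subset.antisymm ?_ fun x hx => ⟨_, hV.algEquiv_mem τ.symm hx, ?_⟩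
  · rintro _ ⟨x, hx, rfl⟩
    exact hV.algEquiv_mem τ hx
  · ext i
    simp

variable [IsAlgClosed L]

omit [IsAlgClosed L] in
-- The set of quotients contains the translate `x⁻¹ X` for any `x` in `X`.
theorem varietyDim_leftQuotients_pos {X : Set (Matrix.SpecialLinearGroup (Fin n) L)}
    (hne : X.Nonempty) (hX : 0 < varietyDim (matrixPoints X)) :
    0 < varietyDim (matrixPoints (Set.image2 (fun x y => x⁻¹ * y) X X)) := by
  obtain ⟨x, hx⟩ := hne
  rw [← varietyDim_image (leftMulEquiv x⁻¹) (isVarietyOver_image_leftMulEquiv x⁻¹),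
    leftMulEquiv_image] at hX
  refine hX.trans_le (varietyDim_mono (matrixPoints_subset_iff.2 ?_))
  rintro _ ⟨y, hy, rfl⟩
  exact ⟨x, hx, y, hy, rfl⟩

theorem inv_mem_leftQuotients {Γ : Type*} [Group Γ] {X : Set Γ} {e : Γ}
    (he : e ∈ Set.image2 (fun x y => x⁻¹ * y) X X) : e⁻¹ ∈ Set.image2 (fun x y => x⁻¹ * y) X X := by
  obtain ⟨x, hx, y, hy, rfl⟩ := he
  exact ⟨y, hy, x, hx, by group⟩

theorem leftQuotients_subset {Γ : Type*} [Group Γ] {G : Subgroup Γ} {X : Set Γ}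
    (hX : X ⊆ G) : Set.image2 (fun x y => x⁻¹ * y) X X ⊆ G := by
  rintro _ ⟨x, hx, y, hy, rfl⟩
  exact G.mul_mem (G.inv_mem (hX hx)) (hX hy)

variable [Algebra.IsAlgebraic K L]

/-- If `Y` is not yet `G`, some conjugate of a quotient of two points of the curve moves `Y`. The
closure of `g τ(x⁻¹ X) g⁻¹ Y` is then irreducible and strictly larger than `Y`, while its Hilbert
function is at most the product of those of the curve and of `Y`. So the dimension rises by exactly
one. -/
theorem exists_irreducible_subset_of_curve
    {G : Subgroup (Matrix.SpecialLinearGroup (Fin n) L)} (hG : IsAlgebraicSubgroupOver K G)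
    (hirr : IsIrreducibleVariety (matrixPoints (G : Set (Matrix.SpecialLinearGroup (Fin n) L))))
    (hsimple : IsAlmostSimpleOver K G) {X : Set (Matrix.SpecialLinearGroup (Fin n) L)} (hXG : X ⊆ G)
    (hX : IsIrreducibleVariety (matrixPoints X)) (hX1 : coordTrdeg (matrixPoints X) = 1) {c : ℕ}
    (hc : HilbBound c (matrixPoints X)) (d : ℕ)
    (hd : d ≤ coordTrdeg (matrixPoints (G : Set (Matrix.SpecialLinearGroup (Fin n) L)))) :
    ∃ Y ⊆ matrixPoints (G : Set (Matrix.SpecialLinearGroup (Fin n) L)),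
      IsIrreducibleVariety Y ∧ coordTrdeg Y = d ∧ HilbBound (c ^ d) Y := by
  induction d with
  | zero =>
    refine ⟨{slPt 1}, ?_, isIrreducibleVariety_singleton _, coordTrdeg_singleton _, ?_⟩
    · exact Set.singleton_subset_iff.2 (slPt_mem_matrixPoints.2 G.one_mem)
    · exact hilbBound_singleton _
  | succ d ih =>
    obtain ⟨Y, hYG, hY, hYd, hYc⟩ := ih (by omega)
    obtain ⟨T, hTG, rfl⟩ := exists_matrixPoints_eq hYG
    obtain ⟨τ, g, hg, x, hx, z, hz, y, hy, hnot⟩ : ∃ τ : L ≃ₐ[K] L, ∃ g ∈ G, ∃ x ∈ X, ∃ z ∈ X,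
        ∃ y ∈ T, g * galoisSL τ (x⁻¹ * z) * g⁻¹ * y ∉ T := by
      by_contra! hstab
      have hXne : X.Nonempty := Set.image_nonempty.1 hX.2.1
      have := eq_of_forall_conj_mul_mem hG hirr hsimple (leftQuotients_subset hXG)
        (fun e => inv_mem_leftQuotients)
        (varietyDim_leftQuotients_pos hXne (by
          rw [hX.varietyDim_eq, hX1]
          exact_mod_cast Nat.one_pos))
        hY.1 hTG (Set.image_nonempty.1 hY.2.1) (by
          rintro τ g hg _ ⟨x, hx, z, hz, rfl⟩ y hy
          exact hstab τ g hg x hx z hz y hy)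
      rw [this] at hYd
      omega
    set a := g * galoisSL τ x⁻¹ with ha
    set A := galoisEquiv τ '' matrixPoints X with hA
    have hAirr : IsIrreducibleVariety A :=
      hX.image (galoisEquiv τ) (isVarietyOver_image_galoisEquiv τ)
    have hsub : Set.image2 (sandwich (a : Matrix (Fin n) (Fin n) L)
        (↑g⁻¹ : Matrix (Fin n) (Fin n) L)) A (matrixPoints T) ⊆
          matrixPoints (G : Set (Matrix.SpecialLinearGroup (Fin n) L)) := by
      rintro _ ⟨_, ⟨_, ⟨w, hw, rfl⟩, rfl⟩, _, ⟨v, hv, rfl⟩, rfl⟩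
      change sandwich _ _ (galoisEquiv τ (slPt w)) (slPt v) ∈ _
      rw [galoisEquiv_slPt, slPt_mul_eq_sandwich, slPt_mem_matrixPoints]
      exact G.mul_mem (G.mul_mem (G.mul_mem (G.mul_mem hg (galoisSL_mem τ hG
        (G.inv_mem (hXG hx)))) (galoisSL_mem τ hG (hXG hw))) (G.inv_mem hg)) (hTG hv)
    have hmem : ∀ w ∈ X, ∀ v ∈ T, slPt (g * galoisSL τ (x⁻¹ * w) * g⁻¹ * v) ∈
        zariskiClosure (Set.image2 (sandwich (a : Matrix (Fin n) (Fin n) L)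
          (↑g⁻¹ : Matrix (Fin n) (Fin n) L)) A (matrixPoints T)) := by
      intro w hw v hv
      refine subset_zariskiClosure _ ⟨_, ⟨_, ⟨w, hw, rfl⟩, rfl⟩, _, ⟨v, hv, rfl⟩, ?_⟩
      change sandwich _ _ (galoisEquiv τ (slPt w)) (slPt v) = _
      rw [galoisEquiv_slPt, slPt_mul_eq_sandwich, ha, map_mul]
      simp only [mul_assoc]
    set Y' := zariskiClosure (Set.image2 (sandwich (a : Matrix (Fin n) (Fin n) L)
        (↑g⁻¹ : Matrix (Fin n) (Fin n) L)) A (matrixPoints T)) with hY'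
    have hY'irr : IsIrreducibleVariety Y' := irreducible_closure_sandwich _ _ hAirr hY
    have hhilb : ∀ t, hilb Y' t ≤ c ^ (d + 1) * (t + 1) ^ (d + 1) := by
      intro t
      rw [hY', hilb_zariskiClosure]
      refine (hilb_sandwich_le _ _ A _ t).trans ?_
      have h1 := (hilb_image_galoisEquiv_le τ (matrixPoints X) t).trans (hc t)
      have h2 := hYc t
      rw [hX1] at h1
      rw [hYd] at h2
      refine (Nat.mul_le_mul h1 h2).trans (le_of_eq ?_)
      ring
    have hle := hY'irr.coordTrdeg_le_of_hilb_le hhilb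
    have hlt : matrixPoints T ⊂ Y' := by
      refine ⟨?_, fun h => hnot ?_⟩
      · rintro _ ⟨v, hv, rfl⟩
        -- At the point `x` of the curve the left factor is the identity, so the new variety
        -- contains the old one.
        have := hmem x hx v hv
        rw [inv_mul_cancel, map_one, mul_one, mul_inv_cancel, one_mul] at this
        exact this
      · exact slPt_mem_matrixPoints.1 (h (hmem z hz y hy))
    have hlt' := hY.coordTrdeg_lt hY'irr hlt
    have heq : coordTrdeg Y' = d + 1 := by omega
    refine ⟨Y', zariskiClosure_subset hirr.1 hsub, hY'irr, heq, fun t => ?_⟩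
    rw [heq]
    exact hhilb t

/-- The complexity of an almost simple group is bounded by that of a positive-dimensional
irreducible subvariety. -/
theorem HilbBound.of_subset_almostSimple
    {G : Subgroup (Matrix.SpecialLinearGroup (Fin n) L)} (hG : IsAlgebraicSubgroupOver K G)
    (hirr : IsIrreducibleVariety (matrixPoints (G : Set (Matrix.SpecialLinearGroup (Fin n) L))))
    (hsimple : IsAlmostSimpleOver K G) {Z : Set (Fin n × Fin n → L)}
    (hZG : Z ⊆ matrixPoints (G : Set (Matrix.SpecialLinearGroup (Fin n) L)))
    (hZ : IsIrreducibleVariety Z) (hZ0 : coordTrdeg Z ≠ 0) {c : ℕ} (hc0 : 0 < c)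
    (hc : HilbBound c Z) :
    HilbBound ((c * 2 ^ (n * n * (n * n))) ^ (n * n))
      (matrixPoints (G : Set (Matrix.SpecialLinearGroup (Fin n) L))) := by
  have hcard : Nat.card (Fin n × Fin n) = n * n := by simp
  obtain ⟨X, hXZ, hX, hX1, hXc⟩ := hZ.exists_curve hZ0 hc
  obtain ⟨T, hTG, rfl⟩ := exists_matrixPoints_eq (hXZ.trans hZG)
  have hXc' : HilbBound (c * 2 ^ (n * n * (n * n))) (matrixPoints T) := by
    refine hXc.mono (Nat.mul_le_mul_left _ (Nat.pow_le_pow_right two_pos ?_))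
    have := hZ.coordTrdeg_le_card
    rw [hcard] at this ⊢
    exact Nat.mul_le_mul_left _ this
  obtain ⟨Y, hYG, hY, hYd, hYc⟩ :=
    exists_irreducible_subset_of_curve hG hirr hsimple hTG hX hX1 hXc' _ le_rfl
  obtain rfl := hY.eq_of_coordTrdeg_le hirr hYG hYd.ge
  refine hYc.mono (Nat.pow_le_pow_right (by positivity) ?_)
  have := hirr.coordTrdeg_le_card
  rwa [hcard] at this

end Growth

/-! ### The exceptional subvariety, its properness and its complexity. -/

section Obstruction

open MvPolynomial

variable {n : ℕ} {K L : Type*} [Field K] [Field L] [Algebra K L]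

/-- The elements `g` of `G` for which the conjugates by `g` of the quotients `x⁻¹ y` of two points
of a component of `V'` fail to move a component of `V` of largest dimension out of the zero set
of its equations of degree at most `D`. -/
def growthObstruction (D : ℕ) (G V' V : Set (Matrix.SpecialLinearGroup (Fin n) L)) :
    Set (Matrix.SpecialLinearGroup (Fin n) L) :=
  {g | g ∈ G ∧ ∀ X ∈ varietyComponents (matrixPoints V'), ∀ x y, slPt x ∈ X → slPt y ∈ X →
    ∀ Z ∈ varietyComponents (matrixPoints V), varietyDim Z = varietyDim (matrixPoints V) →
      ∀ f ∈ vanishingIdeal L Z, f.totalDegree ≤ D → ∀ v, slPt v ∈ Z →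
        aeval (slPt (g⁻¹ * (x⁻¹ * y) * g * v)) f = 0}

/-- The polynomial `g ↦ f (g⁻¹ a g v)` on `SL_n`. -/
noncomputable def conjPoly (a v : Matrix.SpecialLinearGroup (Fin n) L)
    (f : MvPolynomial (Fin n × Fin n) L) : MvPolynomial (Fin n × Fin n) L :=
  aeval (matPt ((coordMat n L).adjugate * constMat a * coordMat n L * constMat v)) f

theorem aeval_conjPoly (a v g : Matrix.SpecialLinearGroup (Fin n) L)
    (f : MvPolynomial (Fin n × Fin n) L) :
    aeval (slPt g) (conjPoly a v f) = aeval (slPt (g⁻¹ * a * g * v)) f := by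
  rw [conjPoly, comp_aeval_apply]
  congr 2
  ext p
  simp [aeval_matPt, slPt]

theorem MatDegreeLE.totalDegree_aeval_le
    {M : Matrix (Fin n) (Fin n) (MvPolynomial (Fin n × Fin n) L)} {d : ℕ} (hM : MatDegreeLE M d)
    (f : MvPolynomial (Fin n × Fin n) L) :
    (aeval (matPt M) f : MvPolynomial (Fin n × Fin n) L).totalDegree ≤ d * f.totalDegree := by
  have h : ∀ p, (matPt M p).totalDegree ≤ d := fun p => hM p.1 p.2
  exact _root_.totalDegree_aeval_le (matPt M) h f

theorem totalDegree_conjPoly_le (a v : Matrix.SpecialLinearGroup (Fin n) L)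
    (f : MvPolynomial (Fin n × Fin n) L) :
    (conjPoly a v f).totalDegree ≤ (n + 1) * f.totalDegree := by
  have h := ((matDegreeLE_adjugate.mul (matDegreeLE_constMat (a : Matrix (Fin n) (Fin n) L))).mul
    matDegreeLE_coordMat).mul (matDegreeLE_constMat (v : Matrix (Fin n) (Fin n) L))
  rw [add_zero, add_zero] at h
  rw [conjPoly]
  exact h.totalDegree_aeval_le f

/-- The degree bound comes from the expression `g⁻¹ a g v`, whose entries have degree at most `n +
1` in `g`: `n` for the adjugate and `1` for `g`. -/
theorem matrixPoints_growthObstruction (D : ℕ)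
    (G V' V : Set (Matrix.SpecialLinearGroup (Fin n) L)) :
    ∃ S : Set (MvPolynomial (Fin n × Fin n) L), (∀ p ∈ S, p.totalDegree ≤ (n + 1) * D) ∧
      matrixPoints (growthObstruction D G V' V) =
        matrixPoints G ∩ {z | ∀ p ∈ S, aeval z p = 0} := by
  refine ⟨{p | ∃ X ∈ varietyComponents (matrixPoints V'), ∃ x y, slPt x ∈ X ∧ slPt y ∈ X ∧
    ∃ Z ∈ varietyComponents (matrixPoints V), varietyDim Z = varietyDim (matrixPoints V) ∧
      ∃ f ∈ vanishingIdeal L Z, f.totalDegree ≤ D ∧ ∃ v, slPt v ∈ Z ∧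
        conjPoly (x⁻¹ * y) v f = p}, ?_, ?_⟩
  · rintro _ ⟨X, hX, x, y, hx, hy, Z, hZ, hZd, f, hf, hfD, v, hv, rfl⟩
    exact (totalDegree_conjPoly_le _ _ _).trans (Nat.mul_le_mul_left _ hfD)
  · ext z
    constructor
    · rintro ⟨g, ⟨hg, h⟩, rfl⟩
      refine ⟨⟨g, hg, rfl⟩, ?_⟩
      rintro _ ⟨X, hX, x, y, hx, hy, Z, hZ, hZd, f, hf, hfD, v, hv, rfl⟩
      exact (aeval_conjPoly _ _ g f).trans (h X hX x y hx hy Z hZ hZd f hf hfD v hv)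
    · rintro ⟨⟨g, hg, rfl⟩, h⟩
      refine ⟨g, ⟨hg, fun X hX x y hx hy Z hZ hZd f hf hfD v hv => ?_⟩, rfl⟩
      rw [← aeval_conjPoly]
      exact h _ ⟨X, hX, x, y, hx, hy, Z, hZ, hZd, f, hf, hfD, v, hv, rfl⟩

theorem galoisEquiv_image_mem_varietyComponents {σ : Type*} (τ : L ≃ₐ[K] L) {V Z : Set (σ → L)}
    (hV : IsVarietyOver K V) (hZ : Z ∈ varietyComponents V) :
    galoisEquiv τ '' Z ∈ varietyComponents V := by
  have := image_mem_varietyComponents (galoisEquiv τ) (isVarietyOver_image_galoisEquiv τ) hZ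
  rwa [galoisEquiv_image_eq τ hV] at this

theorem galoisSL_symm_apply (τ : L ≃ₐ[K] L) (g : Matrix.SpecialLinearGroup (Fin n) L) :
    galoisSL τ (galoisSL τ.symm g) = g := by
  ext
  simp [galoisSL]

/-- A Galois automorphism permutes the components of `V'` and `V`, and preserves dimensions and the
degrees of equations, so it only permutes the conditions. -/
theorem galoisSL_mem_growthObstruction (D : ℕ) {G V' V : Set (Matrix.SpecialLinearGroup (Fin n) L)}
    (hG : IsVarietyOver K (matrixPoints G)) (hV' : IsVarietyOver K (matrixPoints V'))
    (hV : IsVarietyOver K (matrixPoints V)) (τ : L ≃ₐ[K] L)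
    {g : Matrix.SpecialLinearGroup (Fin n) L} (hg : g ∈ growthObstruction D G V' V) :
    galoisSL τ g ∈ growthObstruction D G V' V := by
  refine ⟨galoisSL_mem τ hG hg.1, fun X hX x y hx hy Z hZ hZd f hf hfD v hv => ?_⟩
  have hsymm : ∀ {Y : Set (Fin n × Fin n → L)} {u}, slPt u ∈ Y →
      slPt (galoisSL τ.symm u) ∈ galoisEquiv τ.symm '' Y := fun {Y u} hu => ⟨_, hu, rfl⟩
  have h := hg.2 _ (galoisEquiv_image_mem_varietyComponents τ.symm hV' hX) _ _ (hsymm hx)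
    (hsymm hy) _ (galoisEquiv_image_mem_varietyComponents τ.symm hV hZ)
    ((varietyDim_image _ (isVarietyOver_image_galoisEquiv τ.symm) Z).trans hZd)
    (map (τ.symm : L →+* L) f) ?_ ((Finset.sup_mono (support_map_subset _ _)).trans hfD) _ (hsymm hv)
  · have h1 : slPt (g⁻¹ * ((galoisSL τ.symm x)⁻¹ * galoisSL τ.symm y) * g * galoisSL τ.symm v) =
        galoisEquiv τ.symm
          (slPt ((galoisSL τ g)⁻¹ * (x⁻¹ * y) * galoisSL τ g * v)) := by
      rw [galoisEquiv_slPt]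
      simp only [map_mul, map_inv]
      have : galoisSL τ.symm (galoisSL τ g) = g := galoisSL_symm_apply τ.symm g
      rw [this]
    rw [h1, aeval_galoisEquiv_map] at h
    exact (map_eq_zero_iff _ τ.symm.injective).1 h
  · rw [mem_vanishingIdeal_iff] at hf ⊢
    rintro _ ⟨z, hz, rfl⟩
    rw [aeval_galoisEquiv_map, hf z hz, map_zero]

variable [IsAlgClosed L] [Algebra.IsAlgebraic K L]

theorem isVarietyOver_growthObstruction (D : ℕ) {G V' V : Set (Matrix.SpecialLinearGroup (Fin n) L)}
    (hG : IsVarietyOver K (matrixPoints G)) (hV' : IsVarietyOver K (matrixPoints V'))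
    (hV : IsVarietyOver K (matrixPoints V)) :
    IsVarietyOver K (matrixPoints (growthObstruction D G V' V)) := by
  obtain ⟨S, -, hS⟩ := matrixPoints_growthObstruction D G V' V
  refine IsVarietyOver.descend (K := K) ?_ ?_
  · rw [hS]
    exact hG.baseChange.inter ⟨S, rfl⟩
  · rintro τ _ ⟨g, hg, rfl⟩
    exact slPt_mem_matrixPoints.2 (galoisSL_mem_growthObstruction D hG hV' hV τ hg)

/-- If nothing were excluded, the common zeros in `G` of the low-degree equations of a top component
would be stable under a normal family of positive dimension and hence fill `G`. One equation of
degree at most `D` that is nonzero on `G` rules this out. -/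
theorem growthObstruction_ssubset {G : Subgroup (Matrix.SpecialLinearGroup (Fin n) L)}
    (hG : IsAlgebraicSubgroupOver K G)
    (hirr : IsIrreducibleVariety (matrixPoints (G : Set (Matrix.SpecialLinearGroup (Fin n) L))))
    (hsimple : IsAlmostSimpleOver K G) {V' V : Set (Matrix.SpecialLinearGroup (Fin n) L)}
    (hV' : IsVarietyOver K (matrixPoints V')) (hV : IsVarietyOver K (matrixPoints V))
    (hV'G : V' ⊆ G) (hVG : V ⊂ G) (hne : V.Nonempty) (hne' : V'.Nonempty)
    (hpos : 0 < varietyDim (matrixPoints V')) {D : ℕ}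
    (hD : ∀ Z ∈ varietyComponents (matrixPoints V), ∃ k ≤ D, HasVarietyDegree Z k) :
    growthObstruction D G V' V ⊂ G := by
  refine ⟨fun g hg => hg.1, fun hGW => ?_⟩
  obtain ⟨X₀, hX₀, hX₀d⟩ :=
    hV'.baseChange.exists_varietyComponent_varietyDim_eq (hne'.image _)
  obtain ⟨Z, hZ, hZd⟩ := hV.baseChange.exists_varietyComponent_varietyDim_eq (hne.image _)
  obtain ⟨X, hXV', rfl⟩ := exists_matrixPoints_eq hX₀.1.2
  obtain ⟨T, hTV, rfl⟩ := exists_matrixPoints_eq hZ.1.2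
  obtain ⟨k, hkD, hk⟩ := hD _ hZ
  have hTG : matrixPoints T ⊂ matrixPoints (G : Set (Matrix.SpecialLinearGroup (Fin n) L)) := by
    refine ⟨matrixPoints_subset_iff.2 (hTV.trans hVG.1), fun h => hVG.2 ?_⟩
    exact (matrixPoints_subset_iff.1 h).trans hTV
  set I : Set (MvPolynomial (Fin n × Fin n) L) :=
    {f | f ∈ vanishingIdeal L (matrixPoints T) ∧ f.totalDegree ≤ D} with hI
  obtain ⟨Y, hYG, hY⟩ := exists_matrixPoints_eq (Set.inter_subset_left (s := matrixPoints
    (G : Set (Matrix.SpecialLinearGroup (Fin n) L))) (t := {z | ∀ p ∈ I, aeval z p = 0}))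
  have hYmem : ∀ h, h ∈ Y ↔ h ∈ G ∧ ∀ f ∈ vanishingIdeal L (matrixPoints T),
      f.totalDegree ≤ D → aeval (slPt h) f = 0 := by
    intro h
    rw [← slPt_mem_matrixPoints, hY, Set.mem_inter_iff, slPt_mem_matrixPoints]
    exact and_congr_right fun _ => ⟨fun h f hf hfD => h f ⟨hf, hfD⟩, fun h f hf => h f hf.1 hf.2⟩
  have hTY : T ⊆ Y := fun t ht => (hYmem t).2 ⟨hVG.1 (hTV ht), fun f hf _ =>
    (mem_vanishingIdeal_iff.1 hf) _ (slPt_mem_matrixPoints.2 ht)⟩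
  have hYeq : Y = G := by
    refine eq_of_forall_conj_mul_mem hG hirr hsimple
      (leftQuotients_subset (hXV'.trans hV'G)) (fun e => inv_mem_leftQuotients)
      (varietyDim_leftQuotients_pos (Set.image_nonempty.1 hX₀.1.1.2.1) (hX₀d ▸ hpos)) ?_ hYG
      ((Set.image_nonempty.1 hZ.1.1.2.1).mono hTY) ?_
    · rw [hY]
      exact hirr.1.inter ⟨I, rfl⟩
    · rintro τ g hg _ ⟨x, hx, y, hy, rfl⟩ v hv
      rw [hYmem] at hv ⊢
      refine ⟨G.mul_mem (G.mul_mem (G.mul_mem hg (galoisSL_mem τ hG (G.mul_mem (G.inv_mem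
        (hV'G (hXV' hx))) (hV'G (hXV' hy))))) (G.inv_mem hg)) hv.1, fun f hf hfD => ?_⟩
      -- Left translation does not raise the degree of `f`. If the translated polynomial still
      -- vanishes on `T`, it is one of the equations defining `Y`, and evaluating it at `v` proves
      -- stability.
      have htrans : ∀ h w : Matrix.SpecialLinearGroup (Fin n) L,
          aeval (slPt w) (aeval (matPt (constMat h * coordMat n L)) f :
            MvPolynomial (Fin n × Fin n) L) = aeval (slPt (h * w)) f := by
        intro h w
        rw [comp_aeval_apply]
        congr 2
        ext p
        simp [aeval_matPt, slPt]
      rw [← htrans]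
      refine hv.2 _ ?_ ?_
      · rw [mem_vanishingIdeal_iff]
        rintro _ ⟨t, ht, rfl⟩
        refine (htrans _ t).trans ?_
        -- The obstruction is phrased with `g⁻¹ a g`, so the conjugate `g a g⁻¹` is obtained from
        -- the inverse.
        have := (hGW (G.inv_mem hg)).2 _ (galoisEquiv_image_mem_varietyComponents τ hV' hX₀)
          (galoisSL τ x) (galoisSL τ y) ⟨_, ⟨x, hx, rfl⟩, rfl⟩ ⟨_, ⟨y, hy, rfl⟩, rfl⟩ _ hZ hZd
          f hf hfD t (slPt_mem_matrixPoints.2 ht)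
        rw [inv_inv, ← map_inv, ← map_mul] at this
        exact this
      · refine (totalDegree_aeval_le (d := 1) _ (fun p => ?_) f).trans (by rwa [one_mul])
        exact ((matDegreeLE_constMat _).mul matDegreeLE_coordMat p.1 p.2).trans (by simp)
  obtain ⟨F, hF, hFG, hFk⟩ := exists_mem_vanishingIdeal_of_hasVarietyDegree hZ.1.1 hirr
    (hZ.1.1.coordTrdeg_lt hirr hTG) hk
  refine hFG (mem_vanishingIdeal_iff.2 ?_)
  rintro _ ⟨g, hg, rfl⟩
  rw [← hYeq] at hg
  exact ((hYmem g).1 hg).2 F hF (hFk.trans hkD)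

omit [Algebra.IsAlgebraic K L] in
-- The failed condition says that `y g v` is outside `x g Z`, while both lie in the irreducible
-- closure of `X g Z`. A proper irreducible closed subset has smaller dimension.
theorem exists_component_of_notMem_growthObstruction
    {G V' V : Set (Matrix.SpecialLinearGroup (Fin n) L)} {D : ℕ}
    {g : Matrix.SpecialLinearGroup (Fin n) L} (hg : g ∈ G) (hgW : g ∉ growthObstruction D G V' V) :
    ∃ Z ∈ varietyComponents (zariskiClosure (matrixPoints (V' * {g} * V))),
      varietyDim (matrixPoints V) < varietyDim Z := by
  obtain ⟨X, hX, x, y, hx, hy, Z, hZ, hZd, f, hf, v, hv, hne⟩ : ∃ X ∈ varietyComponents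
      (matrixPoints V'), ∃ x y, slPt x ∈ X ∧ slPt y ∈ X ∧ ∃ Z ∈ varietyComponents (matrixPoints V),
      varietyDim Z = varietyDim (matrixPoints V) ∧ ∃ f ∈ vanishingIdeal L Z, ∃ v, slPt v ∈ Z ∧
        aeval (slPt (g⁻¹ * (x⁻¹ * y) * g * v)) f ≠ 0 := by
    by_contra! h
    exact hgW ⟨hg, fun X hX x y hx hy Z hZ hZd f hf _ v hv => h X hX x y hx hy Z hZ hZd f hf v hv⟩
  obtain ⟨A, hA, rfl⟩ := exists_matrixPoints_eq hX.1.2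
  obtain ⟨B, hB, rfl⟩ := exists_matrixPoints_eq hZ.1.2
  rw [slPt_mem_matrixPoints] at hx hy hv
  set P := Set.image2 (sandwich ((1 : Matrix.SpecialLinearGroup (Fin n) L) :
    Matrix (Fin n) (Fin n) L) (g : Matrix (Fin n) (Fin n) L)) (matrixPoints A) (matrixPoints B)
    with hP
  have hTirr : IsIrreducibleVariety (zariskiClosure P) :=
    irreducible_closure_sandwich _ _ hX.1.1 hZ.1.1
  have hmem : ∀ a ∈ A, ∀ b ∈ B, slPt (a * g * b) ∈ zariskiClosure P := fun a ha b hb =>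
    subset_zariskiClosure _ ⟨_, ⟨a, ha, rfl⟩, _, ⟨b, hb, rfl⟩, by
      refine (slPt_mul_eq_sandwich _ _ _ _).trans ?_
      rw [one_mul]⟩
  have hsub : zariskiClosure P ⊆ zariskiClosure (matrixPoints (V' * {g} * V)) := by
    refine zariskiClosure_subset (isVarietyOver_zariskiClosure _) ?_
    rintro _ ⟨_, ⟨a, ha, rfl⟩, _, ⟨b, hb, rfl⟩, rfl⟩
    refine subset_zariskiClosure _ ?_
    refine ⟨a * g * b, Set.mul_mem_mul (Set.mul_mem_mul (hA ha) rfl) (hB hb), ?_⟩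
    refine Eq.trans ?_ (slPt_mul_eq_sandwich _ _ _ _).symm
    rw [one_mul]
    rfl
  have hQ : IsIrreducibleVariety (leftMulEquiv (x * g) '' matrixPoints B) :=
    hZ.1.1.image _ (isVarietyOver_image_leftMulEquiv (x * g))
  have hlt : leftMulEquiv (x * g) '' matrixPoints B ⊂ zariskiClosure P := by
    rw [leftMulEquiv_image]
    refine ⟨?_, fun h => hne ?_⟩
    · rintro _ ⟨_, ⟨b, hb, rfl⟩, rfl⟩
      exact hmem x hx b hb
    · obtain ⟨b, hb, hbe⟩ := slPt_mem_matrixPoints.1 (h (hmem y hy v hv))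
      have : g⁻¹ * (x⁻¹ * y) * g * v = b := by
        calc g⁻¹ * (x⁻¹ * y) * g * v = (x * g)⁻¹ * (y * g * v) := by group
          _ = b := by rw [← hbe]; group
      rw [this]
      exact mem_vanishingIdeal_iff.1 hf _ (slPt_mem_matrixPoints.2 hb)
  obtain ⟨Z', hZ', hsub'⟩ :=
    (isVarietyOver_zariskiClosure _).exists_varietyComponent hTirr hsub
  refine ⟨Z', hZ', ?_⟩
  rw [← hZd, ← varietyDim_image (leftMulEquiv (x * g)) (isVarietyOver_image_leftMulEquiv (x * g)),
    hQ.varietyDim_eq]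
  refine lt_of_lt_of_le ?_ (varietyDim_mono hsub')
  rw [hTirr.varietyDim_eq]
  exact_mod_cast hQ.coordTrdeg_lt hTirr hlt

omit [Algebra.IsAlgebraic K L] in
-- Summing over all dimensions up to `m` makes both bounds independent of the dimensions of `Y` and
-- of the components.
theorem IsIrreducibleVariety.hasBoundedComponents_inter {σ : Type*} [Fintype σ] {Y : Set (σ → L)}
    (hY : IsIrreducibleVariety Y) {c d m B : ℕ} (hm : Fintype.card σ ≤ m) (hc : HilbBound c Y)
    (hB : ∑ e ∈ Finset.range (m + 1), bezoutBound d e c ≤ B) {S : Set (MvPolynomial σ L)}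
    (hS : ∀ f ∈ S, f.totalDegree ≤ d) :
    HasBoundedComponents (Y ∩ {x | ∀ f ∈ S, aeval x f = 0}) B
      (∑ e ∈ Finset.range (m + 1), bezoutBound 1 e B) := by
  have hcard : ∀ {Z : Set (σ → L)}, IsIrreducibleVariety Z →
      coordTrdeg Z ∈ Finset.range (m + 1) := fun hZ => by
    have := hZ.coordTrdeg_le_card
    rw [Nat.card_eq_fintype_card] at this
    exact Finset.mem_range.2 (by omega)
  obtain ⟨h1, h2⟩ := bezout hY rfl hc S hS
  have hle : bezoutBound d (coordTrdeg Y) c ≤ B :=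
    (Finset.single_le_sum (f := fun e => bezoutBound d e c) (fun _ _ => Nat.zero_le _)
      (hcard hY)).trans hB
  refine ⟨?_, fun Z hZ => ?_⟩
  · rw [← ((hY.1.inter ⟨S, rfl⟩).finite_varietyComponents).cast_ncard_eq]
    exact_mod_cast h1.trans hle
  · obtain ⟨k, hk, hkZ⟩ := hZ.1.1.exists_hasVarietyDegree ((h2 Z hZ).mono hle)
    exact ⟨k, hk.trans (Finset.single_le_sum (f := fun e => bezoutBound 1 e B)
      (fun _ _ => Nat.zero_le _) (hcard hZ.1.1)), hkZ⟩

theorem HasBoundedComponents.mono {L σ : Type*} [Field L] [Fintype σ] {V : Set (σ → L)}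
    {N N' D D' : ℕ} (h : HasBoundedComponents V N D) (hN : N ≤ N') (hD : D ≤ D') :
    HasBoundedComponents V N' D' :=
  ⟨h.1.trans (by exact_mod_cast hN), fun Z hZ =>
    let ⟨k, hk, hkZ⟩ := h.2 Z hZ
    ⟨k, hk.trans hD, hkZ⟩⟩

end Obstruction

theorem mainTheorem8 (n N' D' N D : ℕ) :
    ∃ C : ℕ, ∀ (K : Type*) (L : Type*) [Field K] [Field L] [Algebra K L] [IsAlgClosure K L]
      (G : Subgroup (Matrix.SpecialLinearGroup (Fin n) L)),
      IsAlgebraicSubgroupOver K G →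
      IsIrreducibleVariety (matrixPoints (G : Set (Matrix.SpecialLinearGroup (Fin n) L))) →
      IsAlmostSimpleOver K G →
      ∀ V' V : Set (Matrix.SpecialLinearGroup (Fin n) L),
        IsVarietyOver K (matrixPoints V') → IsVarietyOver K (matrixPoints V) →
        V' ⊂ G → V ⊂ G → V.Nonempty →
        0 < varietyDim (matrixPoints V') →
        HasBoundedComponents (matrixPoints V') N' D' →
        HasBoundedComponents (matrixPoints V) N D →
        ∃ W : Set (Matrix.SpecialLinearGroup (Fin n) L),
          IsVarietyOver K (matrixPoints W) ∧ W ⊂ G ∧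
          (∀ g ∈ G, g ∉ W →
            ∃ Z ∈ varietyComponents (zariskiClosure (matrixPoints (V' * {g} * V))),
              varietyDim (matrixPoints V) < varietyDim Z) ∧
          HasBoundedComponents (matrixPoints W) C C := by
  -- This bounds the complexity of `G`: the power of `D' + 1` is that of a component of `V'`, the
  -- power of `2` pays for cutting it down to a curve, and the outer exponent `n * n` bounds the
  -- number of multiplications needed to reach `G`.
  set c := ((D' + 1) ^ (n * n * (n * n)) * 2 ^ (n * n * (n * n))) ^ (n * n) with hcdef
  set B := ∑ e ∈ Finset.range (n * n + 1), bezoutBound ((n + 1) * D) e c with hBdef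
  -- The first summand bounds the number of components of `W`, the second their degrees.
  refine ⟨B + ∑ e ∈ Finset.range (n * n + 1), bezoutBound 1 e B, ?_⟩
  intro K L _ _ _ _ G hG hirr hsimple V' V hV' hV hV'G hVG hne hpos hbV' hbV
  have : IsAlgClosed L := IsAlgClosure.isAlgClosed K
  have : Algebra.IsAlgebraic K L := IsAlgClosure.isAlgebraic
  have hcard : Fintype.card (Fin n × Fin n) = n * n := by simp
  have hne' : V'.Nonempty := by
    by_contra h
    rw [Set.not_nonempty_iff_eq_empty] at h
    have : IsEmpty {Z : Set (Fin n × Fin n → L) //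
        IsIrreducibleVariety Z ∧ Z ⊆ matrixPoints V'} := by
      refine ⟨fun Z => ?_⟩
      obtain ⟨z, hz⟩ := Z.2.1.2.1
      have := Z.2.2 hz
      simp [h, matrixPoints] at this
    rw [varietyDim, Order.krullDim_eq_bot] at hpos
    exact not_lt_bot hpos
  have hc : HilbBound c (matrixPoints (G : Set (Matrix.SpecialLinearGroup (Fin n) L))) := by
    obtain ⟨X, hX, hXd⟩ :=
      hV'.baseChange.exists_varietyComponent_varietyDim_eq (hne'.image _)
    obtain ⟨k, hkD, hk⟩ := hbV'.2 X hX
    have hX0 : coordTrdeg X ≠ 0 := by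
      intro h0
      change varietyDim X = varietyDim (matrixPoints V') at hXd
      rw [← hXd, hX.1.1.varietyDim_eq, h0] at hpos
      exact lt_irrefl _ hpos
    have h1 := HilbBound.of_hasVarietyDegree hX.1.1 hk
    rw [hcard] at h1
    exact HilbBound.of_subset_almostSimple hG hirr hsimple
      (hX.1.2.trans (matrixPoints_subset_iff.2 hV'G.1)) hX.1.1 hX0 (by positivity)
      (h1.mono (Nat.pow_le_pow_left (by omega) _))
  refine ⟨growthObstruction D G V' V, isVarietyOver_growthObstruction D hG hV' hV,
    growthObstruction_ssubset hG hirr hsimple hV' hV hV'G.1 hVG hne hne' hpos hbV.2,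
    fun g hg hgW => exists_component_of_notMem_growthObstruction hg hgW, ?_⟩
  obtain ⟨S, hSd, hS⟩ := matrixPoints_growthObstruction D G V' V
  rw [hS]
  exact (hirr.hasBoundedComponents_inter hcard.le hc le_rfl hSd).mono
    (Nat.le_add_right _ _) (Nat.le_add_left _ _)
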